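/- **Theorem 4.1.** Let $d\ge 1$, write $z=(t,x,v)\in\mathbb R\times\mathbb R^d\times\mathbb R^d=\mathbb R^{1+2d}$, and put $\mathbb R^{1+2d}_T=(-\infty,T)\times\mathbb R^{2d}$ for $T\in(-\infty,\infty]$. Let $\delta\in(0,1)$ and let $a(t)=(a^{ij}(t))_{i,j=1}^d$ be bounded measurable functions of $t\in\mathbb R$ with $$\delta|\xi|^2\le a^{ij}(t)\xi_i\xi_j\le\delta^{-1}|\xi|^2\qquad\text{for all }\xi\in\mathbb R^d,\ t\in\mathbb R,$$ and let $P_0u=\partial_tu-v\cdot D_xu-a^{ij}(t)D_{v_iv_j}u$. For an open set $G\subset\mathbb R^{1+2d}$, let $S_2(G)$ be the set of real-valued $u\in L_2(G)$ whose distributional derivatives $D_vu$, $D_v^2u$ and $\partial_tu-v\cdot D_xu$ belong to $L_2(G)$. For $s\in(0,1)$ and $u \in L_2(G)$, where $G$ is a set of the form $(S,T)\times\mathbb R^{2d}$, $-\infty\le S<T\le\infty$, the distribution $(-\Delta_x)^su$ on $G$ is defined by $((-\Delta_x)^su,\phi)=(u,(-\Delta_x)^s\phi)$, $\phi\in C_0^\infty(G)$,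 where $(-\Delta_x)^s$ acts on $\phi$ in the variable $x$ as the Fourier multiplier with symbol $|k|^{2s}$. The following assertions hold. (i) There is a constant $N=N(d)$ such that for any $\lambda\ge0$, $T\in(-\infty,\infty]$ and $u\in S_2(\mathbb R^{1+2d}_T)$, the distributions $(-\Delta_x)^{1/3}u$ and $D_v(-\Delta_x)^{1/6}u$ belong to $L_2(\mathbb R^{1+2d}_T)$ and $$\lambda\|u\|+\lambda^{1/2}\|D_vu\|+\|D_v^2u\|+\|(-\Delta_x)^{1/3}u\|+\|D_v(-\Delta_x)^{1/6}u\|\le N\delta^{-1}\|P_0u+\lambda u\|,$$ where $\|\cdot\|=\|\cdot\|_{L_2(\mathbb R^{1+2d}_T)}$. (ii) For any $\lambda>0$, $T\in(-\infty,\infty]$ and $f\in L_2(\mathbb R^{1+2d}_T)$, the equation $P_0u+\lambda u=f$ (a.e. in $\mathbb R^{1+2d}_T$) has a unique solution $u\in S_2(\mathbb R^{1+2d}_T)$. (iii) For any finite $S<T$ and $f\in L_2((S,T)\times\mathbb R^{2d})$, the Cauchy problem $$P_0u=f\ \text{ in }(S,T)\times\mathbb R^{2d},\qquad u(S,\cdot)=0,$$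 has a unique solution $u\in S_2((S,T)\times\mathbb R^{2d})$; here $u$ is called a solution if there is $\widetilde u\in S_2(\mathbb R^{1+2d}_T)$ with $\widetilde u=u$ on $(S,T)\times\mathbb R^{2d}$, $\widetilde u=0$ on $(-\infty,S)\times\mathbb R^{2d}$ and $P_0\widetilde u=f$ on $(S,T)\times\mathbb R^{2d}$. In addition, $(-\Delta_x)^{1/3}u$ and $D_v(-\Delta_x)^{1/6}u$ belong to $L_2((S,T)\times\mathbb R^{2d})$ and, with $\|\cdot\|=\|\cdot\|_{L_2((S,T)\times\mathbb R^{2d})}$, $$\|u\|+\|D_vu\|+\|D_v^2u\|+\|(-\Delta_x)^{1/3}u\|+\|D_v(-\Delta_x)^{1/6}u\|+\|\partial_tu-v\cdot D_xu\|\le N\delta^{-1}\|f\|,$$ where $N=N(d,T-S)$ depends only on $d$ and $T-S$. -/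

import Mathlib

open MeasureTheory
open scoped ContDiff FourierTransform

noncomputable section

namespace KFP

/-- `ℝ^d` with its Euclidean norm. -/
abbrev Sp (d : ℕ) : Type := EuclideanSpace ℝ (Fin d)

/-- The points `z = (t, x, v)` of `ℝ^{1+2d}`. -/
abbrev Pt (d : ℕ) : Type := ℝ × Sp d × Sp d

/-- The slab `(S, T) × ℝ^{2d}`, with `S`, `T` possibly infinite. -/
def slab (d : ℕ) (S T : EReal) : Set (Pt d) :=
  {z | S < (z.1 : EReal) ∧ (z.1 : EReal) < T}

/-- The set `ℝ^{1+2d}_T = (-∞, T) × ℝ^{2d}`. -/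
abbrev past (d : ℕ) (T : EReal) : Set (Pt d) := slab d ⊥ T

/-- Lebesgue measure on `G`. -/
abbrev leb {d : ℕ} (G : Set (Pt d)) : Measure (Pt d) := (volume : Measure (Pt d)).restrict G

/-- The `L_2(G)` norm of a scalar or vector valued function, as an extended real. -/
abbrev normL2 {d : ℕ} {F : Type*} [NormedAddCommGroup F] (G : Set (Pt d)) (f : Pt d → F) :
    ENNReal :=
  eLpNorm f 2 (leb G)

/-- `φ ∈ C_0^∞(G)`. -/
structure IsTest {d : ℕ} (G : Set (Pt d)) (φ : Pt d → ℝ) : Prop where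
  smooth : ContDiff ℝ ∞ φ
  compact : HasCompactSupport φ
  supp : tsupport φ ⊆ G

/-- The classical derivative `∂_{v_i} φ`. -/
def dv {d : ℕ} (i : Fin d) (φ : Pt d → ℝ) (z : Pt d) : ℝ :=
  fderiv ℝ φ z (0, 0, EuclideanSpace.single i 1)

/-- The classical transport derivative `∂_t φ - v · D_x φ` at `z = (t, x, v)`. -/
def transport {d : ℕ} (φ : Pt d → ℝ) (z : Pt d) : ℝ :=
  fderiv ℝ φ z (1, -z.2.2, 0)

/-- The fractional Laplacian `(-Δ)^s` of a function on `ℝ^d`, through its Fourier symbol.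
With the normalization `𝓕 ψ k = ∫ exp(-2πi x·k) ψ(x) dx` the symbol of `-Δ` is `(2π|k|)^2`.
The result is real for real `ψ`, because the symbol is even. -/
def fracLap {d : ℕ} (s : ℝ) (ψ : Sp d → ℝ) (x : Sp d) : ℝ :=
  (𝓕⁻ (fun k : Sp d =>
    (((2 * Real.pi * ‖k‖) ^ (2 * s) : ℝ) : ℂ) * 𝓕 (fun y : Sp d => (ψ y : ℂ)) k) x).re

/-- `(-Δ_x)^s φ`, acting in the `x` variable only. -/
def fracLapX {d : ℕ} (s : ℝ) (φ : Pt d → ℝ) (z : Pt d) : ℝ :=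
  fracLap s (fun x => φ (z.1, x, z.2.2)) z.2.1

/-- `D_{v_i} u = g` in the sense of distributions on `G`. -/
def IsWeakDv {d : ℕ} (G : Set (Pt d)) (i : Fin d) (u g : Pt d → ℝ) : Prop :=
  ∀ φ, IsTest G φ → ∫ z in G, u z * dv i φ z = -∫ z in G, g z * φ z

/-- `∂_t u - v · D_x u = g` in the sense of distributions on `G`. -/
def IsWeakTransport {d : ℕ} (G : Set (Pt d)) (u g : Pt d → ℝ) : Prop :=
  ∀ φ, IsTest G φ → ∫ z in G, u z * transport φ z = -∫ z in G, g z * φ z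

/-- `(-Δ_x)^s u = g` in the sense of distributions on `G`. -/
def IsFracLapX {d : ℕ} (G : Set (Pt d)) (s : ℝ) (u g : Pt d → ℝ) : Prop :=
  ∀ φ, IsTest G φ → ∫ z in G, u z * fracLapX s φ z = ∫ z in G, g z * φ z

/-- `D_{v_i} (-Δ_x)^s u = g` in the sense of distributions on `G`. -/
def IsDvFracLapX {d : ℕ} (G : Set (Pt d)) (s : ℝ) (i : Fin d) (u g : Pt d → ℝ) : Prop :=
  ∀ φ, IsTest G φ → ∫ z in G, u z * fracLapX s (dv i φ) z = -∫ z in G, g z * φ z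

/-- `u ∈ S_2(G)`, where `p = D_v u`, `H = D_v^2 u` and `Y = ∂_t u - v · D_x u` (these are
determined by `u` almost everywhere on an open set `G`). The values of `p` and `H` carry the
Euclidean norm. -/
structure HasS2 {d : ℕ} (G : Set (Pt d)) (u : Pt d → ℝ) (p : Pt d → Sp d)
    (H : Pt d → EuclideanSpace ℝ (Fin d × Fin d)) (Y : Pt d → ℝ) : Prop where
  memLp_u : MemLp u 2 (leb G)
  memLp_p : MemLp p 2 (leb G)
  memLp_H : MemLp H 2 (leb G)
  memLp_Y : MemLp Y 2 (leb G)
  weak_p : ∀ i, IsWeakDv G i u (fun z => p z i)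
  weak_H : ∀ i j, IsWeakDv G i (fun z => p z j) (fun z => H z (i, j))
  weak_Y : IsWeakTransport G u Y

/-- `u ∈ S_2(G)`. -/
def MemS2 {d : ℕ} (G : Set (Pt d)) (u : Pt d → ℝ) : Prop :=
  ∃ p H Y, HasS2 G u p H Y

/-- `w = (-Δ_x)^{1/3} u` and `m = D_v (-Δ_x)^{1/6} u` on `G`, both in `L_2(G)`. -/
structure HasFrac {d : ℕ} (G : Set (Pt d)) (u w : Pt d → ℝ) (m : Pt d → Sp d) : Prop where
  memLp_w : MemLp w 2 (leb G)
  memLp_m : MemLp m 2 (leb G)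
  eq_w : IsFracLapX G (1 / 3) u w
  eq_m : ∀ i, IsDvFracLapX G (1 / 6) i u (fun z => m z i)

/-- Coefficients `a = a(t)`, bounded and measurable, with
`δ |ξ|² ≤ a^{ij}(t) ξ_i ξ_j ≤ δ⁻¹ |ξ|²`. -/
structure IsCoeff {d : ℕ} (δ : ℝ) (a : ℝ → Matrix (Fin d) (Fin d) ℝ) : Prop where
  measurable : ∀ i j, Measurable fun t => a t i j
  bounded : ∃ C : ℝ, ∀ t i j, |a t i j| ≤ C
  lower : ∀ (t : ℝ) (ξ : Sp d), δ * ‖ξ‖ ^ 2 ≤ ∑ i, ∑ j, a t i j * ξ i * ξ j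
  upper : ∀ (t : ℝ) (ξ : Sp d), ∑ i, ∑ j, a t i j * ξ i * ξ j ≤ δ⁻¹ * ‖ξ‖ ^ 2

/-- `P_0 u = ∂_t u - v · D_x u - a^{ij}(t) D_{v_i v_j} u`, in terms of `H = D_v^2 u` and
`Y = ∂_t u - v · D_x u`. -/
def P0 {d : ℕ} (a : ℝ → Matrix (Fin d) (Fin d) ℝ) (H : Pt d → EuclideanSpace ℝ (Fin d × Fin d))
    (Y : Pt d → ℝ) (z : Pt d) : ℝ :=
  Y z - ∑ i, ∑ j, a z.1 i j * H z (i, j)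

/-- `u ∈ S_2(G)` is a solution of `P_0 u + lam u = f` on `G`. -/
def IsSol {d : ℕ} (a : ℝ → Matrix (Fin d) (Fin d) ℝ) (lam : ℝ) (G : Set (Pt d))
    (f u : Pt d → ℝ) : Prop :=
  ∃ p H Y, HasS2 G u p H Y ∧ ∀ᵐ z ∂leb G, P0 a H Y z + lam * u z = f z

/-- `u ∈ S_2((S, T) × ℝ^{2d})` is a solution of the Cauchy problem `P_0 u = f`, `u(S, ·) = 0`:
its extension by zero to `t < S` belongs to `S_2(ℝ^{1+2d}_T)` and solves the equation for
`S < t < T`. -/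
def IsCauchySol {d : ℕ} (a : ℝ → Matrix (Fin d) (Fin d) ℝ) (S T : ℝ) (f u : Pt d → ℝ) : Prop :=
  MemS2 (slab d S T) u ∧
    ∃ u' p H Y, HasS2 (past d T) u' p H Y ∧
      (∀ᵐ z ∂leb (slab d S T), u' z = u z) ∧
      (∀ᵐ z ∂leb (past d S), u' z = 0) ∧
      ∀ᵐ z ∂leb (slab d S T), P0 a H Y z = f z

end KFP

end

/-! The shear `(t, x, v) ↦ (t, x + t v, v)` preserves Lebesgue measure and turns `∂_t - v · D_x`
into `∂_t`. Compose it with the Fourier transform in the two space variables, with dual frequencies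
`k` and `ξ`. Then `D_{v_i}` becomes multiplication by `i η_i` with `η = 2π(ξ + t k)`, and `(-Δ_x)^s`
becomes multiplication by `|κ|^{2s}` with `κ = 2πk`. Since `a` depends on `t` only, the equation
`P_0 u + λ u = f` decouples into one scalar linear equation `∂_t U + (a^{ij} η_i η_j + λ) U = F` for
each fixed `(k, ξ)`.

A solution that is square integrable towards `-∞` carries no initial datum there, so `|U(t)|` is at
most the Duhamel integral of `exp(-∫_s^t c) |F(s)|`, where `c` is the rate (`IsRate.duhamel_le`).
Because `η` is affine in time with slope `κ`, the integral of `|η|²` over `(s, t)` is at least both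
`(t - s)|η(t)|²/4` and `(t - s)³|κ|²/12`. The second bound is the hypoelliptic gain: diffusion in
`v` together with transport forces decay in `k`. Schur's test on each time line then bounds the
Duhamel integral weighted by `λ`, by `|η|²` and by `|κ|^{2/3}`, with constants linear in `δ⁻¹`
(`IsCoeff.bound_lam`, `IsCoeff.bound_eta`, `IsCoeff.bound_kap`). All other multipliers in the
estimate, such as `√λ η_i` and `η_i |κ|^{1/3}`, are dominated by the sum of these three
(`freq_bound`), and Plancherel gives (i) in `HasS2.apriori`.

Two points need care. The transform exists only as an isometry of `L_2`, characterised by its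
pairing with tensors (`shearFourier`, `isFT_iff`), and the weak equation gives only a weak time
derivative of `U`. A du Bois-Reymond argument supplies a representative that is absolutely
continuous on almost every time line (`exists_isPrim_of_weak`), to which Duhamel applies in
`HasS2.ae_le_duh`. Moreover the symbol `|κ|^{2s}` is singular at `k = 0`, so the transform of
`(-Δ_x)^s φ` is identified off the null set `k = 0` (`isFT_fracLapC`).

Uniqueness is the Duhamel bound with `F = 0`, valid also for `λ = 0`. For existence the Duhamel
integral is taken as the definition of `U`, the weighted bounds put all the required multiples in
`L_2`, and inverse transforms give the solution (`IsCoeff.exists_solution`). For the Cauchy problem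
`λ = 0` and `F` lives in `(S, T)`, so the propagator bound `≤ 1` already gives `‖u‖ ≤ (T - S)‖f‖`;
the remaining norms follow from (i) with `λ = (T - S)⁻¹`. -/

noncomputable section

namespace KFP

open Set Filter Topology Metric Function SchwartzMap
open scoped ComplexConjugate InnerProductSpace

section



/-! ### Smooth approximation of indicators of compact sets -/

section Tensors

variable {E : Type*} [NormedAddCommGroup E] [NormedSpace ℝ E] [FiniteDimensional ℝ E]

/-- The indicator of a compact set is a pointwise limit of smooth bumps supported in a fixed
compact neighbourhood. -/
theorem exists_bump_seq {K U : Set E} (hK : IsCompact K) (hU : IsOpen U) (hKU : K ⊆ U) :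
    ∃ K' : Set E, IsCompact K' ∧ K' ⊆ U ∧ ∃ g : ℕ → E → ℝ,
      (∀ n, ContDiff ℝ ∞ (g n)) ∧ (∀ n x, 0 ≤ g n x ∧ g n x ≤ 1) ∧ (∀ n, tsupport (g n) ⊆ K') ∧
      ∀ x, Tendsto (fun n => g n x) atTop (𝓝 (K.indicator (fun _ => (1 : ℝ)) x)) := by
  have : ProperSpace E := FiniteDimensional.proper ℝ E
  obtain ⟨δ, δpos, hδ⟩ := hK.exists_cthickening_subset_open hU hKU
  -- The n-th bump is `1` on `K` and lives in the `u n`-thickening. The radii tend to `0`, so a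
  -- point off the closed set `K` eventually leaves the supports.
  obtain ⟨u, -, u_pos, u_lim⟩ := exists_seq_strictAnti_tendsto' δpos
  have hK' : IsCompact (cthickening δ K) := hK.cthickening
  have : ∀ n, ∃ g : E → ℝ, support g = thickening (u n) K ∧ ContDiff ℝ ∞ g ∧
      Set.range g ⊆ Set.Icc 0 1 ∧ ∀ x ∈ K, g x = 1 := by
    intro n
    rcases exists_contMDiff_support_eq_eq_one_iff (modelWithCornersSelf ℝ E)
      (isOpen_thickening (δ := u n) (E := K)) hK.isClosed
      (self_subset_thickening (u_pos n).1 K) with ⟨g, g_smooth, g_range, g_supp, hg⟩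
    exact ⟨g, g_supp, g_smooth.contDiff, g_range, fun x hx ↦ (hg x).1 hx⟩
  choose g g_supp g_diff g_range hg using this
  refine ⟨cthickening δ K, hK', hδ, g, g_diff, fun n x => g_range n ⟨x, rfl⟩, fun n => ?_,
    fun x => ?_⟩
  · refine closure_minimal ?_ isClosed_cthickening
    rw [g_supp]
    exact thickening_subset_cthickening_of_le (u_pos n).2.le _
  · by_cases hx : x ∈ K
    · simp [hx, hg _ x hx]
    · rw [indicator_of_notMem hx]
      apply tendsto_const_nhds.congr'
      obtain ⟨ε, εpos, hε⟩ : ∃ ε, 0 < ε ∧ x ∉ thickening ε K := by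
        rw [← hK.isClosed.closure_eq, closure_eq_iInter_thickening K] at hx
        simpa using hx
      filter_upwards [(tendsto_order.1 u_lim).2 _ εpos] with n hn
      symm
      rw [← notMem_support, g_supp]
      contrapose hε
      exact thickening_mono hn.le K hε

end Tensors

/-! ### Tensor test functions and the shear -/

variable {d : ℕ}

/-- The tensor `θ(t) A(k) B(ξ)`. -/
def tens (θ : ℝ → ℂ) (A B : Sp d → ℂ) (z : Pt d) : ℂ := θ z.1 * A z.2.1 * B z.2.2

/-- The sheared tensor `θ(t) A(x + t v) B(v)`. -/
def stens (θ : ℝ → ℂ) (A B : Sp d → ℂ) (z : Pt d) : ℂ :=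
  θ z.1 * A (z.2.1 + z.1 • z.2.2) * B z.2.2

/-- A real function viewed as a complex one. -/
abbrev cpx {α : Type*} (f : α → ℝ) (x : α) : ℂ := (f x : ℂ)

/-- `g` is smooth with compact support inside `U`. -/
def IsBump {E : Type*} [NormedAddCommGroup E] [NormedSpace ℝ E] (U : Set E) (g : E → ℝ) : Prop :=
  ContDiff ℝ ∞ g ∧ HasCompactSupport g ∧ tsupport g ⊆ U

/-- The indicator of a box is the product of three indicators, each a limit of bumps with supports
in a fixed compact set; dominated convergence passes to the limit. -/
theorem setIntegral_box_eq_zero {R : Pt d → ℂ} {J : Set ℝ} {O W : Set (Sp d)} (hJ : IsOpen J)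
    (hO : IsOpen O) (hW : IsOpen W) (hR : LocallyIntegrable R)
    (h : ∀ θ A B, IsBump J θ → IsBump O A → IsBump W B →
      ∫ z, R z * tens (cpx θ) (cpx A) (cpx B) z = 0)
    {K₁ : Set ℝ} {K₂ K₃ : Set (Sp d)} (h₁ : IsCompact K₁) (h₂ : IsCompact K₂)
    (h₃ : IsCompact K₃) (hJ' : K₁ ⊆ J) (hO' : K₂ ⊆ O) (hW' : K₃ ⊆ W) :
    ∫ z in K₁ ×ˢ K₂ ×ˢ K₃, R z = 0 := by
  obtain ⟨L₁, hL₁, hLJ, θ, hθ, θ01, θs, θl⟩ := exists_bump_seq h₁ hJ hJ'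
  obtain ⟨L₂, hL₂, hLO, A, hA, A01, As, Al⟩ := exists_bump_seq h₂ hO hO'
  obtain ⟨L₃, hL₃, hLW, B, hB, B01, Bs, Bl⟩ := exists_bump_seq h₃ hW hW'
  have hz : ∀ n, ∫ z, R z * tens (cpx (θ n)) (cpx (A n)) (cpx (B n)) z = 0 := fun n =>
    h _ _ _ ⟨hθ n, HasCompactSupport.of_support_subset_isCompact hL₁
        ((subset_tsupport _).trans (θs n)), (θs n).trans hLJ⟩
      ⟨hA n, HasCompactSupport.of_support_subset_isCompact hL₂
        ((subset_tsupport _).trans (As n)), (As n).trans hLO⟩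
      ⟨hB n, HasCompactSupport.of_support_subset_isCompact hL₃
        ((subset_tsupport _).trans (Bs n)), (Bs n).trans hLW⟩
  have hL : IsCompact (L₁ ×ˢ L₂ ×ˢ L₃) := hL₁.prod (hL₂.prod hL₃)
  have lim : Tendsto (fun n => ∫ z, R z * tens (cpx (θ n)) (cpx (A n)) (cpx (B n)) z) atTop
      (𝓝 (∫ z, (K₁ ×ˢ K₂ ×ˢ K₃).indicator R z)) := by
    refine tendsto_integral_of_dominated_convergence
      ((L₁ ×ˢ L₂ ×ˢ L₃).indicator (fun z => ‖R z‖)) (fun n => ?_) ?_ (fun n => ?_) ?_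
    · refine hR.aestronglyMeasurable.mul (Continuous.aestronglyMeasurable ?_)
      have := (hθ n).continuous
      have := (hA n).continuous
      have := (hB n).continuous
      unfold tens cpx
      fun_prop
    · rw [integrable_indicator_iff hL.measurableSet]
      exact (hR.integrableOn_isCompact hL).norm
    · refine Eventually.of_forall fun z => ?_
      by_cases hz : z ∈ L₁ ×ˢ L₂ ×ˢ L₃
      · rw [indicator_of_mem hz, norm_mul]
        refine mul_le_of_le_one_right (norm_nonneg _) ?_
        simp only [tens, cpx, norm_mul, Complex.norm_real, Real.norm_eq_abs]
        rw [abs_of_nonneg (θ01 n _).1, abs_of_nonneg (A01 n _).1, abs_of_nonneg (B01 n _).1]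
        exact mul_le_one₀ (mul_le_one₀ (θ01 n _).2 (A01 n _).1 (A01 n _).2) (B01 n _).1 (B01 n _).2
      · rw [indicator_of_notMem hz]
        have : θ n z.1 = 0 ∨ A n z.2.1 = 0 ∨ B n z.2.2 = 0 := by
          by_contra! hne
          exact hz ⟨θs n (subset_tsupport _ hne.1), As n (subset_tsupport _ hne.2.1),
            Bs n (subset_tsupport _ hne.2.2)⟩
        rcases this with h0 | h0 | h0 <;> simp [tens, cpx, h0]
    · refine Eventually.of_forall fun z => ?_
      have hlim := ((Complex.continuous_ofReal.tendsto _).comp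
        (((θl z.1).mul (Al z.2.1)).mul (Bl z.2.2))).const_mul (R z)
      refine (hlim.congr fun n => ?_).trans_eq ?_
      · simp [tens, cpx]
      · congr 1
        by_cases h1 : z.1 ∈ K₁ <;> by_cases h2 : z.2.1 ∈ K₂ <;> by_cases h3 : z.2.2 ∈ K₃ <;>
          simp [h1, h2, h3, indicator, mem_prod]
  simp only [hz] at lim
  rw [← integral_indicator (h₁.prod (h₂.prod h₃)).measurableSet]
  exact (tendsto_nhds_unique lim tendsto_const_nhds)

/-- A locally integrable function which is orthogonal to all smooth tensors supported in
`J × O × W` vanishes almost everywhere there. -/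
theorem ae_eq_zero_of_tens {R : Pt d → ℂ} {J : Set ℝ} {O W : Set (Sp d)} (hJ : IsOpen J)
    (hO : IsOpen O) (hW : IsOpen W) (hR : LocallyIntegrable R)
    (h : ∀ θ A B, IsBump J θ → IsBump O A → IsBump W B →
      ∫ z, R z * tens (cpx θ) (cpx A) (cpx B) z = 0) :
    ∀ᵐ z, z ∈ J ×ˢ O ×ˢ W → R z = 0 := by
  have box : ∀ (K₁ : Set ℝ) (K₂ K₃ : Set (Sp d)), IsCompact K₁ → IsCompact K₂ → IsCompact K₃ →
      K₁ ⊆ J → K₂ ⊆ O → K₃ ⊆ W → ∀ᵐ z ∂(volume.restrict (K₁ ×ˢ K₂ ×ˢ K₃)), R z = 0 := by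
    intro K₁ K₂ K₃ h₁ h₂ h₃ hJ' hO' hW'
    have hK := h₁.prod (h₂.prod h₃)
    have hint : IntegrableOn R (K₁ ×ˢ K₂ ×ˢ K₃) := hR.integrableOn_isCompact hK
    refine hint.ae_eq_zero_of_forall_setIntegral_eq_zero fun s hs hfin => ?_
    clear hfin
    -- Products of closed sets form a π-system generating the Borel sets, and they cut a compact box
    -- in a compact box. Vanishing of the integral on compact boxes therefore spreads to all
    -- measurable subsets.
    have hgen : (inferInstance : MeasurableSpace (Pt d)) = MeasurableSpace.generateFrom
        (image2 (· ×ˢ ·) {s : Set ℝ | IsClosed s}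
          (image2 (· ×ˢ ·) {s : Set (Sp d) | IsClosed s} {s : Set (Sp d) | IsClosed s})) := by
      have c1 : IsCountablySpanning {s : Set ℝ | IsClosed s} :=
        ⟨fun _ => univ, fun _ => isClosed_univ, iUnion_const _⟩
      have c2 : IsCountablySpanning {s : Set (Sp d) | IsClosed s} :=
        ⟨fun _ => univ, fun _ => isClosed_univ, iUnion_const _⟩
      rw [generateFrom_eq_prod (C := {s : Set ℝ | IsClosed s})
        (D := image2 (· ×ˢ ·) {s : Set (Sp d) | IsClosed s} {s : Set (Sp d) | IsClosed s})
        ?_ ?_ c1 (c2.prod c2)]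
      · rw [← borel_eq_generateFrom_isClosed, BorelSpace.measurable_eq (α := ℝ)]
      · rw [generateFrom_eq_prod _ _ c2 c2]
        all_goals rw [← borel_eq_generateFrom_isClosed, BorelSpace.measurable_eq (α := Sp d)]
    have hpi : IsPiSystem (image2 (· ×ˢ ·) {s : Set ℝ | IsClosed s}
          (image2 (· ×ˢ ·) {s : Set (Sp d) | IsClosed s} {s : Set (Sp d) | IsClosed s})) :=
      isPiSystem_isClosed.prod (isPiSystem_isClosed.prod isPiSystem_isClosed)
    have huniv : ∫ z in K₁ ×ˢ K₂ ×ˢ K₃, R z = 0 :=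
      setIntegral_box_eq_zero hJ hO hW hR h h₁ h₂ h₃ hJ' hO' hW'
    induction s, hs using MeasurableSpace.induction_on_inter hgen hpi with
    | empty => simp
    | basic t ht =>
      obtain ⟨a, ha, b, ⟨b1, hb1, b2, hb2, rfl⟩, rfl⟩ := ht
      have hm : MeasurableSet (a ×ˢ b1 ×ˢ b2) :=
        (IsClosed.measurableSet ha).prod ((IsClosed.measurableSet hb1).prod
          (IsClosed.measurableSet hb2))
      rw [Measure.restrict_restrict hm, prod_inter_prod, prod_inter_prod]
      exact setIntegral_box_eq_zero hJ hO hW hR h (h₁.inter_left ha) (h₂.inter_left hb1)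
        (h₃.inter_left hb2) (inter_subset_right.trans hJ') (inter_subset_right.trans hO')
        (inter_subset_right.trans hW')
    | compl t ht ih =>
      have := integral_add_compl ht hint
      rw [ih, huniv, zero_add] at this
      exact this
    | iUnion f hd hf ih =>
      rw [integral_iUnion hf hd hint.integrableOn]
      simp [ih]
  rw [ae_iff]
  refine measure_null_of_locally_null _ fun z hz => ?_
  simp only [Classical.not_imp, mem_ofPred_eq] at hz
  obtain ⟨⟨z1, z2, z3⟩, -⟩ := hz
  obtain ⟨K₁, h₁, h₁', h₁''⟩ := exists_compact_subset hJ z1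
  obtain ⟨K₂, h₂, h₂', h₂''⟩ := exists_compact_subset hO z2
  obtain ⟨K₃, h₃, h₃', h₃''⟩ := exists_compact_subset hW z3
  have hm : MeasurableSet (K₁ ×ˢ K₂ ×ˢ K₃) := (h₁.prod (h₂.prod h₃)).measurableSet
  refine ⟨_, inter_mem self_mem_nhdsWithin (mem_nhdsWithin_of_mem_nhds
    (prod_mem_nhds (mem_interior_iff_mem_nhds.1 h₁')
      (prod_mem_nhds (mem_interior_iff_mem_nhds.1 h₂') (mem_interior_iff_mem_nhds.1 h₃')))), ?_⟩
  have := box K₁ K₂ K₃ h₁ h₂ h₃ h₁'' h₂'' h₃''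
  rw [ae_restrict_iff' hm, ae_iff] at this
  refine measure_mono_null (fun y hy => ?_) this
  simp only [Classical.not_imp] at hy ⊢
  exact ⟨hy.2, hy.1.2⟩

/-- The shear `(t, x, v) ↦ (t, x + t v, v)`. -/
def shear (d : ℕ) : Pt d ≃ₜ Pt d where
  toFun z := (z.1, z.2.1 + z.1 • z.2.2, z.2.2)
  invFun z := (z.1, z.2.1 - z.1 • z.2.2, z.2.2)
  left_inv z := by simp
  right_inv z := by simp
  continuous_toFun := by fun_prop
  continuous_invFun := by fun_prop

theorem shear_apply (z : Pt d) : shear d z = (z.1, z.2.1 + z.1 • z.2.2, z.2.2) := rfl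

theorem shear_symm_apply (z : Pt d) : (shear d).symm z = (z.1, z.2.1 - z.1 • z.2.2, z.2.2) := rfl

/-- For fixed `t` and `v` the shear is a translation in `x`, so it is an iterated skew product of
measure preserving maps. -/
theorem measurePreserving_shear : MeasurePreserving (shear d) := by
  have h1 : ∀ t : ℝ, MeasurePreserving (fun y : Sp d × Sp d => (y.1 + t • y.2, y.2)) := by
    intro t
    have : MeasurePreserving (fun y : Sp d × Sp d => (y.1, y.2 + t • y.1)) := by
      refine (MeasurePreserving.id volume).skew_product (g := fun v x => x + t • v)
        (by fun_prop) (Eventually.of_forall fun v => ?_)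
      exact map_add_right_eq_self _ _
    exact (Measure.measurePreserving_swap.comp this).comp Measure.measurePreserving_swap
  refine (MeasurePreserving.id volume).skew_product
    (g := fun (t : ℝ) (y : Sp d × Sp d) => (y.1 + t • y.2, y.2))
    (by fun_prop) (Eventually.of_forall fun t => (h1 t).map_eq)

theorem stens_eq_comp (θ : ℝ → ℂ) (A B : Sp d → ℂ) : stens θ A B = tens θ A B ∘ shear d := rfl

theorem integral_comp_shear {F : Type*} [NormedAddCommGroup F] [NormedSpace ℝ F] (f : Pt d → F) :
    ∫ z, f (shear d z) = ∫ z, f z :=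
  measurePreserving_shear.integral_comp (shear d).measurableEmbedding f

theorem integral_tens (θ : ℝ → ℂ) (A B : Sp d → ℂ) :
    ∫ z, tens θ A B z = (∫ t, θ t) * ((∫ k, A k) * ∫ ξ, B ξ) := by
  have h1 : ∫ y : Sp d × Sp d, A y.1 * B y.2 = (∫ k, A k) * ∫ ξ, B ξ := integral_prod_mul A B
  have h2 := integral_prod_mul (μ := (volume : Measure ℝ)) (ν := (volume : Measure (Sp d × Sp d)))
    θ (fun y => A y.1 * B y.2)
  rw [← h1, ← h2]
  simp only [tens, mul_assoc]
  rfl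

theorem memLp_tens {θ : ℝ → ℂ} {A B : Sp d → ℂ} (hθ : MemLp θ 2) (hA : MemLp A 2)
    (hB : MemLp B 2) : MemLp (tens θ A B) 2 := by
  rw [memLp_two_iff_integrable_sq_norm ?_]
  · have h := (hθ.integrable_norm_pow two_ne_zero).mul_prod
      ((hA.integrable_norm_pow two_ne_zero).mul_prod (hB.integrable_norm_pow two_ne_zero))
    refine h.congr (Eventually.of_forall fun z => ?_)
    simp [tens, mul_pow, mul_assoc]
  · exact (hθ.1.comp_fst.mul hA.1.comp_fst.comp_snd).mul hB.1.comp_snd.comp_snd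

theorem memLp_stens {θ : ℝ → ℂ} {A B : Sp d → ℂ} (hθ : MemLp θ 2) (hA : MemLp A 2)
    (hB : MemLp B 2) : MemLp (stens θ A B) 2 := by
  rw [stens_eq_comp]
  exact (memLp_tens hθ hA hB).comp_measurePreserving measurePreserving_shear

end

/-! ### The Fourier transform in the sheared variables, as an isometry of `L_2` -/

section



variable {d : ℕ}

/-- The Fourier transform of a Schwartz function, as a Schwartz function. -/
abbrev sft (A : 𝓢(Sp d, ℂ)) : 𝓢(Sp d, ℂ) := 𝓕 A

/-- `U` is the Fourier transform of `u` in the variables `(x + t v, v)`. -/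
structure IsFT (u U : Pt d → ℂ) : Prop where
  left : MemLp u 2
  right : MemLp U 2
  pair : ∀ θ : ℝ → ℂ, MemLp θ 2 → ∀ A B : 𝓢(Sp d, ℂ),
    ∫ z, u z * stens θ (sft A) (sft B) z = ∫ z, U z * tens θ A B z

theorem memLp_schwartz (A : 𝓢(Sp d, ℂ)) : MemLp A 2 := A.memLp 2

theorem MemLp.locallyIntegrable_two {f : Pt d → ℂ} (hf : MemLp f 2) : LocallyIntegrable f :=
  hf.locallyIntegrable (by norm_num)

theorem memLp_conj {α : Type*} [MeasurableSpace α] {μ : Measure α} {f : α → ℂ}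
    (hf : MemLp f 2 μ) : MemLp (fun z => conj (f z)) 2 μ :=
  hf.star

theorem inner_toLp_toLp {α : Type*} [MeasurableSpace α] {μ : Measure α} {f g : α → ℂ}
    (hf : MemLp f 2 μ) (hg : MemLp g 2 μ) :
    ⟪hf.toLp, hg.toLp⟫_ℂ = ∫ z, g z * conj (f z) ∂μ := by
  rw [L2.inner_def]
  refine integral_congr_ae ?_
  filter_upwards [hf.coeFn_toLp, hg.coeFn_toLp] with z h1 h2
  rw [h1, h2]
  rfl

theorem inner_toLp_left {α : Type*} [MeasurableSpace α] {μ : Measure α} {f : α → ℂ}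
    (hf : MemLp f 2 μ) (g : Lp ℂ 2 μ) :
    ⟪hf.toLp, g⟫_ℂ = ∫ z, g z * conj (f z) ∂μ := by
  rw [L2.inner_def]
  refine integral_congr_ae ?_
  filter_upwards [hf.coeFn_toLp] with z h1
  rw [h1]
  rfl

/-- Index type for the tensors. -/
abbrev TIdx (d : ℕ) : Type := {θ : ℝ → ℂ // MemLp θ 2} × 𝓢(Sp d, ℂ) × 𝓢(Sp d, ℂ)

theorem memLp_tIdx (i : TIdx d) : MemLp (tens i.1.1 i.2.1 i.2.2) 2 :=
  memLp_tens i.1.2 (memLp_schwartz _) (memLp_schwartz _)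

theorem memLp_tIdx_shear (i : TIdx d) : MemLp (stens i.1.1 (sft i.2.1) (sft i.2.2)) 2 :=
  memLp_stens i.1.2 (memLp_schwartz (sft i.2.1)) (memLp_schwartz (sft i.2.2))

/-- The conjugated tensor as an element of `L_2`. -/
def tensVec (i : TIdx d) : Lp ℂ 2 (volume : Measure (Pt d)) := (memLp_conj (memLp_tIdx i)).toLp

/-- The conjugated sheared tensor of Fourier transforms as an element of `L_2`. -/
def stensVec (i : TIdx d) : Lp ℂ 2 (volume : Measure (Pt d)) :=
  (memLp_conj (memLp_tIdx_shear i)).toLp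

theorem integral_fourier_mul_conj (f g : 𝓢(Sp d, ℂ)) :
    ∫ x, conj (sft f x) * 𝓕 g x = ∫ x, conj (f x) * g x := by
  have := integral_inner_fourier_fourier f g
  simpa [mul_comm, RCLike.inner_apply] using this

/-- The shear drops out of the integral, the time factors are untouched, and Plancherel for Schwartz
functions handles the `x` and `v` factors separately. -/
theorem inner_stensVec (i j : TIdx d) :
    ⟪stensVec i, stensVec j⟫_ℂ = ⟪tensVec i, tensVec j⟫_ℂ := by
  rw [stensVec, stensVec, tensVec, tensVec, inner_toLp_toLp, inner_toLp_toLp]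
  have h1 : ∀ z, conj (tens j.1.1 j.2.1 j.2.2 z) * conj (conj (tens i.1.1 i.2.1 i.2.2 z)) =
      tens (fun t => conj (j.1.1 t) * i.1.1 t) (fun k => conj (j.2.1 k) * i.2.1 k)
        (fun k => conj (j.2.2 k) * i.2.2 k) z := fun z => by simp [tens]; ring
  have h2 : ∀ z, conj (stens j.1.1 (sft j.2.1) (sft j.2.2) z) *
        conj (conj (stens i.1.1 (sft i.2.1) (sft i.2.2) z)) =
      tens (fun t => conj (j.1.1 t) * i.1.1 t) (fun k => conj (sft j.2.1 k) * 𝓕 i.2.1 k)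
        (fun k => conj (sft j.2.2 k) * 𝓕 i.2.2 k) (shear d z) :=
    fun z => by simp [stens, tens, shear_apply]; ring
  simp_rw [h1, h2]
  rw [integral_comp_shear, integral_tens, integral_tens, integral_fourier_mul_conj,
    integral_fourier_mul_conj]

/-- Equal Gram matrices: this is what makes the linear extension of `stensVec i ↦ tensVec i` well
defined and isometric. -/
theorem inner_linearCombination {ι H : Type*} [NormedAddCommGroup H] [InnerProductSpace ℂ H]
    {v w : ι → H} (h : ∀ i j, ⟪v i, v j⟫_ℂ = ⟪w i, w j⟫_ℂ) (c : ι →₀ ℂ) :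
    ‖Finsupp.linearCombination ℂ v c‖ = ‖Finsupp.linearCombination ℂ w c‖ := by
  simp only [norm_eq_sqrt_re_inner (𝕜 := ℂ), Finsupp.linearCombination_apply, Finsupp.sum_inner,
    Finsupp.inner_sum, inner_smul_left, inner_smul_right, h]

theorem denseRange_linearCombination {ι H : Type*} [NormedAddCommGroup H] [InnerProductSpace ℂ H]
    [CompleteSpace H] {v : ι → H} (h : ∀ x, (∀ i, ⟪v i, x⟫_ℂ = 0) → x = 0) :
    DenseRange (Finsupp.linearCombination ℂ v) := by
  have h1 : (Submodule.span ℂ (range v)).topologicalClosure = ⊤ := by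
    rw [Submodule.topologicalClosure_eq_top_iff, eq_bot_iff]
    intro x hx
    refine h x fun i => (Submodule.mem_orthogonal _ _).1 hx _ (Submodule.subset_span ⟨i, rfl⟩)
  have h2 := Submodule.dense_iff_topologicalClosure_eq_top.2 h1
  rw [← Finsupp.range_linearCombination] at h2
  exact h2

/-- A bump as a complex Schwartz function. -/
theorem IsBump.exists_schwartz {E : Type*} [NormedAddCommGroup E] [NormedSpace ℝ E] {U : Set E}
    {g : E → ℝ} (hg : IsBump U g) : ∃ A : 𝓢(E, ℂ), ∀ x, A x = g x := by
  have h1 : HasCompactSupport (cpx g) := hg.2.1.comp_left (g := fun r : ℝ => (r : ℂ)) (by simp)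
  have h2 : ContDiff ℝ ∞ (cpx g) := Complex.ofRealCLM.contDiff.comp hg.1
  exact ⟨h1.toSchwartzMap h2, fun x => rfl⟩

theorem IsBump.memLp_cpx {U : Set ℝ} {g : ℝ → ℝ} (hg : IsBump U g) : MemLp (cpx g) 2 :=
  (Continuous.memLp_of_hasCompactSupport (hg.1.continuous) hg.2.1).ofReal

theorem ae_eq_zero_of_forall_tens {R : Pt d → ℂ} (hR : MemLp R 2)
    (h : ∀ i : TIdx d, ∫ z, R z * tens i.1.1 i.2.1 i.2.2 z = 0) : R =ᵐ[volume] 0 := by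
  have := ae_eq_zero_of_tens (R := R) isOpen_univ isOpen_univ isOpen_univ
    (MemLp.locallyIntegrable_two hR) (fun θ A B hθ hA hB => by
      obtain ⟨A', hA'⟩ := hA.exists_schwartz
      obtain ⟨B', hB'⟩ := hB.exists_schwartz
      have := h ⟨⟨cpx θ, hθ.memLp_cpx⟩, A', B'⟩
      simp only [tens, hA', hB'] at this
      exact this)
  filter_upwards [this] with z hz
  exact hz (by simp)

theorem denseRange_tensVec : DenseRange (Finsupp.linearCombination ℂ (tensVec (d := d))) := by
  refine denseRange_linearCombination fun x hx => ?_
  refine (Lp.eq_zero_iff_ae_eq_zero).2 (ae_eq_zero_of_forall_tens (Lp.memLp x) fun i => ?_)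
  have := hx i
  rw [tensVec, inner_toLp_left] at this
  simpa using this

/-- Every Schwartz function is a Fourier transform. Testing with inverse transforms and undoing the
shear reduces the claim to orthogonality to the plain tensors. -/
theorem denseRange_stensVec : DenseRange (Finsupp.linearCombination ℂ (stensVec (d := d))) := by
  refine denseRange_linearCombination fun x hx => ?_
  have hsymm : MeasurePreserving (shear d).symm (volume : Measure (Pt d)) volume :=
    measurePreserving_shear.symm (shear d).toMeasurableEquiv
  have h0 : (fun z => x ((shear d).symm z)) =ᵐ[volume] 0 := by
    refine ae_eq_zero_of_forall_tens ((Lp.memLp x).comp_measurePreserving hsymm) fun i => ?_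
    have := hx ⟨i.1, 𝓕⁻ i.2.1, 𝓕⁻ i.2.2⟩
    rw [stensVec, inner_toLp_left] at this
    rw [← integral_comp_shear]
    simpa [stens_eq_comp] using this
  refine (Lp.eq_zero_iff_ae_eq_zero).2 ?_
  have := measurePreserving_shear.quasiMeasurePreserving.ae h0
  filter_upwards [this] with z hz
  simpa using hz

/-- The Fourier transform in the variables `(x + t v, v)`. -/
def shearFourier (d : ℕ) :
    Lp ℂ 2 (volume : Measure (Pt d)) ≃ₗᵢ[ℂ] Lp ℂ 2 (volume : Measure (Pt d)) :=
  (LinearEquiv.refl ℂ (TIdx d →₀ ℂ)).extendOfIsometry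
    (Finsupp.linearCombination ℂ stensVec) (Finsupp.linearCombination ℂ tensVec)
    denseRange_stensVec denseRange_tensVec
    (fun c => (inner_linearCombination inner_stensVec c).symm)

theorem shearFourier_stensVec (i : TIdx d) : shearFourier d (stensVec i) = tensVec i := by
  have := LinearEquiv.extendOfIsometry_eq (f := LinearEquiv.refl ℂ (TIdx d →₀ ℂ))
    (e₁ := Finsupp.linearCombination ℂ stensVec) (e₂ := Finsupp.linearCombination ℂ tensVec)
    denseRange_stensVec denseRange_tensVec
    (fun c => (inner_linearCombination inner_stensVec c).symm) (Finsupp.single i 1)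
  simp only [Finsupp.linearCombination_single, one_smul, LinearEquiv.refl_apply] at this
  exact this

/-- The pairing in `IsFT` is the unitarity of `shearFourier` tested on the sheared tensors. Since
the tensors separate `L_2`, the pairings determine `U`. Parseval, uniqueness on both sides and
linearity then come from the isometry. -/
theorem isFT_iff {u U : Pt d → ℂ} (hu : MemLp u 2) (hU : MemLp U 2) :
    IsFT u U ↔ shearFourier d hu.toLp = hU.toLp := by
  have key : ∀ i : TIdx d, ∫ z, u z * stens i.1.1 (sft i.2.1) (sft i.2.2) z =
      ∫ z, shearFourier d hu.toLp z * tens i.1.1 i.2.1 i.2.2 z := by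
    intro i
    have h := (shearFourier d).inner_map_map (stensVec i) hu.toLp
    rw [shearFourier_stensVec, tensVec, stensVec, inner_toLp_left, inner_toLp_toLp] at h
    simpa using h.symm
  constructor
  · intro h
    have h1 := (Lp.memLp (shearFourier d hu.toLp)).sub hU
    have h0 := ae_eq_zero_of_forall_tens h1 fun i => ?_
    · refine Lp.ext ?_
      filter_upwards [h0, hU.coeFn_toLp] with z h2 h3
      rw [h3]
      exact sub_eq_zero.1 h2
    · have h2 := key i
      rw [h.pair i.1.1 i.1.2] at h2
      simp only [Pi.sub_apply, sub_mul]
      rw [integral_sub, h2, sub_self]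
      · exact (Lp.memLp (shearFourier d hu.toLp)).integrable_mul (memLp_tIdx i)
      · exact hU.integrable_mul (memLp_tIdx i)
  · intro h
    refine ⟨hu, hU, fun θ hθ A B => ?_⟩
    rw [key ⟨⟨θ, hθ⟩, A, B⟩, h]
    refine integral_congr_ae ?_
    filter_upwards [hU.coeFn_toLp] with z hz
    rw [hz]

theorem exists_isFT {u : Pt d → ℂ} (hu : MemLp u 2) : ∃ U, IsFT u U :=
  ⟨shearFourier d hu.toLp, (isFT_iff hu (Lp.memLp _)).2 (by simp)⟩

theorem exists_isFT_inv {U : Pt d → ℂ} (hU : MemLp U 2) : ∃ u, IsFT u U :=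
  ⟨(shearFourier d).symm hU.toLp, (isFT_iff (Lp.memLp _) hU).2 (by simp)⟩

theorem IsFT.parseval {u U g G : Pt d → ℂ} (h : IsFT u U) (h' : IsFT g G) :
    ∫ z, u z * conj (g z) = ∫ z, U z * conj (G z) := by
  rw [← inner_toLp_toLp h'.left h.left, ← inner_toLp_toLp h'.right h.right,
    ← (isFT_iff h.left h.right).1 h, ← (isFT_iff h'.left h'.right).1 h',
    LinearIsometryEquiv.inner_map_map]

theorem IsFT.eLpNorm_eq {u U : Pt d → ℂ} (h : IsFT u U) :
    eLpNorm u 2 volume = eLpNorm U 2 volume := by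
  have h1 := (shearFourier d).norm_map h.left.toLp
  rw [(isFT_iff h.left h.right).1 h, Lp.norm_toLp, Lp.norm_toLp,
    ENNReal.toReal_eq_toReal_iff' h.right.2.ne h.left.2.ne] at h1
  exact h1.symm

theorem IsFT.ae_unique {u U U' : Pt d → ℂ} (h : IsFT u U) (h' : IsFT u U') : U =ᵐ[volume] U' := by
  have h1 := (isFT_iff h.left h.right).1 h
  rw [(isFT_iff h.left h'.right).1 h'] at h1
  filter_upwards [h.right.coeFn_toLp, h'.right.coeFn_toLp] with z h2 h3
  rw [← h2, ← h3, h1]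

theorem IsFT.ae_unique_left {u u' U : Pt d → ℂ} (h : IsFT u U) (h' : IsFT u' U) :
    u =ᵐ[volume] u' := by
  have h1 := (isFT_iff h.left h.right).1 h
  rw [← (isFT_iff h'.left h.right).1 h'] at h1
  have h4 := (shearFourier d).injective h1
  filter_upwards [h.left.coeFn_toLp, h'.left.coeFn_toLp] with z h2 h3
  rw [← h2, ← h3, h4]

theorem IsFT.congr {u u' U U' : Pt d → ℂ} (h : IsFT u U) (h1 : u =ᵐ[volume] u')
    (h2 : U =ᵐ[volume] U') : IsFT u' U' := by
  refine ⟨h.left.ae_eq h1, h.right.ae_eq h2, fun θ hθ A B => ?_⟩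
  calc _ = ∫ z, u z * stens θ (sft A) (sft B) z :=
        integral_congr_ae (by filter_upwards [h1] with z hz; rw [hz])
    _ = ∫ z, U z * tens θ A B z := h.pair θ hθ A B
    _ = _ := integral_congr_ae (by filter_upwards [h2] with z hz; rw [hz])

theorem IsFT.add {u U g G : Pt d → ℂ} (h : IsFT u U) (h' : IsFT g G) :
    IsFT (fun z => u z + g z) (fun z => U z + G z) := by
  have e1 := (isFT_iff h.left h.right).1 h
  have e2 := (isFT_iff h'.left h'.right).1 h'
  refine (isFT_iff (h.left.add h'.left) (h.right.add h'.right)).2 ?_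
  rw [MemLp.toLp_add h.left h'.left, MemLp.toLp_add h.right h'.right, map_add, e1, e2]

/-- Multiplication by a bounded function of time commutes with the Fourier transform. -/
theorem IsFT.mul_time {u U : Pt d → ℂ} (h : IsFT u U) {b : ℝ → ℂ} (hb : Measurable b) {C : ℝ}
    (hC : ∀ t, ‖b t‖ ≤ C) : IsFT (fun z => b z.1 * u z) (fun z => b z.1 * U z) := by
  have hb1 : MemLp (fun z : Pt d => b z.1) ⊤ := memLp_top_of_bound
    (hb.comp measurable_fst).aestronglyMeasurable C (Eventually.of_forall fun z => hC z.1)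
  have hb0 : MemLp b ⊤ := memLp_top_of_bound
    hb.aestronglyMeasurable C (Eventually.of_forall hC)
  refine ⟨h.left.mul hb1, h.right.mul hb1, fun θ hθ A B => ?_⟩
  have := h.pair (fun t => b t * θ t) (hθ.mul hb0) A B
  simpa [stens, tens, mul_assoc, mul_left_comm] using this

end

section



/-! ### Absolutely continuous functions and their product rule -/

section Primitives

/-- `f` is a primitive of the integrable function `f'` on `[a, b]`. -/
structure IsPrim (f f' : ℝ → ℂ) (a b : ℝ) : Prop where
  le : a ≤ b
  integrable : IntervalIntegrable f' volume a b
  eq : ∀ x ∈ Icc a b, f x = f a + ∫ t in a..x, f' t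

theorem absolutelyContinuousOnInterval_const {X : Type*} [PseudoMetricSpace X] (c : X) (a b : ℝ) :
    AbsolutelyContinuousOnInterval (fun _ : ℝ => c) a b :=
  LipschitzOnWith.absolutelyContinuousOnInterval (K := 0) (by intro x _ y _; simp)

theorem absolutelyContinuousOnInterval_congr {X : Type*} [PseudoMetricSpace X] {f g : ℝ → X}
    {a b : ℝ} (hf : AbsolutelyContinuousOnInterval f a b) (h : ∀ x ∈ uIcc a b, f x = g x) :
    AbsolutelyContinuousOnInterval g a b := by
  rw [absolutelyContinuousOnInterval_iff] at hf ⊢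
  intro ε hε
  obtain ⟨δ, hδ, H⟩ := hf ε hε
  refine ⟨δ, hδ, fun E hE hl => ?_⟩
  convert H E hE hl using 1
  refine Finset.sum_congr rfl fun i hi => ?_
  rw [h _ (hE.1 i hi).1, h _ (hE.1 i hi).2]

/-- Reduced to the real case through real and imaginary parts. -/
theorem ac_primitive {f : ℝ → ℂ} {a b : ℝ} (hf : IntervalIntegrable f volume a b) :
    AbsolutelyContinuousOnInterval (fun x => ∫ t in a..x, f t) a b := by
  have hre : IntervalIntegrable (fun t => (f t).re) volume a b := ⟨hf.1.re, hf.2.re⟩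
  have him : IntervalIntegrable (fun t => (f t).im) volume a b := ⟨hf.1.im, hf.2.im⟩
  have h1 := (hre.absolutelyContinuousOnInterval_intervalIntegral (c := a) (by simp)).smul
    (absolutelyContinuousOnInterval_const (1 : ℂ) a b)
  have h2 := (him.absolutelyContinuousOnInterval_intervalIntegral (c := a) (by simp)).smul
    (absolutelyContinuousOnInterval_const Complex.I a b)
  refine absolutelyContinuousOnInterval_congr (h1.add h2) fun x hx => ?_
  have hfx : IntervalIntegrable f volume a x := hf.mono_set (uIcc_subset_uIcc (by simp) hx)
  apply Complex.ext
  · simpa using (intervalIntegral.intervalIntegral_re hfx)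
  · simpa using (intervalIntegral.intervalIntegral_im hfx)

theorem ae_mem_Ioo_of_mem_uIcc (a b : ℝ) (hab : a ≤ b) : ∀ᵐ x : ℝ, x ∈ uIcc a b → x ∈ Ioo a b := by
  have h1 : ∀ᵐ x : ℝ, x ≠ a := by simp [ae_iff, measure_singleton]
  have h2 : ∀ᵐ x : ℝ, x ≠ b := by simp [ae_iff, measure_singleton]
  filter_upwards [h1, h2] with x h1 h2 hx
  rw [uIcc_of_le hab] at hx
  exact ⟨lt_of_le_of_ne hx.1 (Ne.symm h1), lt_of_le_of_ne hx.2 h2⟩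

variable {f f' g g' : ℝ → ℂ} {a b : ℝ}

theorem IsPrim.ac (h : IsPrim f f' a b) : AbsolutelyContinuousOnInterval f a b :=
  absolutelyContinuousOnInterval_congr
    ((absolutelyContinuousOnInterval_const (f a) a b).add (ac_primitive h.integrable))
    fun x hx => by rw [uIcc_of_le h.le] at hx; simp [h.eq x hx]

theorem IsPrim.ae_hasDerivAt (h : IsPrim f f' a b) :
    ∀ᵐ x, x ∈ uIcc a b → HasDerivAt f (f' x) x := by
  filter_upwards [h.integrable.ae_hasDerivAt_integral, ae_mem_Ioo_of_mem_uIcc a b h.le]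
    with x h1 h2 hx
  have h3 := (h1 hx a (by simp)).const_add (f a)
  refine h3.congr_of_eventuallyEq ?_
  filter_upwards [isOpen_Ioo.mem_nhds (h2 hx)] with y hy
  exact h.eq y (Ioo_subset_Icc_self hy)

/-- The difference of `f` and the integral of `f'` is absolutely continuous with derivative zero
almost everywhere, hence constant. This reduces the product rule and the exponential to pointwise
derivatives. -/
theorem IsPrim.of_ac (hab : a ≤ b) (hf : AbsolutelyContinuousOnInterval f a b)
    (hd : ∀ᵐ x, x ∈ uIcc a b → HasDerivAt f (f' x) x) (hi : IntervalIntegrable f' volume a b) :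
    IsPrim f f' a b := by
  refine ⟨hab, hi, fun x hx => ?_⟩
  have h1 : AbsolutelyContinuousOnInterval (fun x => f x - ∫ t in a..x, f' t) a b :=
    hf.sub (ac_primitive hi)
  obtain ⟨C, hC⟩ := h1.const_of_ae_hasDerivAt_zero (by
    filter_upwards [hd, hi.ae_hasDerivAt_integral] with x h2 h3 hx
    have h4 := (h2 hx).sub (h3 hx a (by simp))
    rw [sub_self] at h4
    exact h4)
  have e1 := hC a (by simp)
  have e2 := hC x (by rwa [uIcc_of_le hab])
  simp only [intervalIntegral.integral_same, sub_zero] at e1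
  rw [e1, ← e2]
  ring

theorem IsPrim.continuousOn (h : IsPrim f f' a b) : ContinuousOn f (uIcc a b) :=
  h.ac.continuousOn

theorem IsPrim.mul (hf : IsPrim f f' a b) (hg : IsPrim g g' a b) :
    IsPrim (fun x => f x * g x) (fun x => f' x * g x + f x * g' x) a b := by
  refine IsPrim.of_ac hf.le (hf.ac.smul hg.ac) ?_ ?_
  · filter_upwards [hf.ae_hasDerivAt, hg.ae_hasDerivAt] with x h1 h2 hx
    exact (h1 hx).mul (h2 hx)
  · exact (hf.integrable.mul_continuousOn hg.continuousOn).add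
      (hg.integrable.continuousOn_mul hf.continuousOn)

theorem IsPrim.sub_eq (h : IsPrim f f' a b) : f b - f a = ∫ t in a..b, f' t := by
  rw [h.eq b ⟨h.le, le_rfl⟩]; ring

theorem IsPrim.conj (h : IsPrim f f' a b) :
    IsPrim (fun x => conj (f x)) (fun x => conj (f' x)) a b := by
  have hi : ∀ {s : Set ℝ}, IntegrableOn f' s → IntegrableOn (fun x => conj (f' x)) s := fun hs =>
    Complex.conjCLE.toContinuousLinearMap.integrable_comp hs
  refine ⟨h.le, ⟨hi h.integrable.1, hi h.integrable.2⟩, fun x hx => ?_⟩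
  have hx' : IntervalIntegrable f' volume a x :=
    h.integrable.mono_set (by rw [uIcc_of_le h.le, uIcc_of_le hx.1]; exact Icc_subset_Icc_right hx.2)
  have := Complex.conjCLE.toContinuousLinearMap.intervalIntegral_comp_comm hx'
  rw [h.eq x hx, map_add]
  congr 1
  exact this.symm

/-- `exp (∫ c)` is a primitive for bounded `c`. -/
theorem isPrim_exp {c : ℝ → ℝ} (hab : a ≤ b) (hm : Measurable c) {M : ℝ}
    (hM : ∀ x ∈ Icc a b, |c x| ≤ M) (σ r : ℝ) (hr : ∀ x ∈ Icc a b, IntervalIntegrable c volume r x) :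
    IsPrim (fun x => (Real.exp (σ * ∫ t in r..x, c t) : ℂ))
      (fun x => (σ * c x * Real.exp (σ * ∫ t in r..x, c t) : ℂ)) a b := by
  have hci : IntervalIntegrable c volume a b := by
    rw [intervalIntegrable_iff_integrableOn_Icc_of_le hab]
    exact Measure.integrableOn_of_bounded (M := M) (by simp) hm.aestronglyMeasurable
      ((ae_restrict_iff' measurableSet_Icc).2 (Eventually.of_forall hM))
  set Q : ℝ → ℝ := fun x => σ * ∫ t in r..x, c t with hQ
  have hQe : ∀ x ∈ Icc a b, ∀ y ∈ Icc a b, Q y - Q x = σ * ∫ t in x..y, c t := by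
    intro x hx y hy
    simp only [hQ]
    rw [← mul_sub, intervalIntegral.integral_interval_sub_left (hr y hy) (hr x hx)]
  -- The exponent is Lipschitz because `c` is bounded, and the exponential is Lipschitz on the
  -- compact range of the exponent. The composition is then Lipschitz, hence absolutely continuous.
  have hlip : LipschitzOnWith (Real.toNNReal (|σ| * M)) Q (uIcc a b) := by
    rw [uIcc_of_le hab]
    refine LipschitzOnWith.of_dist_le_mul fun x hx y hy => ?_
    have hM0 : 0 ≤ M := (abs_nonneg _).trans (hM x hx)
    rw [dist_comm, Real.dist_eq, hQe x hx y hy, abs_mul, Real.coe_toNNReal _ (by positivity),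
      mul_assoc]
    refine mul_le_mul_of_nonneg_left ?_ (abs_nonneg _)
    have := intervalIntegral.norm_integral_le_of_norm_le_const (f := c) (a := x) (b := y) (C := M)
      (fun t ht => hM t (by
        rw [uIoc, mem_Ioc] at ht
        exact ⟨(le_min hx.1 hy.1).trans ht.1.le, ht.2.trans (max_le hx.2 hy.2)⟩))
    rw [Real.norm_eq_abs] at this
    rw [dist_comm, Real.dist_eq]
    exact this
  have hQc : ContinuousOn Q (uIcc a b) := hlip.continuousOn
  obtain ⟨m, hm1, hm2⟩ : ∃ m, 0 ≤ m ∧ ∀ x ∈ uIcc a b, |Q x| ≤ m := by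
    obtain ⟨m, hm⟩ := isCompact_uIcc.exists_bound_of_continuousOn hQc
    exact ⟨m, (norm_nonneg _).trans (hm a (by simp)), hm⟩
  obtain ⟨K, hK⟩ := (Real.contDiff_exp (n := 1)).contDiffOn.exists_lipschitzOnWith
    (by decide) (convex_Icc (-m) m) isCompact_Icc
  have hexp := hK.comp hlip (fun x hx => abs_le.1 (hm2 x hx))
  have hcexp : LipschitzOnWith (K * Real.toNNReal (|σ| * M))
      (fun x => (Real.exp (Q x) : ℂ)) (uIcc a b) := by
    intro x hx y hy
    have := hexp hx hy
    rw [edist_dist] at this ⊢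
    rwa [Complex.dist_eq, ← Complex.ofReal_sub, Complex.norm_real, ← dist_eq_norm]
  refine IsPrim.of_ac hab hcexp.absolutelyContinuousOnInterval ?_ ?_
  · filter_upwards [hci.ae_hasDerivAt_integral, ae_mem_Ioo_of_mem_uIcc a b hab] with x h1 h2 hx
    have h3 : HasDerivAt Q (σ * c x) x := by
      have h4 := ((h1 hx a (by simp)).const_add (∫ t in r..a, c t)).const_mul σ
      refine h4.congr_of_eventuallyEq ?_
      filter_upwards [isOpen_Ioo.mem_nhds (h2 hx)] with y hy
      simp only [hQ]
      rw [intervalIntegral.integral_add_adjacent_intervals (hr a ⟨le_rfl, hab⟩)]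
      exact (hr a ⟨le_rfl, hab⟩).symm.trans (hr y (Ioo_subset_Icc_self hy))
    have h5 := (h3.exp).ofReal_comp
    convert h5 using 1
    rw [Complex.ofReal_mul, Complex.ofReal_mul]
    ring
  · refine IntervalIntegrable.mul_continuousOn ?_ ?_
    · have : IntervalIntegrable (fun x => (c x : ℂ)) volume a b := ⟨hci.1.ofReal, hci.2.ofReal⟩
      exact this.const_mul (σ : ℂ)
    · exact hcexp.continuousOn

end Primitives

end

section



/-! ### Scalar linear equations and the Duhamel formula -/

section Duhamel

/-- Locally bounded nonnegative measurable coefficients of a scalar linear equation. -/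
structure IsRate (c : ℝ → ℝ) : Prop where
  measurable : Measurable c
  bounded : ∀ R, ∃ M, ∀ x, |x| ≤ R → |c x| ≤ M
  nonneg : ∀ x, 0 ≤ c x

/-- The propagator `exp (-∫_s^t c)`. -/
def prop (c : ℝ → ℝ) (t s : ℝ) : ℝ := Real.exp (-∫ r in s..t, c r)

variable {c : ℝ → ℝ}

theorem prop_pos (c : ℝ → ℝ) (t s : ℝ) : 0 < prop c t s := Real.exp_pos _

theorem enorm_prop (c : ℝ → ℝ) (t s : ℝ) : ‖(prop c t s : ℂ)‖ₑ = ENNReal.ofReal (prop c t s) := by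
  rw [← ofReal_norm, Complex.norm_real, Real.norm_of_nonneg (prop_pos c t s).le]

theorem IsRate.exists_bound (hc : IsRate c) (a b : ℝ) : ∃ M, ∀ x ∈ Icc a b, |c x| ≤ M := by
  obtain ⟨M, hM⟩ := hc.bounded (max |a| |b|)
  exact ⟨M, fun x hx => hM x (abs_le_max_abs_abs hx.1 hx.2)⟩

theorem IsRate.intervalIntegrable (hc : IsRate c) (a b : ℝ) : IntervalIntegrable c volume a b := by
  wlog hab : a ≤ b generalizing a b
  · exact (this b a (le_of_not_ge hab)).symm
  obtain ⟨M, hM⟩ := hc.exists_bound a b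
  rw [intervalIntegrable_iff_integrableOn_Icc_of_le hab]
  exact Measure.integrableOn_of_bounded (M := M) (by simp) hc.measurable.aestronglyMeasurable
    ((ae_restrict_iff' measurableSet_Icc).2 (Eventually.of_forall hM))

theorem IsRate.isPrim_exp (hc : IsRate c) {a b : ℝ} (hab : a ≤ b) (σ r : ℝ) :
    IsPrim (fun x => (Real.exp (σ * ∫ t in r..x, c t) : ℂ))
      (fun x => (σ * c x * Real.exp (σ * ∫ t in r..x, c t) : ℂ)) a b := by
  obtain ⟨M, hM⟩ := hc.exists_bound a b
  exact KFP.isPrim_exp hab hc.measurable hM σ r fun x _ => hc.intervalIntegrable r x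

theorem IsRate.prop_le_one (hc : IsRate c) {s t : ℝ} (h : s ≤ t) : prop c t s ≤ 1 := by
  refine Real.exp_le_one_iff.2 (neg_nonpos.2 ?_)
  exact intervalIntegral.integral_nonneg h fun x _ => hc.nonneg x

/-- Separating the two times makes the propagator visibly continuous in both and lets the factor in
`t` leave integrals over `s`. -/
theorem IsRate.prop_eq (hc : IsRate c) (r s t : ℝ) :
    prop c t s = Real.exp (-1 * ∫ x in r..t, c x) * Real.exp (1 * ∫ x in r..s, c x) := by
  rw [prop, ← Real.exp_add, ← intervalIntegral.integral_interval_sub_left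
    (hc.intervalIntegrable r t) (hc.intervalIntegrable r s)]
  ring_nf

theorem IsRate.continuous_exp (hc : IsRate c) (σ r : ℝ) :
    Continuous (fun x => Real.exp (σ * ∫ t in r..x, c t)) :=
  Real.continuous_exp.comp (continuous_const.mul
    (intervalIntegral.continuous_primitive (fun a b => hc.intervalIntegrable a b) r))

theorem IsRate.continuous_prop (hc : IsRate c) : Continuous (fun z : ℝ × ℝ => prop c z.1 z.2) := by
  have h : (fun z : ℝ × ℝ => prop c z.1 z.2) = fun z =>
    Real.exp (-1 * ∫ x in (0 : ℝ)..z.1, c x) * Real.exp (1 * ∫ x in (0 : ℝ)..z.2, c x) :=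
    funext fun z => hc.prop_eq 0 z.2 z.1
  rw [h]
  exact ((hc.continuous_exp (-1) 0).comp continuous_fst).mul
    ((hc.continuous_exp 1 0).comp continuous_snd)

/-- Integrating factor: the product of `exp (∫_a^x c)` and `W` has derivative `exp (∫_a^x c) F`, and
only absolute continuity is needed to integrate it back. -/
theorem IsRate.duhamel_eq (hc : IsRate c) {a b : ℝ} {W Y F : ℝ → ℂ} (hW : IsPrim W Y a b)
    (hY : ∀ᵐ x, x ∈ Icc a b → Y x = F x - c x * W x) :
    W b = prop c b a * W a + ∫ s in a..b, prop c b s * F s := by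
  have h1 := (hc.isPrim_exp hW.le 1 a).mul hW
  have h2 := h1.sub_eq
  have h3 : ∫ x in a..b, ((((1 : ℝ) : ℂ) * c x * Real.exp (1 * ∫ t in a..x, c t)) * W x +
      Real.exp (1 * ∫ t in a..x, c t) * Y x) =
      ∫ x in a..b, ((Real.exp (1 * ∫ t in a..x, c t) : ℝ) : ℂ) * F x := by
    refine intervalIntegral.integral_congr_ae ?_
    filter_upwards [hY] with x hx hx'
    rw [uIoc_of_le hW.le] at hx'
    rw [hx (Ioc_subset_Icc_self hx')]
    push_cast
    ring
  rw [h3] at h2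
  have h4 : ∫ s in a..b, (prop c b s : ℂ) * F s = ((Real.exp (-1 * ∫ t in a..b, c t) : ℝ) : ℂ) *
      ∫ x in a..b, ((Real.exp (1 * ∫ t in a..x, c t) : ℝ) : ℂ) * F x := by
    rw [← intervalIntegral.integral_const_mul]
    refine intervalIntegral.integral_congr fun x _ => ?_
    rw [hc.prop_eq a x b, Complex.ofReal_mul]
    ring
  rw [h4, ← h2, hc.prop_eq a a b]
  simp only [intervalIntegral.integral_same, mul_zero, Real.exp_zero, Complex.ofReal_one, one_mul,
    mul_one]
  rw [mul_sub, ← mul_assoc, ← Complex.ofReal_mul, ← Real.exp_add]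
  simp

/-- The Duhamel bound for a square integrable solution on a half line. -/
theorem IsRate.duhamel_le (hc : IsRate c) {b : ℝ} {W Y F : ℝ → ℂ}
    (hW : ∀ a ≤ b, IsPrim W Y a b) (hL : MemLp W 2 (volume.restrict (Iic b)))
    (hY : ∀ᵐ x, x ≤ b → Y x = F x - c x * W x) :
    ‖W b‖ₑ ≤ ∫⁻ s in Iic b, ENNReal.ofReal (prop c b s) * ‖F s‖ₑ := by
  set N := ∫⁻ s in Iic b, ENNReal.ofReal (prop c b s) * ‖F s‖ₑ
  have h1 : ∀ a ≤ b, ‖W b‖ₑ ≤ ‖W a‖ₑ + N := by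
    intro a ha
    rw [hc.duhamel_eq (hW a ha) (by filter_upwards [hY] with x hx hx' using hx hx'.2)]
    refine (enorm_add_le _ _).trans (add_le_add ?_ ?_)
    · rw [enorm_mul, enorm_prop]
      exact mul_le_of_le_one_left' (ENNReal.ofReal_le_one.2 (hc.prop_le_one ha))
    · rw [intervalIntegral.integral_of_le ha]
      refine (enorm_integral_le_lintegral_enorm _).trans ?_
      refine (lintegral_mono_set Ioc_subset_Iic_self).trans (le_of_eq ?_)
      refine lintegral_congr fun s => ?_
      rw [enorm_mul, enorm_prop]
  -- If `‖W b‖` exceeded the Duhamel integral by a gap `ε`, then `‖W a‖ ≥ ε` for every `a ≤ b`,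
  -- which is impossible for a square integrable function on a half line.
  by_contra! hlt
  set ε := ‖W b‖ₑ - N
  have hε : 0 < ε := tsub_pos_of_lt hlt
  have h2 : ∀ a ≤ b, ε ≤ ‖W a‖ₑ := fun a ha => tsub_le_iff_right.2 (h1 a ha)
  have h3 := lintegral_rpow_enorm_lt_top_of_eLpNorm_lt_top two_ne_zero ENNReal.ofNat_ne_top hL.2
  refine h3.ne (top_le_iff.1 ?_)
  calc ⊤ = ∫⁻ _ in Iic b, ε ^ (2 : ℝ) := by
        rw [lintegral_const, Measure.restrict_apply_univ, Real.volume_Iic, ENNReal.mul_top]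
        simp [hε.ne']
    _ ≤ _ := by
        refine setLIntegral_mono' measurableSet_Iic fun a ha => ?_
        simp only [ENNReal.toReal_ofNat]
        exact ENNReal.rpow_le_rpow (h2 a ha) (by norm_num)

/-- The Duhamel formula defines a solution. -/
theorem IsRate.isPrim_duhamel (hc : IsRate c) {F : ℝ → ℂ} {a b : ℝ} (hab : a ≤ b)
    (hF : ∀ t, IntegrableOn (fun s => (prop c t s : ℂ) * F s) (Iic t)) :
    IsPrim (fun t => ∫ s in Iic t, (prop c t s : ℂ) * F s)
      (fun t => F t - c t * ∫ s in Iic t, (prop c t s : ℂ) * F s) a b := by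
  -- With base point `a` the propagator is `e' t * e s`. The Duhamel integral is then `e'` times an
  -- ordinary primitive, and the product rule gives the equation.
  set e : ℝ → ℂ := fun s => ((Real.exp (1 * ∫ x in a..s, c x) : ℝ) : ℂ)
  set e' : ℝ → ℂ := fun s => ((Real.exp (-1 * ∫ x in a..s, c x) : ℝ) : ℂ)
  have hee : ∀ s, e' s * e s = 1 := fun s => by
    simp only [e, e']
    rw [← Complex.ofReal_mul, ← Real.exp_add]
    simp
  have hpe : ∀ t s, (prop c t s : ℂ) = e' t * e s := fun t s => by
    rw [hc.prop_eq a s t, Complex.ofReal_mul]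
  have hF' : ∀ t, IntegrableOn (fun s => e s * F s) (Iic t) := fun t => by
    have := (hF t).const_mul (e t)
    refine this.congr (Eventually.of_forall fun s => ?_)
    simp only
    rw [hpe, ← mul_assoc, ← mul_assoc, mul_comm (e t), hee, one_mul]
  have hW : ∀ t, ∫ s in Iic t, (prop c t s : ℂ) * F s = e' t * ∫ s in Iic t, e s * F s := fun t => by
    rw [← integral_const_mul]
    refine integral_congr_ae (Eventually.of_forall fun s => ?_)
    simp only
    rw [hpe, mul_assoc]
  have hZ : IsPrim (fun t => ∫ s in Iic t, e s * F s) (fun s => e s * F s) a b := by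
    refine ⟨hab, ?_, fun x hx => ?_⟩
    · exact ((hF' b).mono_set (by rw [uIcc_of_le hab]; exact Icc_subset_Iic_self)).intervalIntegrable
    · rw [← intervalIntegral.integral_Iic_sub_Iic (hF' a) (hF' x)]
      ring
  have hp := (hc.isPrim_exp hab (-1) a).mul hZ
  simp_rw [hW]
  convert hp using 2 with t
  have h1 := hee t
  simp only [e, e'] at h1 ⊢
  rw [← mul_assoc, ← mul_assoc, h1]
  push_cast
  ring

end Duhamel

/-! ### Schur's test and exponential kernels -/

section Schur

/-- Schur's test. -/
theorem lintegral_schur {K : ℝ → ℝ → ENNReal} (hK : Measurable (uncurry K)) {f : ℝ → ENNReal}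
    (hf : AEMeasurable f) {A B : ENNReal} (hA : ∀ t, ∫⁻ s, K t s ≤ A) (hB : ∀ s, ∫⁻ t, K t s ≤ B) :
    ∫⁻ t, (∫⁻ s, K t s * f s) ^ 2 ≤ A * B * ∫⁻ s, f s ^ 2 := by
  wlog hf' : Measurable f generalizing f
  · have h := this (f := hf.mk f) hf.measurable_mk.aemeasurable hf.measurable_mk
    have e1 : ∀ t, ∫⁻ s, K t s * f s = ∫⁻ s, K t s * hf.mk f s := fun t =>
      lintegral_congr_ae (by filter_upwards [hf.ae_eq_mk] with s hs; rw [hs])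
    have e2 : ∫⁻ s, f s ^ 2 = ∫⁻ s, hf.mk f s ^ 2 :=
      lintegral_congr_ae (by filter_upwards [hf.ae_eq_mk] with s hs; rw [hs])
    simp_rw [e1, e2]
    exact h
  have hKt : ∀ t, Measurable (K t) := fun t => hK.comp measurable_prodMk_left
  -- Cauchy–Schwarz with `K f` split as `K^{1/2}` times `K^{1/2} f`; the first factor yields the row
  -- bound. The column bound enters after exchanging the integrals.
  have h1 : ∀ t, (∫⁻ s, K t s * f s) ^ 2 ≤ A * ∫⁻ s, K t s * f s ^ 2 := by
    intro t
    have hh : ∀ x : ENNReal, x ^ (1 / 2 : ℝ) * x ^ (1 / 2 : ℝ) = x := fun x => by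
      rw [← ENNReal.rpow_add_of_nonneg _ _ (by norm_num) (by norm_num)]; norm_num
    have hs : ∀ x : ENNReal, (x ^ (1 / 2 : ℝ)) ^ 2 = x := fun x => by rw [sq, hh]
    have := ENNReal.lintegral_mul_le_Lp_mul_Lq volume Real.HolderConjugate.two_two
      (f := fun s => K t s ^ (1 / 2 : ℝ)) (g := fun s => K t s ^ (1 / 2 : ℝ) * f s)
      ((hKt t).pow_const _).aemeasurable (((hKt t).pow_const _).mul hf').aemeasurable
    have e1 : ∀ s, ((fun s => K t s ^ (1 / 2 : ℝ)) * fun s => K t s ^ (1 / 2 : ℝ) * f s) s =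
        K t s * f s := fun s => by simp only [Pi.mul_apply]; rw [← mul_assoc, hh]
    simp only [e1, ENNReal.rpow_two, mul_pow, hs] at this
    calc (∫⁻ s, K t s * f s) ^ 2
        ≤ ((∫⁻ s, K t s) ^ (1 / 2 : ℝ) * (∫⁻ s, K t s * f s ^ 2) ^ (1 / 2 : ℝ)) ^ 2 := by gcongr
      _ = (∫⁻ s, K t s) * ∫⁻ s, K t s * f s ^ 2 := by rw [mul_pow, hs, hs]
      _ ≤ _ := by gcongr; exact hA t
  calc ∫⁻ t, (∫⁻ s, K t s * f s) ^ 2 ≤ ∫⁻ t, A * ∫⁻ s, K t s * f s ^ 2 := lintegral_mono h1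
    _ = A * ∫⁻ t, ∫⁻ s, K t s * f s ^ 2 :=
        lintegral_const_mul _ (Measurable.lintegral_prod_right'
          (f := fun z : ℝ × ℝ => K z.1 z.2 * f z.2 ^ 2)
          (hK.mul ((hf'.comp measurable_snd).pow_const 2)))
    _ = A * ∫⁻ s, ∫⁻ t, K t s * f s ^ 2 := by
        rw [lintegral_lintegral_swap]
        exact (hK.mul ((hf'.comp measurable_snd).pow_const 2)).aemeasurable
    _ = A * ∫⁻ s, (∫⁻ t, K t s) * f s ^ 2 := by
        congr 1
        refine lintegral_congr fun s => ?_
        rw [lintegral_mul_const]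
        exact hK.comp measurable_prodMk_right
    _ ≤ A * ∫⁻ s, B * f s ^ 2 := by gcongr with s; exact hB s
    _ = _ := by rw [lintegral_const_mul _ (hf'.pow_const 2), mul_assoc]

theorem lintegral_exp_Iic {β : ℝ} (hβ : 0 < β) (t : ℝ) :
    ∫⁻ s in Iic t, ENNReal.ofReal (Real.exp (-(β * (t - s)))) = ENNReal.ofReal (1 / β) := by
  have e : ∀ s, Real.exp (-(β * (t - s))) = Real.exp (-(β * t)) * Real.exp (β * s) := fun s => by
    rw [← Real.exp_add]; ring_nf
  simp_rw [e]
  rw [← ofReal_integral_eq_lintegral_ofReal, integral_const_mul, integral_exp_mul_Iic hβ]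
  · congr 1
    rw [mul_div_assoc', ← Real.exp_add]
    simp
  · exact (integrableOn_exp_mul_Iic hβ t).const_mul _
  · exact Eventually.of_forall fun s => by positivity

theorem lintegral_exp_Ici {β : ℝ} (hβ : 0 < β) (s : ℝ) :
    ∫⁻ t in Ici s, ENNReal.ofReal (Real.exp (-(β * (t - s)))) = ENNReal.ofReal (1 / β) := by
  have e : ∀ t, Real.exp (-(β * (t - s))) = Real.exp (β * s) * Real.exp (-β * t) := fun t => by
    rw [← Real.exp_add]; ring_nf
  simp_rw [e]
  rw [setLIntegral_congr Ioi_ae_eq_Ici.symm, ← ofReal_integral_eq_lintegral_ofReal,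
    integral_const_mul, integral_exp_mul_Ioi (by linarith)]
  · congr 1
    rw [neg_div_neg_eq, mul_div_assoc', ← Real.exp_add]
    simp
  · exact (integrableOn_exp_mul_Ioi (by linarith) s).const_mul _
  · exact Eventually.of_forall fun s => by positivity

/-- The integrand is minus the `t`-derivative of the propagator, so over `[s, b]` the integral
telescopes to `1 - prop c b s`. No lower bound on `c` is needed. -/
theorem IsRate.lintegral_mul_prop_le {c : ℝ → ℝ} (hc : IsRate c) (s : ℝ) :
    ∫⁻ t in Ici s, ENNReal.ofReal (c t * prop c t s) ≤ 1 := by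
  have h1 : ∀ b, s ≤ b → ∫⁻ t in Icc s b, ENNReal.ofReal (c t * prop c t s) ≤ 1 := by
    intro b hb
    have hp := hc.isPrim_exp hb (-1) s
    have h2 := hp.sub_eq
    have hi : IntervalIntegrable (fun t => c t * prop c t s) volume s b :=
      (hc.intervalIntegrable s b).mul_continuousOn
        (hc.continuous_prop.comp (Continuous.prodMk_left s)).continuousOn
    have h3 : ∫ t in s..b, c t * prop c t s = 1 - prop c b s := by
      have e : ∫ t in s..b, (((-1 : ℝ) : ℂ) * c t * ((Real.exp (-1 * ∫ r in s..t, c r) : ℝ) : ℂ)) =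
          ((-∫ t in s..b, c t * prop c t s : ℝ) : ℂ) := by
        rw [← intervalIntegral.integral_neg, ← intervalIntegral.integral_ofReal]
        refine intervalIntegral.integral_congr fun t _ => ?_
        simp only [prop]
        push_cast
        ring_nf
      rw [e, ← Complex.ofReal_sub, Complex.ofReal_inj] at h2
      simp only [intervalIntegral.integral_same, mul_zero, Real.exp_zero] at h2
      rw [prop, ← neg_one_mul (∫ r in s..b, c r)]
      linarith
    rw [intervalIntegral.integral_of_le hb] at h3
    rw [setLIntegral_congr Ioc_ae_eq_Icc.symm, ← ofReal_integral_eq_lintegral_ofReal, h3]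
    · rw [← ENNReal.ofReal_one]
      exact ENNReal.ofReal_le_ofReal (by linarith [prop_pos c b s])
    · exact hi.1
    · exact Eventually.of_forall fun t => mul_nonneg (hc.nonneg t) (Real.exp_pos _).le
  have hcov : AECover (volume.restrict (Ici s)) atTop (fun b : ℝ => Iic b) := aecover_Iic tendsto_id
  have hm : Measurable fun t => ENNReal.ofReal (c t * prop c t s) :=
    (hc.measurable.mul (hc.continuous_prop.comp (Continuous.prodMk_left s)).measurable).ennreal_ofReal
  have := hcov.lintegral_tendsto_of_countably_generated hm.aemeasurable
  refine le_of_tendsto this ?_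
  filter_upwards [eventually_ge_atTop s] with b hb
  rw [Measure.restrict_restrict measurableSet_Iic, inter_comm, Ici_inter_Iic]
  exact h1 b hb

end Schur

end

section



/-! ### Weighted `L_2` bounds for the Duhamel operator -/

section Weights

/-- The Duhamel majorant `∫_{-∞}^t exp (-∫_s^t c) f(s) ds`. -/
def duh (c : ℝ → ℝ) (f : ℝ → ENNReal) (t : ℝ) : ENNReal :=
  ∫⁻ s in Iic t, ENNReal.ofReal (prop c t s) * f s

/-- Schur's test for the kernel `g(t) prop c t s` on `s ≤ t`. Row and column conditions are kept
separate because the weight `|η(t)|²` needs different arguments for the two. -/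
theorem IsRate.weighted_bound {c : ℝ → ℝ} (hc : IsRate c) {g : ℝ → ℝ} (hg : Measurable g)
    (hg0 : ∀ t, 0 ≤ g t) {f : ℝ → ENNReal} (hf : AEMeasurable f) {A B : ENNReal}
    (hA : ∀ t, ENNReal.ofReal (g t) * ∫⁻ s in Iic t, ENNReal.ofReal (prop c t s) ≤ A)
    (hB : ∀ s, ∫⁻ t in Ici s, ENNReal.ofReal (g t * prop c t s) ≤ B) :
    ∫⁻ t, (ENNReal.ofReal (g t) * duh c f t) ^ 2 ≤ A * B * ∫⁻ s, f s ^ 2 := by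
  have hpm : Measurable (fun z : ℝ × ℝ => ENNReal.ofReal (prop c z.1 z.2)) :=
    hc.continuous_prop.measurable.ennreal_ofReal
  have hset : MeasurableSet {z : ℝ × ℝ | z.2 ≤ z.1} := measurableSet_le measurable_snd measurable_fst
  set K : ℝ → ℝ → ENNReal := fun t s =>
    {z : ℝ × ℝ | z.2 ≤ z.1}.indicator
      (fun z => ENNReal.ofReal (g z.1) * ENNReal.ofReal (prop c z.1 z.2)) (t, s) with hKdef
  have hK : Measurable (uncurry K) :=
    (((hg.comp measurable_fst).ennreal_ofReal).mul hpm).indicator hset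
  have hKt : ∀ t s, K t s = (Iic t).indicator
      (fun s => ENNReal.ofReal (g t) * ENNReal.ofReal (prop c t s)) s := fun t s => by
    simp only [hKdef, indicator, mem_ofPred_eq, mem_Iic]
  have hKs : ∀ t s, K t s = (Ici s).indicator
      (fun t => ENNReal.ofReal (g t * prop c t s)) t := fun t s => by
    simp only [hKdef, indicator, mem_ofPred_eq, mem_Ici, ENNReal.ofReal_mul (hg0 t)]
  have hp1 : ∀ t, Measurable fun s => ENNReal.ofReal (prop c t s) := fun t =>
    (hc.continuous_prop.comp (Continuous.prodMk_right t)).measurable.ennreal_ofReal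
  have hA' : ∀ t, ∫⁻ s, K t s ≤ A := fun t => by
    simp_rw [hKt]
    rw [lintegral_indicator measurableSet_Iic, lintegral_const_mul _ (hp1 t)]
    exact hA t
  have hB' : ∀ s, ∫⁻ t, K t s ≤ B := fun s => by
    simp_rw [hKs]
    rw [lintegral_indicator measurableSet_Ici]
    exact hB s
  have e : ∀ t, ENNReal.ofReal (g t) * duh c f t = ∫⁻ s, K t s * f s := fun t => by
    simp_rw [hKt]
    have hm : AEMeasurable (fun s => ENNReal.ofReal (prop c t s) * f s) (volume.restrict (Iic t)) :=
      ((hp1 t).aemeasurable.mul hf).restrict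
    rw [duh, ← lintegral_const_mul'' _ hm, ← lintegral_indicator measurableSet_Iic]
    congr 1 with s
    by_cases hs : s ∈ Iic t <;> simp [hs, mul_assoc]
  simp_rw [e]
  exact lintegral_schur hK hf hA' hB'

/-- A weight dominated by an exponential decay rate. -/
theorem IsRate.exp_bound {c : ℝ → ℝ} (hc : IsRate c) {m β C : ℝ} (hβ : 0 < β) (hm : 0 ≤ m)
    (hC : 0 ≤ C) (h : ∀ t s, s ≤ t → prop c t s ≤ C * Real.exp (-(β * (t - s))))
    {f : ℝ → ENNReal} (hf : AEMeasurable f) :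
    ∫⁻ t, (ENNReal.ofReal m * duh c f t) ^ 2 ≤ ENNReal.ofReal (m * C / β) ^ 2 * ∫⁻ s, f s ^ 2 := by
  have hmC : 0 ≤ m * C := mul_nonneg hm hC
  have key : ENNReal.ofReal (m * C) * ENNReal.ofReal (1 / β) = ENNReal.ofReal (m * C / β) := by
    rw [← ENNReal.ofReal_mul hmC, mul_one_div]
  have hme : ∀ t, Measurable fun s => ENNReal.ofReal (Real.exp (-(β * (t - s)))) := fun t => by
    fun_prop
  have hme' : ∀ s, Measurable fun t => ENNReal.ofReal (Real.exp (-(β * (t - s)))) := fun t => by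
    fun_prop
  rw [sq (ENNReal.ofReal _)]
  refine hc.weighted_bound (g := fun _ => m) measurable_const (fun _ => hm) hf (fun t => ?_)
    (fun s => ?_)
  · calc _ ≤ ENNReal.ofReal m * ∫⁻ s in Iic t, ENNReal.ofReal C *
            ENNReal.ofReal (Real.exp (-(β * (t - s)))) := by
          refine mul_le_mul' le_rfl (setLIntegral_mono' measurableSet_Iic fun s hs => ?_)
          rw [← ENNReal.ofReal_mul hC]
          exact ENNReal.ofReal_le_ofReal (h t s hs)
      _ = _ := by
          rw [lintegral_const_mul _ (hme t), lintegral_exp_Iic hβ, ← mul_assoc,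
            ← ENNReal.ofReal_mul hm, key]
  · calc _ ≤ ∫⁻ t in Ici s, ENNReal.ofReal (m * C) *
            ENNReal.ofReal (Real.exp (-(β * (t - s)))) := by
          refine setLIntegral_mono' measurableSet_Ici fun t ht => ?_
          rw [← ENNReal.ofReal_mul hmC, mul_assoc]
          exact ENNReal.ofReal_le_ofReal (mul_le_mul_of_nonneg_left (h t s ht) hm)
      _ = _ := by
          rw [lintegral_const_mul _ (hme' s), lintegral_exp_Ici hβ, key]

end Weights

/-! ### The symbol of the operator and its decay along characteristics -/

section Symbol

variable {d : ℕ}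

/-- The frequency `2π (ξ + t k)` dual to `v`, as a function of `(t, k, ξ)`. -/
def eta (z : Pt d) : Sp d := (2 * Real.pi) • (z.2.2 + z.1 • z.2.1)

/-- The quadratic form of the coefficients. -/
def quad (a : ℝ → Matrix (Fin d) (Fin d) ℝ) (t : ℝ) (η : Sp d) : ℝ :=
  ∑ i, ∑ j, a t i j * η i * η j

/-- The rate `a^{ij} η_i η_j + lam` along the characteristic through `ζ = (k, ξ)`. -/
def rate (a : ℝ → Matrix (Fin d) (Fin d) ℝ) (lam : ℝ) (ζ : Sp d × Sp d) (t : ℝ) : ℝ :=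
  quad a t (eta (t, ζ)) + lam

variable {a : ℝ → Matrix (Fin d) (Fin d) ℝ} {δ lam : ℝ}

theorem continuous_eta : Continuous (eta (d := d)) := by unfold eta; fun_prop

theorem continuous_eta_apply (i : Fin d) : Continuous fun z : Pt d => eta z i := by
  have := continuous_eta (d := d)
  fun_prop

theorem IsCoeff.le_quad (ha : IsCoeff δ a) (t : ℝ) (η : Sp d) : δ * ‖η‖ ^ 2 ≤ quad a t η :=
  ha.lower t η

theorem IsCoeff.quad_le (ha : IsCoeff δ a) (t : ℝ) (η : Sp d) : quad a t η ≤ δ⁻¹ * ‖η‖ ^ 2 :=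
  ha.upper t η

theorem IsCoeff.quad_nonneg (ha : IsCoeff δ a) (hδ : 0 < δ) (t : ℝ) (η : Sp d) :
    0 ≤ quad a t η :=
  le_trans (by positivity) (ha.le_quad t η)

theorem IsCoeff.measurable_quad (ha : IsCoeff δ a) :
    Measurable fun z : Pt d => quad a z.1 (eta z) := by
  unfold quad
  refine Finset.measurable_sum _ fun i _ => Finset.measurable_sum _ fun j _ => ?_
  exact (((ha.measurable i j).comp measurable_fst).mul (continuous_eta_apply i).measurable).mul
    (continuous_eta_apply j).measurable

theorem IsCoeff.isRate (ha : IsCoeff δ a) (hδ : 0 < δ) (hl : 0 ≤ lam) (ζ : Sp d × Sp d) :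
    IsRate (rate a lam ζ) := by
  refine ⟨?_, fun R => ?_, fun x => ?_⟩
  · exact (ha.measurable_quad.comp (measurable_prodMk_right (y := ζ))).add_const lam
  · have hcont : ContinuousOn (fun t : ℝ => δ⁻¹ * ‖eta (t, ζ)‖ ^ 2 + lam) (Icc (-R) R) := by
      have := continuous_eta (d := d)
      fun_prop
    obtain ⟨M, hM⟩ := isCompact_Icc.exists_bound_of_continuousOn hcont
    refine ⟨M, fun x hx => le_trans ?_ (hM x (abs_le.1 hx))⟩
    have h1 := ha.quad_le x (eta (x, ζ))
    have h2 := ha.quad_nonneg hδ x (eta (x, ζ))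
    rw [rate, abs_of_nonneg (by linarith), Real.norm_of_nonneg (by positivity)]
    linarith
  · have h2 := ha.quad_nonneg hδ x (eta (x, ζ))
    rw [rate]
    linarith

theorem eta_sub (t r : ℝ) (ζ : Sp d × Sp d) :
    eta (r, ζ) = eta (t, ζ) - (t - r) • ((2 * Real.pi) • ζ.1) := by
  simp only [eta, smul_add, smul_smul]
  module

/-- Along a characteristic `η` is affine with slope `2πk`, so the integrand is a quadratic
polynomial in time with an explicit primitive, here expanded at the final time `t`. -/
theorem integral_eta_sq (s t : ℝ) (ζ : Sp d × Sp d) :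
    ∫ r in s..t, ‖eta (r, ζ)‖ ^ 2 = (t - s) * ‖eta (t, ζ)‖ ^ 2
      - (t - s) ^ 2 * ⟪eta (t, ζ), (2 * Real.pi) • ζ.1⟫_ℝ
      + (t - s) ^ 3 / 3 * ‖(2 * Real.pi) • ζ.1‖ ^ 2 := by
  set κ : Sp d := (2 * Real.pi) • ζ.1
  set η := eta (t, ζ)
  have h1 : ∀ r, ‖eta (r, ζ)‖ ^ 2 = ‖η‖ ^ 2 - 2 * (t - r) * ⟪η, κ⟫_ℝ + (t - r) ^ 2 * ‖κ‖ ^ 2 := by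
    intro r
    rw [eta_sub t r ζ, norm_sub_sq_real, inner_smul_right, norm_smul, mul_pow, Real.norm_eq_abs,
      sq_abs]
    ring
  simp_rw [h1]
  have h2 : ∀ r ∈ uIcc s t, HasDerivAt (fun r => -((t - r) * ‖η‖ ^ 2
      - (t - r) ^ 2 * ⟪η, κ⟫_ℝ + (t - r) ^ 3 / 3 * ‖κ‖ ^ 2))
      (‖η‖ ^ 2 - 2 * (t - r) * ⟪η, κ⟫_ℝ + (t - r) ^ 2 * ‖κ‖ ^ 2) r := by
    intro r _
    have hd : HasDerivAt (fun r => t - r) (-1) r := by simpa using (hasDerivAt_id r).const_sub t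
    have := (((hd.mul_const (‖η‖ ^ 2)).sub ((hd.pow 2).mul_const ⟪η, κ⟫_ℝ)).add
      (((hd.pow 3).div_const 3).mul_const (‖κ‖ ^ 2))).neg
    exact this.congr_deriv (by push_cast; ring)
  rw [intervalIntegral.integral_eq_sub_of_hasDerivAt h2
    (Continuous.intervalIntegrable (by fun_prop) _ _)]
  ring

theorem IsCoeff.integral_rate_ge (ha : IsCoeff δ a) (hδ : 0 < δ) (hl : 0 ≤ lam) (ζ : Sp d × Sp d)
    {s t : ℝ} (hst : s ≤ t) :
    δ * (∫ r in s..t, ‖eta (r, ζ)‖ ^ 2) + lam * (t - s) ≤ ∫ r in s..t, rate a lam ζ r := by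
  have hc : Continuous fun r : ℝ => ‖eta (r, ζ)‖ ^ 2 := by
    have := continuous_eta (d := d)
    fun_prop
  have e : ∫ r in s..t, (δ * ‖eta (r, ζ)‖ ^ 2 + lam) =
      δ * (∫ r in s..t, ‖eta (r, ζ)‖ ^ 2) + lam * (t - s) := by
    have hc' : Continuous fun r : ℝ => δ * ‖eta (r, ζ)‖ ^ 2 := continuous_const.mul hc
    rw [intervalIntegral.integral_add (hc'.intervalIntegrable _ _)
      (continuous_const.intervalIntegrable _ _), intervalIntegral.integral_const_mul,
      intervalIntegral.integral_const, smul_eq_mul, mul_comm (t - s)]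
  rw [← e]
  refine intervalIntegral.integral_mono_on hst
    (Continuous.intervalIntegrable (by fun_prop) _ _)
    ((ha.isRate hδ hl ζ).intervalIntegrable s t) fun r _ => ?_
  rw [rate]
  linarith [ha.le_quad r (eta (r, ζ))]

/-- Minimising the explicit quadratic form over `κ` gives the constant `1/4`: the difference of the
two sides is `(t - s)/12` times `|3η - 2(t - s)κ|²`. -/
theorem integral_eta_sq_ge_eta {s t : ℝ} (hst : s ≤ t) (ζ : Sp d × Sp d) :
    (t - s) * ‖eta (t, ζ)‖ ^ 2 / 4 ≤ ∫ r in s..t, ‖eta (r, ζ)‖ ^ 2 := by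
  rw [integral_eta_sq]
  set κ : Sp d := (2 * Real.pi) • ζ.1
  set η := eta (t, ζ)
  have h0 := sq_nonneg (‖(3 : ℝ) • η - (2 * (t - s)) • κ‖)
  rw [norm_sub_sq_real, norm_smul, norm_smul, inner_smul_left,
    inner_smul_right, mul_pow, mul_pow, Real.norm_eq_abs, Real.norm_eq_abs, sq_abs, sq_abs] at h0
  simp only [conj_trivial] at h0
  have h1 := mul_nonneg (sub_nonneg.2 hst) h0
  nlinarith [h1]

/-- Minimising over `η` instead gives `1/12`: the difference is `(t - s)/4` times `|2η - (t -
s)κ|²`. The cubic growth in time is the source of the exponent `2/3` in `|κ|^{2/3}`. -/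
theorem integral_eta_sq_ge_kap {s t : ℝ} (hst : s ≤ t) (ζ : Sp d × Sp d) :
    (t - s) ^ 3 * ‖(2 * Real.pi) • ζ.1‖ ^ 2 / 12 ≤ ∫ r in s..t, ‖eta (r, ζ)‖ ^ 2 := by
  rw [integral_eta_sq]
  set κ : Sp d := (2 * Real.pi) • ζ.1
  set η := eta (t, ζ)
  have h0 := sq_nonneg (‖(2 : ℝ) • η - (t - s) • κ‖)
  rw [norm_sub_sq_real, norm_smul, norm_smul, inner_smul_left,
    inner_smul_right, mul_pow, mul_pow, Real.norm_eq_abs, Real.norm_eq_abs, sq_abs, sq_abs] at h0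
  simp only [conj_trivial] at h0
  have h1 := mul_nonneg (sub_nonneg.2 hst) h0
  nlinarith [h1]

/-- The bound with weight `lam`. -/
theorem IsCoeff.bound_lam (ha : IsCoeff δ a) (hδ : 0 < δ) (hl : 0 ≤ lam) (ζ : Sp d × Sp d)
    {f : ℝ → ENNReal} (hf : AEMeasurable f) :
    ∫⁻ t, (ENNReal.ofReal lam * duh (rate a lam ζ) f t) ^ 2 ≤ ∫⁻ s, f s ^ 2 := by
  rcases hl.eq_or_lt with rfl | hl'
  · simp
  have := (ha.isRate hδ hl ζ).exp_bound hl' hl zero_le_one (fun t s hst => ?_) hf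
  · rwa [mul_one, div_self hl'.ne', ENNReal.ofReal_one, one_pow, one_mul] at this
  · rw [one_mul, prop]
    refine Real.exp_le_exp.2 (neg_le_neg ?_)
    have h1 := ha.integral_rate_ge hδ hl ζ hst
    have h2 : 0 ≤ ∫ r in s..t, ‖eta (r, ζ)‖ ^ 2 :=
      intervalIntegral.integral_nonneg hst fun _ _ => by positivity
    nlinarith

/-- The bound with weight `|2πk|^{2/3}`, given through its cube. -/
theorem IsCoeff.bound_kap (ha : IsCoeff δ a) (hδ : 0 < δ) (hδ1 : δ < 1) (hl : 0 ≤ lam)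
    (ζ : Sp d × Sp d) {m : ℝ} (hm : 0 ≤ m) (hmk : m ^ 3 = ‖(2 * Real.pi) • ζ.1‖ ^ 2)
    {f : ℝ → ENNReal} (hf : AEMeasurable f) :
    ∫⁻ t, (ENNReal.ofReal m * duh (rate a lam ζ) f t) ^ 2 ≤
      ENNReal.ofReal (36 * δ⁻¹) ^ 2 * ∫⁻ s, f s ^ 2 := by
  rcases hm.eq_or_lt with rfl | hm'
  · simp
  have := (ha.isRate hδ hl ζ).exp_bound (β := m * δ / 12) (m := m) (C := 3)
    (by positivity) hm (by norm_num) (fun t s hst => ?_) hf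
  · have e : m * 3 / (m * δ / 12) = 36 * δ⁻¹ := by field_simp; norm_num
    rwa [e] at this
  · have h1 := ha.integral_rate_ge hδ hl ζ hst
    have h2 := integral_eta_sq_ge_kap hst ζ
    rw [← hmk] at h2
    -- The lower bound `δ (t - s)³ m³ / 12` for the exponent is traded for the cruder `y³`, since
    -- `y³` is that bound times `δ²/144 ≤ 1`. With `y³ ≥ y - 1` the propagator decays at the linear
    -- rate `m δ / 12`, and the prefactor `3` absorbs `e`; the result is linear in `δ⁻¹`.
    set y := m * δ / 12 * (t - s)
    have hts : 0 ≤ t - s := sub_nonneg.2 hst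
    have hy : 0 ≤ y := by positivity
    have hy3 : y ^ 3 ≤ ∫ r in s..t, rate a lam ζ r := by
      have h3 : y ^ 3 ≤ δ * ((t - s) ^ 3 * m ^ 3 / 12) := by
        have e : y ^ 3 = δ * ((t - s) ^ 3 * m ^ 3 / 12) * (δ ^ 2 / 144) := by simp only [y]; ring
        rw [e]
        refine mul_le_of_le_one_right (by positivity) ?_
        nlinarith
      have h4 := mul_le_mul_of_nonneg_left h2 hδ.le
      have h5 : 0 ≤ lam * (t - s) := by positivity
      linarith
    have h6 : y - 1 ≤ y ^ 3 := by nlinarith [sq_nonneg (y - 1), sq_nonneg y]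
    calc prop (rate a lam ζ) t s ≤ Real.exp (1 - y) := Real.exp_le_exp.2 (by linarith)
      _ = Real.exp 1 * Real.exp (-y) := by rw [← Real.exp_add]; ring_nf
      _ ≤ 3 * Real.exp (-y) := by
          gcongr
          linarith [Real.exp_one_lt_d9]

/-- For fixed final time the weight `|η(t)|²` is a constant, and `integral_eta_sq_ge_eta` makes the
propagator decay backwards in time at rate `δ|η(t)|²/4`. -/
theorem IsCoeff.row_bound (ha : IsCoeff δ a) (hδ : 0 < δ) (hl : 0 ≤ lam) (ζ : Sp d × Sp d) (t : ℝ) :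
    ENNReal.ofReal (‖eta (t, ζ)‖ ^ 2) * ∫⁻ s in Iic t, ENNReal.ofReal (prop (rate a lam ζ) t s) ≤
      ENNReal.ofReal (4 * δ⁻¹) := by
  rcases (sq_nonneg ‖eta (t, ζ)‖).eq_or_lt with h | h
  · simp [← h]
  set n := ‖eta (t, ζ)‖ ^ 2
  have hβ : 0 < δ * n / 4 := by positivity
  calc _ ≤ ENNReal.ofReal n * ∫⁻ s in Iic t, ENNReal.ofReal (Real.exp (-(δ * n / 4 * (t - s)))) := by
        refine mul_le_mul' le_rfl (setLIntegral_mono' measurableSet_Iic fun s hs =>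
          ENNReal.ofReal_le_ofReal ?_)
        refine Real.exp_le_exp.2 (neg_le_neg ?_)
        have h1 := ha.integral_rate_ge hδ hl ζ hs
        have h2 := mul_le_mul_of_nonneg_left (integral_eta_sq_ge_eta hs ζ) hδ.le
        have h3 : 0 ≤ lam * (t - s) := mul_nonneg hl (sub_nonneg.2 hs)
        nlinarith
    _ = _ := by
        rw [lintegral_exp_Iic hβ, ← ENNReal.ofReal_mul h.le]
        congr 1
        field_simp

/-- The bound with weight `|η|²`. -/
theorem IsCoeff.bound_eta (ha : IsCoeff δ a) (hδ : 0 < δ) (hl : 0 ≤ lam) (ζ : Sp d × Sp d)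
    {f : ℝ → ENNReal} (hf : AEMeasurable f) :
    ∫⁻ t, (ENNReal.ofReal (‖eta (t, ζ)‖ ^ 2) * duh (rate a lam ζ) f t) ^ 2 ≤
      ENNReal.ofReal (2 * δ⁻¹) ^ 2 * ∫⁻ s, f s ^ 2 := by
  -- Row constant `4δ⁻¹` times column constant `δ⁻¹`.
  have e : ENNReal.ofReal (2 * δ⁻¹) ^ 2 = ENNReal.ofReal (4 * δ⁻¹) * ENNReal.ofReal δ⁻¹ := by
    rw [← ENNReal.ofReal_pow (by positivity), ← ENNReal.ofReal_mul (by positivity)]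
    ring_nf
  have hr := ha.isRate hδ hl ζ
  have hcont : Continuous fun t : ℝ => ‖eta (t, ζ)‖ ^ 2 := by
    have := continuous_eta (d := d)
    fun_prop
  rw [e]
  refine hr.weighted_bound (g := fun t => ‖eta (t, ζ)‖ ^ 2) hcont.measurable
    (fun t => by positivity) hf
    (fun t => ha.row_bound hδ hl ζ t) (fun s => ?_)
  -- In the column integral the weight varies with `t`. Ellipticity bounds it by `δ⁻¹` times the
  -- rate, and the rate times the propagator integrates to at most `1`.
  calc _ ≤ ∫⁻ t in Ici s, ENNReal.ofReal δ⁻¹ *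
          ENNReal.ofReal (rate a lam ζ t * prop (rate a lam ζ) t s) := by
        refine lintegral_mono fun t => ?_
        rw [← ENNReal.ofReal_mul (by positivity), ← mul_assoc]
        refine ENNReal.ofReal_le_ofReal (mul_le_mul_of_nonneg_right ?_ (prop_pos _ _ _).le)
        rw [inv_mul_eq_div, le_div_iff₀ hδ, rate]
        linarith [ha.le_quad t (eta (t, ζ))]
    _ = ENNReal.ofReal δ⁻¹ * ∫⁻ t in Ici s,
          ENNReal.ofReal (rate a lam ζ t * prop (rate a lam ζ) t s) :=
        lintegral_const_mul _ (hr.measurable.mul (hr.continuous_prop.comp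
          (Continuous.prodMk_left s)).measurable).ennreal_ofReal
    _ ≤ _ := mul_le_of_le_one_right' (hr.lintegral_mul_prop_le s)

/-- The bound with weight `a^{ij} η_i η_j`. -/
theorem IsCoeff.bound_quad (ha : IsCoeff δ a) (hδ : 0 < δ) (hl : 0 ≤ lam) (ζ : Sp d × Sp d)
    {f : ℝ → ENNReal} (hf : AEMeasurable f) :
    ∫⁻ t, (ENNReal.ofReal (quad a t (eta (t, ζ))) * duh (rate a lam ζ) f t) ^ 2 ≤
      ENNReal.ofReal (2 * δ⁻¹) ^ 2 * ∫⁻ s, f s ^ 2 := by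
  have hr := ha.isRate hδ hl ζ
  -- The upper ellipticity bound costs an extra `δ⁻¹` in the rows, but the columns now cost `1`.
  -- Hence the bound stays linear in `δ⁻¹`, whereas bounding `a` and `D_v² u` separately would give
  -- `δ⁻²`.
  have e : ENNReal.ofReal (2 * δ⁻¹) ^ 2 = ENNReal.ofReal δ⁻¹ * ENNReal.ofReal (4 * δ⁻¹) * 1 := by
    rw [← ENNReal.ofReal_pow (by positivity), mul_one, ← ENNReal.ofReal_mul (by positivity)]
    ring_nf
  rw [e]
  have hqm : Measurable fun t : ℝ => quad a t (eta (t, ζ)) := by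
    simpa [rate] using hr.measurable.sub_const lam
  have hA : ∀ t, ENNReal.ofReal (quad a t (eta (t, ζ))) *
      ∫⁻ s in Iic t, ENNReal.ofReal (prop (rate a lam ζ) t s) ≤
        ENNReal.ofReal δ⁻¹ * ENNReal.ofReal (4 * δ⁻¹) := fun t => by
    have hrow := mul_le_mul' (le_refl (ENNReal.ofReal δ⁻¹)) (ha.row_bound hδ hl ζ t)
    rw [← mul_assoc, ← ENNReal.ofReal_mul (by positivity)] at hrow
    exact (mul_le_mul' (ENNReal.ofReal_le_ofReal (ha.quad_le _ _)) le_rfl).trans hrow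
  have hB : ∀ s, ∫⁻ t in Ici s, ENNReal.ofReal (quad a t (eta (t, ζ)) * prop (rate a lam ζ) t s) ≤
      1 := fun s => by
    have h : ∀ t, ENNReal.ofReal (quad a t (eta (t, ζ)) * prop (rate a lam ζ) t s) ≤
        ENNReal.ofReal (rate a lam ζ t * prop (rate a lam ζ) t s) := fun t =>
      ENNReal.ofReal_le_ofReal (mul_le_mul_of_nonneg_right (le_add_of_nonneg_right hl)
        (prop_pos _ _ _).le)
    exact (lintegral_mono h).trans (hr.lintegral_mul_prop_le s)
  exact hr.weighted_bound hqm (fun t => ha.quad_nonneg hδ t _) hf hA hB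

end Symbol

end

section



variable {d : ℕ}

/-! ### Weak time derivatives and absolutely continuous representatives -/

section TimeRegularity

/-- The interval is the hull of the support, which stays in `J` by order connectedness; a point of
`J` serves when the bump is zero. -/
theorem IsBump.exists_Icc {J : Set ℝ} (hJ : J.OrdConnected) (hne : J.Nonempty) {θ : ℝ → ℝ}
    (hθ : IsBump J θ) : ∃ a b, a ≤ b ∧ Icc a b ⊆ J ∧ ∀ t, t ∉ Icc a b → θ t = 0 := by
  rcases (tsupport θ).eq_empty_or_nonempty with h | h
  · obtain ⟨t, ht⟩ := hne
    exact ⟨t, t, le_rfl, hJ.out ht ht, fun s _ => image_eq_zero_of_notMem_tsupport (by simp [h])⟩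
  · have hc : IsCompact (tsupport θ) := hθ.2.1
    refine ⟨sInf (tsupport θ), sSup (tsupport θ), Real.sInf_le_sSup _ hc.bddBelow hc.bddAbove,
      hJ.out (hθ.2.2 (hc.sInf_mem h)) (hθ.2.2 (hc.sSup_mem h)), fun s hs => ?_⟩
    refine image_eq_zero_of_notMem_tsupport fun hs' => hs ?_
    exact ⟨csInf_le hc.bddBelow hs', le_csSup hc.bddAbove hs'⟩

theorem IsBump.of_Icc {J : Set ℝ} {θ : ℝ → ℝ} {a b : ℝ} (h : ContDiff ℝ ∞ θ) (hJ : Icc a b ⊆ J)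
    (h0 : ∀ t, t ∉ Icc a b → θ t = 0) : IsBump J θ := by
  have hs : tsupport θ ⊆ Icc a b := closure_minimal (fun t ht => by
    by_contra hc; exact ht (h0 t hc)) isClosed_Icc
  exact ⟨h, HasCompactSupport.of_support_subset_isCompact isCompact_Icc
    ((subset_tsupport θ).trans hs), hs.trans hJ⟩

theorem IsBump.integrable {J : Set ℝ} {θ : ℝ → ℝ} (hθ : IsBump J θ) : Integrable θ :=
  hθ.1.continuous.integrable_of_hasCompactSupport hθ.2.1

/-- A bump of mean zero is the derivative of a bump. -/
theorem IsBump.exists_deriv_eq {J : Set ℝ} (hJ : J.OrdConnected) (hne : J.Nonempty) {θ : ℝ → ℝ}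
    (hθ : IsBump J θ) (h0 : ∫ t, θ t = 0) : ∃ θ₁, IsBump J θ₁ ∧ deriv θ₁ = θ := by
  obtain ⟨a, b, hab, hJ', hz⟩ := hθ.exists_Icc hJ hne
  have hc := hθ.1.continuous
  have hd : ∀ t, HasDerivAt (fun t => ∫ s in a..t, θ s) (θ t) t := fun t =>
    intervalIntegral.integral_hasDerivAt_right (hc.intervalIntegrable _ _)
      (hc.stronglyMeasurableAtFilter _ _) hc.continuousAt
  have hde : deriv (fun t => ∫ s in a..t, θ s) = θ := funext fun t => (hd t).deriv
  refine ⟨_, IsBump.of_Icc (a := a) (b := b) ?_ hJ' fun t ht => ?_, hde⟩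
  · rw [contDiff_infty_iff_deriv]
    exact ⟨fun t => (hd t).differentiableAt, by rw [hde]; exact hθ.1⟩
  · have hz' : ∀ x y, (∀ s ∈ uIoc x y, s ∉ Icc a b) → ∫ s in x..y, θ s = 0 := fun x y h =>
      intervalIntegral.integral_zero_ae (Eventually.of_forall fun s hs => hz s (h s hs))
    rw [mem_Icc, not_and_or, not_le, not_le] at ht
    have hab0 : ∫ s in a..b, θ s = 0 := by
      have h1 : (∫ s, θ s) = ∫ s in Icc a b, θ s :=
        (setIntegral_eq_integral_of_forall_compl_eq_zero fun s hs => hz s hs).symm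
      rw [intervalIntegral.integral_of_le hab, ← integral_Icc_eq_integral_Ioc, ← h1, h0]
    rcases ht with ht | ht
    · rw [intervalIntegral.integral_symm, intervalIntegral.integral_of_le ht.le,
        integral_Ioc_eq_integral_Ioo, neg_eq_zero]
      refine setIntegral_eq_zero_of_forall_eq_zero fun s hs => hz s fun h => ?_
      exact absurd hs.2 (not_lt.2 h.1)
    · rw [← intervalIntegral.integral_add_adjacent_intervals (hc.intervalIntegrable a b)
        (hc.intervalIntegrable b t), hab0, zero_add]
      refine hz' b t fun s hs h => ?_
      rw [uIoc_of_le ht.le] at hs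
      exact absurd hs.1 (not_lt.2 h.2)

theorem exists_bump_integral_one {J : Set ℝ} (hJ : IsOpen J) (hne : J.Nonempty) :
    ∃ θ, IsBump J θ ∧ ∫ t, θ t = 1 := by
  obtain ⟨t, ht⟩ := hne
  obtain ⟨r, hr, hrJ⟩ := Metric.isOpen_iff.1 hJ t ht
  let f : ContDiffBump t := ⟨r / 3, r / 2, by positivity, by linarith⟩
  refine ⟨f.normed volume, ⟨f.contDiff_normed, f.hasCompactSupport_normed, ?_⟩, f.integral_normed⟩
  rw [f.tsupport_normed_eq]
  exact (closedBall_subset_ball (by change r / 2 < r; linarith)).trans hrJ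

/-- The primitive in time from `t₀`. -/
def timePrim (t₀ : ℝ) (Y : Pt d → ℂ) (z : Pt d) : ℂ := ∫ s in t₀..z.1, Y (s, z.2)

/-- The variable limits of integration are encoded by measurable sets in the product with an extra
time variable, so measurability follows from that of parametric integrals. -/
theorem stronglyMeasurable_timePrim (t₀ : ℝ) {Y : Pt d → ℂ} (hY : StronglyMeasurable Y) :
    StronglyMeasurable (timePrim t₀ Y) := by
  unfold timePrim intervalIntegral
  have hYc : StronglyMeasurable fun p : Pt d × ℝ => Y (p.2, p.1.2) :=
    hY.comp_measurable (by fun_prop)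
  have e : ∀ {S : Set (Pt d × ℝ)}, MeasurableSet S →
      StronglyMeasurable fun z : Pt d => ∫ s, S.indicator (fun p => Y (p.2, p.1.2)) (z, s) :=
    fun hS => (hYc.indicator hS).integral_prod_right'
  have h1 : MeasurableSet {p : Pt d × ℝ | t₀ < p.2 ∧ p.2 ≤ p.1.1} :=
    (measurableSet_lt measurable_const measurable_snd).inter
      (measurableSet_le measurable_snd (by fun_prop))
  have h2 : MeasurableSet {p : Pt d × ℝ | p.1.1 < p.2 ∧ p.2 ≤ t₀} :=
    (measurableSet_lt (by fun_prop) measurable_snd).inter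
      (measurableSet_le measurable_snd measurable_const)
  refine (Eq.mpr ?_ ((e h1).sub (e h2)))
  congr 1
  funext z
  simp only [Pi.sub_apply]
  rw [← integral_indicator measurableSet_Ioc, ← integral_indicator measurableSet_Ioc]
  rfl

theorem isCompact_subset_box {K : Set (Pt d)} (hK : IsCompact K) :
    ∃ R : ℝ, 0 < R ∧ ∃ K' : Set (Sp d × Sp d), IsCompact K' ∧ K ⊆ Icc (-R) R ×ˢ K' := by
  obtain ⟨R, hR0, hR⟩ := hK.isBounded.subset_closedBall_lt 0 0
  refine ⟨R, hR0, closedBall 0 R, isCompact_closedBall _ _, fun z hz => ?_⟩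
  have := hR hz
  rw [mem_closedBall_zero_iff, Prod.norm_def, max_le_iff] at this
  exact ⟨abs_le.1 this.1, by simpa using this.2⟩

theorem restrict_box (A : Set ℝ) (K' : Set (Sp d × Sp d)) :
    (volume : Measure (Pt d)).restrict (A ×ˢ K') = (volume.restrict A).prod (volume.restrict K') :=
  (Measure.prod_restrict _ _).symm

theorem locallyIntegrable_of_box {f : Pt d → ℂ}
    (h : ∀ R : ℝ, 0 < R → ∀ K' : Set (Sp d × Sp d), IsCompact K' →
      IntegrableOn f (Icc (-R) R ×ˢ K')) : LocallyIntegrable f := by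
  rw [locallyIntegrable_iff]
  intro K hK
  obtain ⟨R, hR, K', hK', hs⟩ := isCompact_subset_box hK
  exact (h R hR K' hK').mono_set hs

theorem LocallyIntegrable.integrable_box {f : Pt d → ℂ} (hf : LocallyIntegrable f) (a b : ℝ)
    {K' : Set (Sp d × Sp d)} (hK' : IsCompact K') :
    Integrable f ((volume.restrict (Icc a b)).prod (volume.restrict K')) := by
  rw [← restrict_box]
  exact hf.integrableOn_isCompact (isCompact_Icc.prod hK')

theorem ae_of_forall_compact {P : Sp d × Sp d → Prop}
    (h : ∀ K' : Set (Sp d × Sp d), IsCompact K' → ∀ᵐ ζ ∂(volume.restrict K'), P ζ) :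
    ∀ᵐ ζ, P ζ := by
  have h1 : ∀ n : ℕ, ∀ᵐ ζ : Sp d × Sp d, ζ ∈ closedBall (0 : Sp d × Sp d) n → P ζ := fun n =>
    (ae_restrict_iff' measurableSet_closedBall).1 (h _ (isCompact_closedBall _ _))
  filter_upwards [ae_all_iff.2 h1] with ζ hζ
  obtain ⟨n, hn⟩ := exists_nat_ge ‖ζ‖
  exact hζ n (by simpa using hn)

/-- Almost every time slice of a locally integrable function is locally integrable. -/
theorem ae_intervalIntegrable {f : Pt d → ℂ} (hf : LocallyIntegrable f) :
    ∀ᵐ ζ : Sp d × Sp d, ∀ a b, IntervalIntegrable (fun t => f (t, ζ)) volume a b := by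
  have h1 : ∀ n : ℕ, ∀ᵐ ζ : Sp d × Sp d, IntegrableOn (fun t => f (t, ζ)) (Icc (-n : ℝ) n) :=
    fun n => ae_of_forall_compact fun K' hK' =>
      (LocallyIntegrable.integrable_box hf (-n : ℝ) n hK').prod_left_ae
  filter_upwards [ae_all_iff.2 h1] with ζ hζ a b
  obtain ⟨n, hn⟩ := exists_nat_ge (max |a| |b|)
  refine IntegrableOn.intervalIntegrable ((hζ n).mono_set ?_)
  have ha := abs_le.1 ((le_max_left _ _).trans hn)
  have hb := abs_le.1 ((le_max_right _ _).trans hn)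
  exact uIcc_subset_Icc ⟨ha.1, ha.2⟩ ⟨hb.1, hb.2⟩

theorem locallyIntegrable_of_slice {C : Sp d × Sp d → ℂ}
    (h : ∀ K' : Set (Sp d × Sp d), IsCompact K' → IntegrableOn C K') :
    LocallyIntegrable (fun z : Pt d => C z.2) := by
  refine locallyIntegrable_of_box fun R hR K' hK' => ?_
  have := (integrable_const (μ := volume.restrict (Icc (-R) R)) (1 : ℂ)).mul_prod (h K' hK')
  rw [IntegrableOn, restrict_box]
  simpa using this

/-- On a box the primitive is dominated by the integral of `‖Y‖` over one fixed time window
containing `t₀` and the box, which is integrable in the remaining variables. -/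
theorem locallyIntegrable_timePrim (t₀ : ℝ) {Y : Pt d → ℂ} (hY : StronglyMeasurable Y)
    (hYi : LocallyIntegrable Y) : LocallyIntegrable (timePrim t₀ Y) := by
  refine locallyIntegrable_of_box fun R hR K' hK' => ?_
  set a := min t₀ (-R)
  set b := max t₀ R
  have h1 := (LocallyIntegrable.integrable_box hYi a b hK').norm.integral_prod_right
  have h2 := (integrable_const (μ := volume.restrict (Icc (-R) R)) (1 : ℝ)).mul_prod h1
  have h3 : ∀ᵐ ζ ∂(volume.restrict K'), IntegrableOn (fun t => Y (t, ζ)) (Icc a b) :=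
    (LocallyIntegrable.integrable_box hYi a b hK').prod_left_ae
  have h4 : ∀ᵐ z : Pt d ∂((volume.restrict (Icc (-R) R)).prod (volume.restrict K')),
      IntegrableOn (fun t => Y (t, z.2)) (Icc a b) :=
    Measure.quasiMeasurePreserving_snd.ae h3
  have h5 : ∀ᵐ z : Pt d ∂((volume.restrict (Icc (-R) R)).prod (volume.restrict K')),
      z.1 ∈ Icc (-R) R :=
    Measure.quasiMeasurePreserving_fst.ae (ae_restrict_mem measurableSet_Icc)
  rw [IntegrableOn, restrict_box]
  refine h2.mono' (stronglyMeasurable_timePrim t₀ hY).aestronglyMeasurable ?_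
  filter_upwards [h4, h5] with z hz hz1
  rw [one_mul]
  refine (intervalIntegral.norm_integral_le_integral_norm_uIoc).trans ?_
  refine setIntegral_mono_set hz.norm (Eventually.of_forall fun s => norm_nonneg _)
    (LE.le.eventuallyLE ?_)
  refine uIoc_subset_uIcc.trans (uIcc_subset_Icc ⟨min_le_left _ _, le_max_left _ _⟩
    ⟨(min_le_right _ _).trans hz1.1, hz1.2.trans (le_max_right _ _)⟩)

theorem isPrim_timePrim (t₀ : ℝ) {Y : Pt d → ℂ} {ζ : Sp d × Sp d}
    (h : ∀ a b, IntervalIntegrable (fun t => Y (t, ζ)) volume a b) {a b : ℝ} (hab : a ≤ b) (C : ℂ) :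
    IsPrim (fun t => C + timePrim t₀ Y (t, ζ)) (fun t => Y (t, ζ)) a b := by
  refine ⟨hab, h a b, fun x _ => ?_⟩
  simp only [timePrim]
  rw [add_assoc, intervalIntegral.integral_add_adjacent_intervals (h _ _) (h _ _)]

theorem continuous_tens_bump {J : Set ℝ} {O W : Set (Sp d)} {θ : ℝ → ℝ} {A B : Sp d → ℝ}
    (hθ : IsBump J θ) (hA : IsBump O A) (hB : IsBump W B) :
    Continuous (tens (cpx θ) (cpx A) (cpx B)) := by
  have := hθ.1.continuous
  have := hA.1.continuous
  have := hB.1.continuous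
  unfold tens cpx
  fun_prop

theorem hasCompactSupport_tens_bump {J : Set ℝ} {O W : Set (Sp d)} {θ : ℝ → ℝ} {A B : Sp d → ℝ}
    (hθ : IsBump J θ) (hA : IsBump O A) (hB : IsBump W B) :
    HasCompactSupport (tens (cpx θ) (cpx A) (cpx B)) := by
  refine HasCompactSupport.of_support_subset_isCompact
    (hθ.2.1.isCompact.prod (hA.2.1.isCompact.prod hB.2.1.isCompact)) fun z hz => ?_
  simp only [mem_support, tens, cpx, ne_eq, mul_eq_zero, Complex.ofReal_eq_zero, not_or] at hz
  exact ⟨subset_tsupport _ hz.1.1, subset_tsupport _ hz.1.2, subset_tsupport _ hz.2⟩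

theorem integrable_mul_tens_bump {R : Pt d → ℂ} (hR : LocallyIntegrable R) {J : Set ℝ}
    {O W : Set (Sp d)} {θ : ℝ → ℝ} {A B : Sp d → ℝ}
    (hθ : IsBump J θ) (hA : IsBump O A) (hB : IsBump W B) :
    Integrable fun z => R z * tens (cpx θ) (cpx A) (cpx B) z := by
  have := hR.integrable_smul_left_of_hasCompactSupport (continuous_tens_bump hθ hA hB)
    (hasCompactSupport_tens_bump hθ hA hB)
  simpa [mul_comm] using this

theorem IsBump.deriv {J : Set ℝ} {θ : ℝ → ℝ} (hθ : IsBump J θ) : IsBump J (deriv θ) :=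
  ⟨(contDiff_infty_iff_deriv.1 hθ.1).2, hθ.2.1.deriv, tsupport_deriv_subset.trans hθ.2.2⟩

/-- Fubini for a locally integrable function tested with a tensor. -/
theorem integral_mul_tens_slice {R : Pt d → ℂ} (hR : LocallyIntegrable R) {J : Set ℝ}
    {O W : Set (Sp d)} {θ : ℝ → ℝ} {A B : Sp d → ℝ}
    (hθ : IsBump J θ) (hA : IsBump O A) (hB : IsBump W B) :
    ∫ z, R z * tens (cpx θ) (cpx A) (cpx B) z =
      ∫ ζ : Sp d × Sp d, (∫ t, R (t, ζ) * θ t) * (A ζ.1 * B ζ.2) := by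
  have h := integral_prod_symm _ (integrable_mul_tens_bump hR hθ hA hB)
  refine Eq.trans h (integral_congr_ae (Eventually.of_forall fun ζ => ?_))
  simp only [tens, cpx]
  rw [← integral_mul_const]
  congr 1 with t
  ring

/-- Integration by parts on one time line, valid because both factors are absolutely continuous. -/
theorem integral_timePrim_mul_deriv (t₀ : ℝ) {Y : Pt d → ℂ} {ζ : Sp d × Sp d}
    (h : ∀ a b, IntervalIntegrable (fun t => Y (t, ζ)) volume a b) {J : Set ℝ} {θ : ℝ → ℝ}
    (hθ : IsBump J θ) :
    ∫ t, timePrim t₀ Y (t, ζ) * ((deriv θ t : ℝ) : ℂ) = -∫ t, Y (t, ζ) * θ t := by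
  have hθ' : IsBump univ θ := ⟨hθ.1, hθ.2.1, subset_univ _⟩
  obtain ⟨a, b, hab, -, hz⟩ := hθ'.exists_Icc ordConnected_univ univ_nonempty
  have hz' : ∀ t, t ∉ Icc a b → deriv θ t = 0 := by
    intro t ht
    have : θ =ᶠ[𝓝 t] fun _ => 0 := by
      filter_upwards [isClosed_Icc.isOpen_compl.mem_nhds ht] with s hs using hz s hs
    rw [this.deriv_eq, deriv_const]
  -- The interval is widened by one on each side so that the bump vanishes at both endpoints and no
  -- boundary term remains.
  set a' := a - 1
  set b' := b + 1
  have hab' : a' ≤ b' := by simp only [a', b']; linarith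
  have hp : IsPrim (fun t => (θ t : ℂ)) (fun t => ((deriv θ t : ℝ) : ℂ)) a' b' := by
    refine ⟨hab', ?_, fun x _ => ?_⟩
    · exact (Complex.continuous_ofReal.comp hθ.deriv.1.continuous).intervalIntegrable _ _
    · rw [intervalIntegral.integral_ofReal, intervalIntegral.integral_deriv_eq_sub]
      · push_cast; ring
      · exact fun y _ => (hθ.1.differentiable (by simp)) y
      · exact hθ.deriv.1.continuous.intervalIntegrable _ _
  have hm := ((isPrim_timePrim t₀ h hab' 0).mul hp).sub_eq
  have ha' : θ a' = 0 := hz _ (by simp only [a', mem_Icc]; intro h; linarith [h.1])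
  have hb' : θ b' = 0 := hz _ (by simp only [b', mem_Icc]; intro h; linarith [h.2])
  simp only [ha', hb', Complex.ofReal_zero, mul_zero, sub_self, zero_add] at hm
  have hsub : Icc a b ⊆ Ioc a' b' := fun x hx =>
    ⟨by simp only [a']; linarith [hx.1], by simp only [b']; linarith [hx.2]⟩
  have key : ∀ g : ℝ → ℂ, (∀ t, t ∉ Icc a b → g t = 0) → ∫ t, g t = ∫ t in a'..b', g t := by
    intro g hg
    rw [intervalIntegral.integral_of_le hab']
    exact (setIntegral_eq_integral_of_forall_compl_eq_zero
      fun t ht => hg t fun h => ht (hsub h)).symm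
  rw [key _ fun t ht => by simp [hz' t ht], key _ fun t ht => by simp [hz t ht]]
  have hp' := isPrim_timePrim t₀ h hab' 0
  rw [intervalIntegral.integral_add (hp'.integrable.mul_continuousOn hp.continuousOn)
    (hp.integrable.continuousOn_mul (by simpa using hp'.continuousOn))] at hm
  rw [eq_neg_iff_add_eq_zero, add_comm]
  exact hm.symm

theorem integrable_slice_mul_bump {R : Pt d → ℂ} {ζ : Sp d × Sp d}
    (h : ∀ a b, IntervalIntegrable (fun t => R (t, ζ)) volume a b) {J : Set ℝ} {θ : ℝ → ℝ}
    (hθ : IsBump J θ) : Integrable fun t => R (t, ζ) * (θ t : ℂ) := by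
  have hl : LocallyIntegrable fun t => R (t, ζ) := by
    rw [locallyIntegrable_iff]
    intro K hK
    obtain ⟨r, hr⟩ := hK.isBounded.subset_closedBall 0
    rw [Real.closedBall_eq_Icc] at hr
    rcases le_or_gt (0 - r) (0 + r) with hle | hlt
    · have := h (0 - r) (0 + r)
      rw [intervalIntegrable_iff_integrableOn_Icc_of_le hle] at this
      exact this.mono_set hr
    · rw [Icc_eq_empty (not_le.2 hlt)] at hr
      rw [subset_empty_iff.1 hr]
      exact integrableOn_empty
  have := hl.integrable_smul_left_of_hasCompactSupport (g := cpx θ)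
    (Complex.continuous_ofReal.comp hθ.1.continuous)
    (hθ.2.1.comp_left (g := fun r : ℝ => (r : ℂ)) (by simp))
  simpa [mul_comm] using this

theorem ae_slice {P : Pt d → Prop} (h : ∀ᵐ z, P z) : ∀ᵐ ζ : Sp d × Sp d, ∀ᵐ t : ℝ, P (t, ζ) := by
  have h1 : ∀ᵐ w : (Sp d × Sp d) × ℝ, P w.swap :=
    (Measure.measurePreserving_swap (μ := (volume : Measure (Sp d × Sp d)))
      (ν := (volume : Measure ℝ))).quasiMeasurePreserving.ae h
  exact Measure.ae_ae_of_ae_prod h1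

theorem IsPrim.congr_deriv {f g g' : ℝ → ℂ} {a b : ℝ} (h : IsPrim f g a b)
    (hg : ∀ᵐ t, g t = g' t) : IsPrim f g' a b := by
  refine ⟨h.le, h.integrable.congr_ae (ae_restrict_of_ae hg), fun x hx => ?_⟩
  rw [h.eq x hx]
  congr 1
  exact intervalIntegral.integral_congr_ae (hg.mono fun t ht _ => ht)

/-- A function whose weak time derivative is square integrable agrees with a function that is
absolutely continuous along almost every time line. -/
theorem exists_isPrim_of_weak {J : Set ℝ} (hJ : IsOpen J) (hJc : J.OrdConnected)
    (hne : J.Nonempty) {U Y : Pt d → ℂ} (hU : MemLp U 2) (hY : MemLp Y 2)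
    (h : ∀ θ A B, IsBump J θ → IsBump univ A → IsBump univ B →
      ∫ z, U z * tens (cpx (deriv θ)) (cpx A) (cpx B) z =
        -∫ z, Y z * tens (cpx θ) (cpx A) (cpx B) z) :
    ∃ W : Pt d → ℂ, (∀ᵐ z, z.1 ∈ J → U z = W z) ∧
      ∀ᵐ ζ : Sp d × Sp d, ∀ a b, a ≤ b → IsPrim (fun t => W (t, ζ)) (fun t => Y (t, ζ)) a b := by
  -- A strongly measurable representative makes the time primitive jointly measurable.
  set Y' := hY.1.mk Y with hY'
  have hYY : Y =ᵐ[volume] Y' := hY.1.ae_eq_mk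
  have hYm : StronglyMeasurable Y' := hY.1.stronglyMeasurable_mk
  have hYl : LocallyIntegrable Y' := MemLp.locallyIntegrable_two (hY.ae_eq hYY)
  have hPl := locallyIntegrable_timePrim 0 hYm hYl
  -- The weak time derivative of `R` vanishes on `J`. What remains is to show that `R` does not
  -- depend on time there.
  set R : Pt d → ℂ := fun z => U z - timePrim 0 Y' z with hR
  have hRl : LocallyIntegrable R := (MemLp.locallyIntegrable_two hU).sub hPl
  have hRs := ae_intervalIntegrable hRl
  have hYs := ae_intervalIntegrable hYl
  have hz : ∀ θ A B, IsBump J θ → IsBump univ A → IsBump univ B →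
      ∫ z, R z * tens (cpx (deriv θ)) (cpx A) (cpx B) z = 0 := by
    intro θ A B hθ hA hB
    simp only [hR, sub_mul]
    rw [integral_sub (integrable_mul_tens_bump (MemLp.locallyIntegrable_two hU) hθ.deriv hA hB)
      (integrable_mul_tens_bump hPl hθ.deriv hA hB), h θ A B hθ hA hB,
      integral_mul_tens_slice hPl hθ.deriv hA hB]
    have e1 : ∫ z, Y z * tens (cpx θ) (cpx A) (cpx B) z =
        ∫ z, Y' z * tens (cpx θ) (cpx A) (cpx B) z :=
      integral_congr_ae (by filter_upwards [hYY] with z hz; rw [hz])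
    rw [e1, integral_mul_tens_slice hYl hθ hA hB, ← integral_neg, sub_eq_zero]
    refine integral_congr_ae ?_
    filter_upwards [hYs] with ζ hζ
    rw [integral_timePrim_mul_deriv 0 hζ hθ, neg_mul]
  obtain ⟨θ₀, hθ₀, hi₀⟩ := exists_bump_integral_one hJ hne
  -- If `R` is independent of time, its value must be its average against the unit mass bump `θ₀`.
  set C : Sp d × Sp d → ℂ := fun ζ => ∫ t, R (t, ζ) * θ₀ t with hC
  have hCl : LocallyIntegrable fun z : Pt d => C z.2 := by
    refine locallyIntegrable_of_slice fun K' hK' => ?_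
    obtain ⟨a, b, -, -, hz0⟩ := hθ₀.exists_Icc hJc hne
    have hRθ : LocallyIntegrable fun z : Pt d => R z * (θ₀ z.1 : ℂ) := by
      have hc : Continuous fun z : Pt d => (θ₀ z.1 : ℂ) :=
        Complex.continuous_ofReal.comp (hθ₀.1.continuous.comp continuous_fst)
      refine locallyIntegrable_iff.2 fun K hK => ?_
      exact (hRl.integrableOn_isCompact hK).mul_continuousOn hc.continuousOn hK
    have h1 := (LocallyIntegrable.integrable_box hRθ a b hK').integral_prod_right
    refine h1.congr (Eventually.of_forall fun ζ => ?_)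
    exact setIntegral_eq_integral_of_forall_compl_eq_zero fun t ht => by simp [hz0 t ht]
  have hfin : ∀ᵐ z : Pt d, z ∈ J ×ˢ (univ : Set (Sp d)) ×ˢ (univ : Set (Sp d)) →
      R z - C z.2 = 0 := by
    refine ae_eq_zero_of_tens hJ isOpen_univ isOpen_univ (hRl.sub hCl) fun θ A B hθ hA hB => ?_
    set c := ∫ t, θ t with hc
    -- Subtracting the mean times `θ₀` leaves a bump of mean zero, hence the derivative of a bump,
    -- against which `R` integrates to zero.
    have hb : IsBump J (fun t => θ t - c * θ₀ t) := by
      refine ⟨hθ.1.sub (contDiff_const.mul hθ₀.1), hθ.2.1.sub (hθ₀.2.1.mul_left), ?_⟩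
      refine (tsupport_sub _ _).trans (union_subset hθ.2.2 ?_)
      exact (tsupport_mul_subset_right).trans hθ₀.2.2
    obtain ⟨θ₁, hθ₁, hd₁⟩ := hb.exists_deriv_eq hJc hne (by
      rw [integral_sub hθ.integrable (hθ₀.integrable.const_mul c), integral_const_mul, hi₀, hc]
      ring)
    have h1 := hz θ₁ A B hθ₁ hA hB
    rw [hd₁, integral_mul_tens_slice hRl hb hA hB] at h1
    rw [← h1]
    refine (integral_mul_tens_slice (hRl.sub hCl) hθ hA hB).trans ?_
    refine integral_congr_ae ?_
    filter_upwards [hRs] with ζ hζ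
    congr 1
    have i1 := integrable_slice_mul_bump hζ hθ
    have i2 := integrable_slice_mul_bump hζ hθ₀
    have e1 : ∀ t, R (t, ζ) * ((θ t - c * θ₀ t : ℝ) : ℂ) =
        R (t, ζ) * θ t - c * (R (t, ζ) * θ₀ t) := fun t => by push_cast; ring
    have e2 : ∀ t, (R (t, ζ) - C ζ) * (θ t : ℂ) = R (t, ζ) * θ t - C ζ * (θ t : ℂ) :=
      fun t => by ring
    have i3 : Integrable fun t => (θ t : ℂ) := hθ.integrable.ofReal
    simp only [Pi.sub_apply, e1, e2]
    rw [integral_sub i1 (i2.const_mul _), integral_sub i1 (i3.const_mul _), integral_const_mul,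
      integral_const_mul, integral_complex_ofReal, mul_comm (C ζ)]
  refine ⟨fun z => C z.2 + timePrim 0 Y' z, ?_, ?_⟩
  · filter_upwards [hfin] with z hz hzJ
    have := hz ⟨hzJ, mem_univ _, mem_univ _⟩
    simp only [hR] at this
    linear_combination this
  · filter_upwards [hYs, ae_slice hYY] with ζ hζ hζ' a b hab
    exact (isPrim_timePrim 0 hζ hab (C ζ)).congr_deriv (hζ'.mono fun t ht => ht.symm)

end TimeRegularity

end

section



variable {d : ℕ}

/-! ### Weak derivatives under the transform -/

section WeakDerivatives

/-- Truncations of a Schwartz function, dominated together with their gradients. -/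
theorem exists_cutoff_seq (α : 𝓢(Sp d, ℂ)) : ∃ (g : ℕ → Sp d → ℂ) (D : Sp d → ℝ), MemLp D 2 ∧
    (∀ n, ContDiff ℝ ∞ (g n)) ∧ (∀ n, HasCompactSupport (g n)) ∧ (∀ n x, ‖g n x‖ ≤ D x) ∧
    (∀ n x e, ‖e‖ ≤ 1 → ‖fderiv ℝ (g n) x e‖ ≤ D x) ∧ ∀ x, ∀ᶠ n in atTop, g n =ᶠ[𝓝 x] α := by
  let χ : ContDiffBump (0 : Sp d) := ⟨1, 2, by norm_num, by norm_num⟩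
  have hχ : ContDiff ℝ ∞ χ := χ.contDiff
  have hχc : HasCompactSupport χ := χ.hasCompactSupport
  obtain ⟨C, hC⟩ := (hχc.fderiv ℝ).exists_bound_of_continuous
    (hχ.continuous_fderiv (by simp))
  have hC0 : 0 ≤ C := (norm_nonneg _).trans (hC 0)
  -- The scales are at most `1`, so the gradients of the dilated cutoffs stay below the fixed bound
  -- `C`.
  let c : ℕ → ℝ := fun n => ((n : ℝ) + 1)⁻¹
  have hc0 : ∀ n, 0 < c n := fun n => by positivity
  have hc1 : ∀ n, c n ≤ 1 := fun n => inv_le_one_of_one_le₀ (by simp)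
  have hχn : ∀ n, ContDiff ℝ ∞ fun x : Sp d => ((χ (c n • x) : ℝ) : ℂ) := fun n =>
    Complex.ofRealCLM.contDiff.comp (hχ.comp (contDiff_const_smul _))
  have hα : ContDiff ℝ ∞ α := α.smooth _
  have hd : ∀ n x, HasFDerivAt (fun x : Sp d => ((χ (c n • x) : ℝ) : ℂ))
      (Complex.ofRealCLM.comp ((fderiv ℝ χ (c n • x)).comp (c n • ContinuousLinearMap.id ℝ (Sp d))))
      x := fun n x => by
    have h1 : HasFDerivAt χ (fderiv ℝ χ (c n • x)) (c n • x) :=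
      (hχ.differentiable (by simp) _).hasFDerivAt
    have h2 : HasFDerivAt (fun x : Sp d => c n • x) (c n • ContinuousLinearMap.id ℝ (Sp d)) x :=
      (hasFDerivAt_id x).const_smul (c n)
    exact Complex.ofRealCLM.hasFDerivAt.comp x (h1.comp x h2)
  refine ⟨fun n x => (χ (c n • x) : ℂ) * α x, fun x => ‖fderiv ℝ α x‖ + (C + 1) * ‖α x‖,
    ?_, fun n => (hχn n).mul hα, fun n => ?_, fun n x => ?_, fun n x e he => ?_, fun x => ?_⟩
  · exact ((fderivCLM ℝ (Sp d) ℂ α).memLp 2).norm.add (((α.memLp 2).norm).const_mul _)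
  · have h1 : HasCompactSupport fun x : Sp d => χ (c n • x) := hχc.comp_smul (hc0 n).ne'
    exact (h1.comp_left (g := fun r : ℝ => (r : ℂ)) (by simp)).mul_right
  · rw [norm_mul, Complex.norm_real, Real.norm_eq_abs, abs_of_nonneg χ.nonneg]
    have := χ.le_one (x := c n • x)
    nlinarith [norm_nonneg (α x), norm_nonneg (fderiv ℝ α x)]
  · have h1 := (hd n x).mul (α.hasFDerivAt x)
    refine (congrArg (fun L : Sp d →L[ℝ] ℂ => ‖L e‖) h1.fderiv).trans_le ?_
    simp only [add_apply, smul_apply, smul_eq_mul]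
    refine (norm_add_le _ _).trans ?_
    rw [norm_mul, norm_mul, Complex.norm_real, Real.norm_eq_abs, abs_of_nonneg χ.nonneg]
    have h2 : ‖fderiv ℝ α x e‖ ≤ ‖fderiv ℝ α x‖ := ContinuousLinearMap.unit_le_opNorm _ _ he
    have h3 : ‖(Complex.ofRealCLM.comp ((fderiv ℝ χ (c n • x)).comp
        (c n • ContinuousLinearMap.id ℝ (Sp d)))) e‖ ≤ C := by
      simp only [ContinuousLinearMap.comp_apply, smul_apply,
        ContinuousLinearMap.id_apply, Complex.ofRealCLM_apply, Complex.norm_real]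
      have h4 : ‖c n • e‖ ≤ 1 := by
        rw [norm_smul, Real.norm_eq_abs, abs_of_pos (hc0 n)]
        exact mul_le_one₀ (hc1 n) (norm_nonneg _) he
      exact (ContinuousLinearMap.unit_le_opNorm _ _ h4).trans (hC _)
    have := χ.le_one (x := c n • x)
    have := χ.nonneg (x := c n • x)
    have := mul_le_mul_of_nonneg_left h3 (norm_nonneg (α x))
    have := mul_le_mul_of_nonneg_right ‹χ (c n • x) ≤ 1› (norm_nonneg (fderiv ℝ α x e))
    nlinarith [norm_nonneg (α x)]
  · obtain ⟨N, hN⟩ := exists_nat_gt (‖x‖ + 1)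
    filter_upwards [eventually_ge_atTop N] with n hn
    filter_upwards [ball_mem_nhds x one_pos] with y hy
    have hy' : ‖y‖ ≤ ‖x‖ + 1 := by
      have h1 : ‖y - x‖ < 1 := by rwa [mem_ball, dist_eq_norm] at hy
      linarith [norm_sub_norm_le y x]
    have hNn : (N : ℝ) ≤ n := by exact_mod_cast hn
    rw [χ.one_of_mem_closedBall]
    · simp
    · rw [mem_closedBall_zero_iff, norm_smul, Real.norm_eq_abs, abs_of_pos (hc0 n)]
      change ((n : ℝ) + 1)⁻¹ * ‖y‖ ≤ 1
      rw [inv_mul_le_iff₀ (by positivity)]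
      linarith

theorem tendsto_integral_stens {u : Pt d → ℂ} (hu : MemLp u 2) {θ : ℝ → ℂ} (hθ : MemLp θ 2)
    {α β : Sp d → ℂ} {αs βs : ℕ → Sp d → ℂ} (hαm : ∀ n, Continuous (αs n))
    (hβm : ∀ n, Continuous (βs n)) {Dα Dβ : Sp d → ℝ} (hDα : MemLp Dα 2) (hDβ : MemLp Dβ 2)
    (hα : ∀ n x, ‖αs n x‖ ≤ Dα x) (hβ : ∀ n x, ‖βs n x‖ ≤ Dβ x)
    (lα : ∀ x, Tendsto (fun n => αs n x) atTop (𝓝 (α x)))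
    (lβ : ∀ x, Tendsto (fun n => βs n x) atTop (𝓝 (β x))) :
    Tendsto (fun n => ∫ z, u z * stens θ (αs n) (βs n) z) atTop
      (𝓝 (∫ z, u z * stens θ α β z)) := by
  have hD : MemLp (stens θ (cpx Dα) (cpx Dβ)) 2 := memLp_stens hθ hDα.ofReal hDβ.ofReal
  have hm : ∀ n, MemLp (stens θ (αs n) (βs n)) 2 := fun n =>
    memLp_stens hθ (hDα.mono' (hαm n).aestronglyMeasurable (Eventually.of_forall (hα n)))
      (hDβ.mono' (hβm n).aestronglyMeasurable (Eventually.of_forall (hβ n)))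
  refine tendsto_integral_of_dominated_convergence
    (fun z => ‖u z * stens θ (cpx Dα) (cpx Dβ) z‖) (fun n => hu.1.mul (hm n).1)
    (hu.integrable_mul hD).norm (fun n => Eventually.of_forall fun z => ?_)
    (Eventually.of_forall fun z => ?_)
  · simp only [norm_mul, stens, cpx, Complex.norm_real, Real.norm_eq_abs]
    gcongr
    · exact (hα n _).trans (le_abs_self _)
    · exact (hβ n _).trans (le_abs_self _)
  · exact ((tendsto_const_nhds.mul (lα _)).mul (lβ _)).const_mul _

/-- `X u = g` on `G` in the sense of distributions, for a divergence free vector field `X`. -/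
def IsWeakAlong (G : Set (Pt d)) (X : Pt d → Pt d) (u g : Pt d → ℝ) : Prop :=
  ∀ φ, IsTest G φ → ∫ z in G, u z * fderiv ℝ φ z (X z) = -∫ z in G, g z * φ z

/-- Extension of a real function by zero, with complex values. -/
def ext0 (G : Set (Pt d)) (u : Pt d → ℝ) : Pt d → ℂ := G.indicator (cpx u)

theorem memLp_ext0 {G : Set (Pt d)} (hG : MeasurableSet G) {u : Pt d → ℝ}
    (hu : MemLp u 2 (leb G)) : MemLp (ext0 G u) 2 :=
  (memLp_indicator_iff_restrict hG).2 hu.ofReal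

theorem integral_ext0_mul {G : Set (Pt d)} (hG : MeasurableSet G) (u : Pt d → ℝ) (τ : Pt d → ℂ) :
    ∫ z, ext0 G u z * τ z = ∫ z in G, (u z : ℂ) * τ z := by
  rw [← integral_indicator hG]
  congr 1 with z
  by_cases hz : z ∈ G <;> simp [ext0, hz, cpx]

/-- The weak formulation may be tested with complex functions. -/
theorem IsWeakAlong.complex {G : Set (Pt d)} (hG : MeasurableSet G) {X : Pt d → Pt d}
    (hX : Continuous X) {u g : Pt d → ℝ} (hu : MemLp u 2 (leb G)) (hg : MemLp g 2 (leb G))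
    (h : IsWeakAlong G X u g) {τ : Pt d → ℂ} (hτ : ContDiff ℝ ∞ τ) (hc : HasCompactSupport τ)
    (hs : tsupport τ ⊆ G) :
    ∫ z, ext0 G u z * fderiv ℝ τ z (X z) = -∫ z, ext0 G g z * τ z := by
  have hτc : Continuous fun z => fderiv ℝ τ z (X z) :=
    (hτ.continuous_fderiv (by simp)).clm_apply hX
  have hτs : HasCompactSupport fun z => fderiv ℝ τ z (X z) := (hc.fderiv ℝ).mono fun z hz => by
    simp only [mem_support] at hz ⊢
    intro h0
    simp [h0] at hz
  have i1 : Integrable (fun z => (u z : ℂ) * fderiv ℝ τ z (X z)) (leb G) :=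
    MemLp.integrable_mul (p := 2) (q := 2) (f := cpx u) hu.ofReal
      ((hτc.memLp_of_hasCompactSupport hτs).restrict G)
  have i2 : Integrable (fun z => (g z : ℂ) * τ z) (leb G) :=
    MemLp.integrable_mul (p := 2) (q := 2) (f := cpx g) hg.ofReal
      ((hτ.continuous.memLp_of_hasCompactSupport hc).restrict G)
  -- The real and imaginary parts of a complex test function are admissible real ones; `L` stands
  -- for either projection.
  have key : ∀ L : ℂ →L[ℝ] ℝ, (∀ (r : ℝ) (w : ℂ), L (r * w) = r * L w) →
      L (∫ z, ext0 G u z * fderiv ℝ τ z (X z)) = L (-∫ z, ext0 G g z * τ z) := by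
    intro L hL
    have hs' : support (fun z => L (τ z)) ⊆ support τ := fun z hz h0 => by
      simp only [mem_support] at hz
      rw [h0, map_zero] at hz
      exact hz rfl
    have h1 := h (fun z => L (τ z)) ⟨L.contDiff.comp hτ, hc.mono hs',
      (closure_mono hs').trans hs⟩
    have hf : ∀ z, fderiv ℝ (fun z => L (τ z)) z (X z) = L (fderiv ℝ τ z (X z)) := fun z => by
      have := L.hasFDerivAt.comp z (hτ.differentiable (by simp) z).hasFDerivAt
      have e := this.fderiv
      rw [show (fun z => L (τ z)) = L ∘ τ from rfl, e]
      rfl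
    simp only [hf, ← hL] at h1
    rw [integral_ext0_mul hG, integral_ext0_mul hG, map_neg,
      ← ContinuousLinearMap.integral_comp_comm L i1, ← ContinuousLinearMap.integral_comp_comm L i2]
    exact h1
  apply Complex.ext
  · exact key Complex.reCLM fun r w => by simp
  · exact key Complex.imCLM fun r w => by simp

/-- The cylinder `J × ℝ^{2d}`. -/
def cyl (d : ℕ) (J : Set ℝ) : Set (Pt d) := {z | z.1 ∈ J}

theorem isOpen_cyl {J : Set ℝ} (hJ : IsOpen J) : IsOpen (cyl d J) := hJ.preimage continuous_fst

theorem IsBump.contDiff_cpx {J : Set ℝ} {θ : ℝ → ℝ} (hθ : IsBump J θ) : ContDiff ℝ ∞ (cpx θ) :=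
  Complex.ofRealCLM.contDiff.comp hθ.1

theorem contDiff_stens {J : Set ℝ} {θ : ℝ → ℝ} (hθ : IsBump J θ) {α β : Sp d → ℂ}
    (hα : ContDiff ℝ ∞ α) (hβ : ContDiff ℝ ∞ β) : ContDiff ℝ ∞ (stens (cpx θ) α β) := by
  have := hθ.contDiff_cpx
  unfold stens
  refine ContDiff.mul (ContDiff.mul (this.comp contDiff_fst) (hα.comp ?_)) (hβ.comp ?_)
  · exact (contDiff_fst.comp contDiff_snd).add
      (contDiff_fst.smul (contDiff_snd.comp contDiff_snd))
  · exact contDiff_snd.comp contDiff_snd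

theorem tsupport_stens_subset (θ : ℝ → ℝ) (α β : Sp d → ℂ) :
    tsupport (stens (cpx θ) α β) ⊆ (shear d) ⁻¹' (tsupport θ ×ˢ tsupport α ×ˢ tsupport β) := by
  refine closure_minimal (fun z hz => ?_) ((((isClosed_tsupport θ).prod
    ((isClosed_tsupport α).prod (isClosed_tsupport β)))).preimage (shear d).continuous)
  simp only [mem_support, stens, cpx, ne_eq, mul_eq_zero, Complex.ofReal_eq_zero, not_or] at hz
  exact ⟨subset_tsupport _ hz.1.1, subset_tsupport _ hz.1.2, subset_tsupport _ hz.2⟩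

theorem hasCompactSupport_stens {θ : ℝ → ℝ} (hθ : HasCompactSupport θ) {α β : Sp d → ℂ}
    (hα : HasCompactSupport α) (hβ : HasCompactSupport β) :
    HasCompactSupport (stens (cpx θ) α β) := by
  have h : IsCompact ((shear d) ⁻¹' (tsupport θ ×ˢ tsupport α ×ˢ tsupport β)) :=
    (shear d).isCompact_preimage.2
      (hθ.isCompact.prod (hα.isCompact.prod hβ.isCompact))
  exact HasCompactSupport.of_support_subset_isCompact h
    ((subset_tsupport _).trans (tsupport_stens_subset θ α β))

theorem fderiv_apply_of_hasDerivAt {τ : Pt d → ℂ} (hτ : ContDiff ℝ ∞ τ) {z w : Pt d} {c : ℂ}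
    (h : HasDerivAt (fun s : ℝ => τ (z + s • w)) c 0) : fderiv ℝ τ z w = c := by
  have h1 : HasLineDerivAt ℝ τ c z w := h
  have h2 := ((hτ.differentiable (by simp) z).hasFDerivAt).hasLineDerivAt w
  exact h2.lineDeriv.symm.trans h1.lineDeriv

/-- Along the field `∂_t - v · D_x` both `x + t v` and `v` are constant, so only the time factor is
differentiated. -/
theorem fderiv_stens_transport {J : Set ℝ} {θ : ℝ → ℝ} (hθ : IsBump J θ) {α β : Sp d → ℂ}
    (hα : ContDiff ℝ ∞ α) (hβ : ContDiff ℝ ∞ β) (z : Pt d) :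
    fderiv ℝ (stens (cpx θ) α β) z (1, -z.2.2, 0) = stens (cpx (deriv θ)) α β z := by
  refine fderiv_apply_of_hasDerivAt (contDiff_stens hθ hα hβ) ?_
  have e : ∀ s : ℝ, stens (cpx θ) α β (z + s • (1, -z.2.2, 0)) =
      (θ (z.1 + s) : ℂ) * (α (z.2.1 + z.1 • z.2.2) * β z.2.2) := fun s => by
    have : z.2.1 + -(s • z.2.2) + (z.1 + s) • z.2.2 = z.2.1 + z.1 • z.2.2 := by
      rw [add_smul]; abel
    simp only [stens, cpx, Prod.fst_add, Prod.snd_add, Prod.smul_fst, Prod.smul_snd, smul_eq_mul,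
      mul_one, smul_neg, smul_zero, add_zero, this]
    ring
  simp only [e]
  have h1 : HasDerivAt (fun s : ℝ => θ (z.1 + s)) (deriv θ z.1) 0 := by
    have h0 : HasDerivAt θ (deriv θ z.1) (z.1 + 0) := by
      rw [add_zero]
      exact (hθ.1.differentiable (by simp) z.1).hasDerivAt
    exact h0.comp_const_add z.1 0
  have h2 := (h1.ofReal_comp).mul_const (α (z.2.1 + z.1 • z.2.2) * β z.2.2)
  simpa [stens, cpx, mul_assoc] using h2

/-- The velocity enters both `β` and the sheared argument of `α`, the latter with a factor `t`. This
is the origin of `t k` in the frequency `η`. -/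
theorem fderiv_stens_dv {J : Set ℝ} {θ : ℝ → ℝ} (hθ : IsBump J θ) {α β : Sp d → ℂ}
    (hα : ContDiff ℝ ∞ α) (hβ : ContDiff ℝ ∞ β) (e : Sp d) (z : Pt d) :
    fderiv ℝ (stens (cpx θ) α β) z (0, 0, e) =
      stens (fun t => t * θ t) (fun y => fderiv ℝ α y e) β z +
        stens (cpx θ) α (fun y => fderiv ℝ β y e) z := by
  refine fderiv_apply_of_hasDerivAt (contDiff_stens hθ hα hβ) ?_
  have e1 : ∀ s : ℝ, stens (cpx θ) α β (z + s • (0, 0, e)) =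
      (θ z.1 : ℂ) * (α (z.2.1 + z.1 • z.2.2 + s • (z.1 • e)) * β (z.2.2 + s • e)) := fun s => by
    simp only [stens, cpx, Prod.fst_add, Prod.snd_add, Prod.smul_fst, Prod.smul_snd,
      smul_zero, add_zero, smul_add, ← add_assoc, smul_comm z.1 s]
    ring
  simp only [e1]
  have h1 : HasDerivAt (fun s : ℝ => α (z.2.1 + z.1 • z.2.2 + s • (z.1 • e)))
      (fderiv ℝ α (z.2.1 + z.1 • z.2.2) (z.1 • e)) 0 :=
    ((hα.differentiable (by simp) _).hasFDerivAt).hasLineDerivAt _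
  have h2 : HasDerivAt (fun s : ℝ => β (z.2.2 + s • e)) (fderiv ℝ β z.2.2 e) 0 :=
    ((hβ.differentiable (by simp) _).hasFDerivAt).hasLineDerivAt _
  have h3 := (h1.mul h2).const_mul (θ z.1 : ℂ)
  refine h3.congr_deriv ?_
  simp only [zero_smul, add_zero, map_smul, stens, cpx, Complex.real_smul]
  ring

theorem isTest_stens {J : Set ℝ} {θ : ℝ → ℝ} (hθ : IsBump J θ) (α β : Sp d → ℂ) :
    tsupport (stens (cpx θ) α β) ⊆ cyl d J :=
  (tsupport_stens_subset θ α β).trans fun _ hz => hθ.2.2 hz.1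

theorem IsBump.memLp_id_mul {J : Set ℝ} {θ : ℝ → ℝ} (hθ : IsBump J θ) :
    MemLp (fun t : ℝ => (t : ℂ) * θ t) 2 := by
  have hc : Continuous fun t : ℝ => (t : ℂ) * θ t :=
    Complex.continuous_ofReal.mul (Complex.continuous_ofReal.comp hθ.1.continuous)
  exact hc.memLp_of_hasCompactSupport
    ((hθ.2.1.comp_left (g := fun r : ℝ => (r : ℂ)) (by simp)).mul_left)

/-- The transforms of bumps are Schwartz but not compactly supported, hence not admissible tests.
They are cut off in the space variables, and dominated convergence removes the cutoff. -/
theorem IsWeakTransport.stens {J : Set ℝ} (hJ : IsOpen J) {u g : Pt d → ℝ}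
    (hu : MemLp u 2 (leb (cyl d J))) (hg : MemLp g 2 (leb (cyl d J)))
    (h : IsWeakTransport (cyl d J) u g) {θ : ℝ → ℝ} (hθ : IsBump J θ) (α β : 𝓢(Sp d, ℂ)) :
    ∫ z, ext0 (cyl d J) u z * KFP.stens (cpx (deriv θ)) α β z =
      -∫ z, ext0 (cyl d J) g z * KFP.stens (cpx θ) α β z := by
  have hG := (isOpen_cyl (d := d) hJ).measurableSet
  obtain ⟨αs, Dα, hDα, sα, cα, bα, -, lα⟩ := exists_cutoff_seq α
  obtain ⟨βs, Dβ, hDβ, sβ, cβ, bβ, -, lβ⟩ := exists_cutoff_seq β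
  have lα' : ∀ x, Tendsto (fun n => αs n x) atTop (𝓝 (α x)) := fun x =>
    tendsto_const_nhds.congr' ((lα x).mono fun n hn => hn.eq_of_nhds.symm)
  have lβ' : ∀ x, Tendsto (fun n => βs n x) atTop (𝓝 (β x)) := fun x =>
    tendsto_const_nhds.congr' ((lβ x).mono fun n hn => hn.eq_of_nhds.symm)
  have l1 := tendsto_integral_stens (memLp_ext0 hG hu) hθ.deriv.memLp_cpx
    (fun n => (sα n).continuous) (fun n => (sβ n).continuous) hDα hDβ bα bβ lα' lβ'
  have l2 := tendsto_integral_stens (memLp_ext0 hG hg) hθ.memLp_cpx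
    (fun n => (sα n).continuous) (fun n => (sβ n).continuous) hDα hDβ bα bβ lα' lβ'
  refine tendsto_nhds_unique l1 (l2.neg.congr fun n => ?_)
  have h' : IsWeakAlong (cyl d J) (fun z => (1, -z.2.2, 0)) u g := h
  have := h'.complex hG (by fun_prop) hu hg (contDiff_stens hθ (sα n) (sβ n))
    (hasCompactSupport_stens hθ.2.1 (cα n) (cβ n)) (isTest_stens hθ _ _)
  simp only [fderiv_stens_transport hθ (sα n) (sβ n)] at this
  exact this.symm

theorem IsWeakDv.stens {J : Set ℝ} (hJ : IsOpen J) {u g : Pt d → ℝ} {i : Fin d}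
    (hu : MemLp u 2 (leb (cyl d J))) (hg : MemLp g 2 (leb (cyl d J)))
    (h : IsWeakDv (cyl d J) i u g) {θ : ℝ → ℝ} (hθ : IsBump J θ) (α β : 𝓢(Sp d, ℂ)) :
    (∫ z, ext0 (cyl d J) u z * KFP.stens (fun t => t * θ t)
        (fun y => fderiv ℝ α y (EuclideanSpace.single i 1)) β z) +
      ∫ z, ext0 (cyl d J) u z * KFP.stens (cpx θ) α
        (fun y => fderiv ℝ β y (EuclideanSpace.single i 1)) z =
      -∫ z, ext0 (cyl d J) g z * KFP.stens (cpx θ) α β z := by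
  have hG := (isOpen_cyl (d := d) hJ).measurableSet
  set e : Sp d := EuclideanSpace.single i 1 with he
  have he1 : ‖e‖ ≤ 1 := by simp [he]
  obtain ⟨αs, Dα, hDα, sα, cα, bα, bα', lα⟩ := exists_cutoff_seq α
  obtain ⟨βs, Dβ, hDβ, sβ, cβ, bβ, bβ', lβ⟩ := exists_cutoff_seq β
  have lα' : ∀ x, Tendsto (fun n => αs n x) atTop (𝓝 (α x)) := fun x =>
    tendsto_const_nhds.congr' ((lα x).mono fun n hn => hn.eq_of_nhds.symm)
  have lβ' : ∀ x, Tendsto (fun n => βs n x) atTop (𝓝 (β x)) := fun x =>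
    tendsto_const_nhds.congr' ((lβ x).mono fun n hn => hn.eq_of_nhds.symm)
  have lα'' : ∀ x, Tendsto (fun n => fderiv ℝ (αs n) x e) atTop (𝓝 (fderiv ℝ α x e)) := fun x =>
    tendsto_const_nhds.congr' ((lα x).mono fun n hn => by simp only [hn.fderiv_eq])
  have lβ'' : ∀ x, Tendsto (fun n => fderiv ℝ (βs n) x e) atTop (𝓝 (fderiv ℝ β x e)) := fun x =>
    tendsto_const_nhds.congr' ((lβ x).mono fun n hn => by simp only [hn.fderiv_eq])
  have dα : ∀ n, Continuous fun x => fderiv ℝ (αs n) x e := fun n =>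
    ((sα n).continuous_fderiv (by simp)).clm_apply continuous_const
  have dβ : ∀ n, Continuous fun x => fderiv ℝ (βs n) x e := fun n =>
    ((sβ n).continuous_fderiv (by simp)).clm_apply continuous_const
  have hu' := memLp_ext0 hG hu
  have l1 := tendsto_integral_stens hu' hθ.memLp_id_mul dα
    (fun n => (sβ n).continuous) hDα hDβ (fun n x => bα' n x e he1) bβ lα'' lβ'
  have l1' := tendsto_integral_stens hu' hθ.memLp_cpx
    (fun n => (sα n).continuous) dβ hDα hDβ bα (fun n x => bβ' n x e he1) lα' lβ''
  have l2 := tendsto_integral_stens (memLp_ext0 hG hg) hθ.memLp_cpx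
    (fun n => (sα n).continuous) (fun n => (sβ n).continuous) hDα hDβ bα bβ lα' lβ'
  refine tendsto_nhds_unique (l1.add l1') (l2.neg.congr fun n => ?_)
  have h' : IsWeakAlong (cyl d J) (fun z => (0, 0, e)) u g := h
  have := h'.complex hG (by fun_prop) hu hg (contDiff_stens hθ (sα n) (sβ n))
    (hasCompactSupport_stens hθ.2.1 (cα n) (cβ n)) (isTest_stens hθ _ _)
  simp only [fderiv_stens_dv hθ (sα n) (sβ n), mul_add] at this
  rw [← this, integral_add]
  · exact hu'.integrable_mul (memLp_stens hθ.memLp_id_mul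
      (hDα.mono' (dα n).aestronglyMeasurable (Eventually.of_forall fun x => bα' n x e he1))
      (hDβ.mono' (sβ n).continuous.aestronglyMeasurable (Eventually.of_forall (bβ n))))
  · exact hu'.integrable_mul (memLp_stens hθ.memLp_cpx
      (hDα.mono' (sα n).continuous.aestronglyMeasurable (Eventually.of_forall (bα n)))
      (hDβ.mono' (dβ n).aestronglyMeasurable (Eventually.of_forall fun x => bβ' n x e he1)))

/-- The transform of the transport derivative is the weak time derivative of the transform. -/
theorem IsWeakTransport.weak_time {J : Set ℝ} (hJ : IsOpen J) {u g : Pt d → ℝ}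
    (hu : MemLp u 2 (leb (cyl d J))) (hg : MemLp g 2 (leb (cyl d J)))
    (h : IsWeakTransport (cyl d J) u g) {U V : Pt d → ℂ} (hU : IsFT (ext0 (cyl d J) u) U)
    (hV : IsFT (ext0 (cyl d J) g) V) (θ : ℝ → ℝ) (A B : Sp d → ℝ) (hθ : IsBump J θ)
    (hA : IsBump univ A) (hB : IsBump univ B) :
    ∫ z, U z * tens (cpx (deriv θ)) (cpx A) (cpx B) z =
      -∫ z, V z * tens (cpx θ) (cpx A) (cpx B) z := by
  obtain ⟨A', hA'⟩ := hA.exists_schwartz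
  obtain ⟨B', hB'⟩ := hB.exists_schwartz
  have h1 := h.stens hJ hu hg hθ (sft A') (sft B')
  rw [hU.pair _ hθ.deriv.memLp_cpx, hV.pair _ hθ.memLp_cpx,
    show (A' : Sp d → ℂ) = cpx A from funext hA', show (B' : Sp d → ℂ) = cpx B from funext hB']
    at h1
  exact h1

theorem exists_sft_eq_fderiv (A : 𝓢(Sp d, ℂ)) (i : Fin d) : ∃ A' : 𝓢(Sp d, ℂ),
    (∀ y, fderiv ℝ (sft A) y (EuclideanSpace.single i 1) = sft A' y) ∧
      ∀ k, A' k = -(2 * Real.pi * Complex.I) * (k i : ℂ) * A k := by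
  have ht : (fun x : Sp d => inner ℝ x (EuclideanSpace.single i 1)).HasTemperateGrowth := by
    fun_prop
  refine ⟨-(2 * Real.pi * Complex.I) • smulLeftCLM ℂ (inner ℝ · (EuclideanSpace.single i 1)) A,
    fun y => ?_, fun k => ?_⟩
  · have h := SchwartzMap.lineDerivOp_fourier_eq A (EuclideanSpace.single i 1)
    exact DFunLike.congr_fun h y
  · rw [smul_apply, smulLeftCLM_apply_apply ht]
    simp [EuclideanSpace.inner_single_right, mul_assoc]

/-- Multiplication by the indicator of `J` commutes with the transform and fixes the zero extension
of `u`, so by uniqueness it fixes `U`. -/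
theorem IsFT.ae_eq_zero_off {J : Set ℝ} (hJ : MeasurableSet J) {u : Pt d → ℝ} {U : Pt d → ℂ}
    (hU : IsFT (ext0 (cyl d J) u) U) : ∀ᵐ z, z.1 ∉ J → U z = 0 := by
  have h1 := hU.mul_time (b := J.indicator fun _ => 1) (measurable_const.indicator hJ) (C := 1)
    (fun t => by by_cases ht : t ∈ J <;> simp [ht])
  have h2 : (fun z : Pt d => J.indicator (fun _ => (1 : ℂ)) z.1 * ext0 (cyl d J) u z) =
      ext0 (cyl d J) u := by
    funext z
    by_cases hz : z.1 ∈ J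
    · simp [hz]
    · simp [ext0, hz, cyl]
  rw [h2] at h1
  filter_upwards [hU.ae_unique h1] with z hz hzJ
  rw [hz]
  simp [hzJ]

/-- The transform of a weak velocity derivative. -/
theorem IsWeakDv.isFT {J : Set ℝ} (hJ : IsOpen J) {u g : Pt d → ℝ} {i : Fin d}
    (hu : MemLp u 2 (leb (cyl d J))) (hg : MemLp g 2 (leb (cyl d J)))
    (h : IsWeakDv (cyl d J) i u g) {U V : Pt d → ℂ} (hU : IsFT (ext0 (cyl d J) u) U)
    (hV : IsFT (ext0 (cyl d J) g) V) : ∀ᵐ z, V z = Complex.I * (eta z i : ℂ) * U z := by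
  have hηc : Continuous fun z : Pt d => Complex.I * (eta z i : ℂ) :=
    continuous_const.mul (Complex.continuous_ofReal.comp (continuous_eta_apply i))
  have hηU : LocallyIntegrable fun z : Pt d => Complex.I * (eta z i : ℂ) * U z := by
    refine locallyIntegrable_iff.2 fun K hK => ?_
    exact ((MemLp.locallyIntegrable_two hU.right).integrableOn_isCompact hK).continuousOn_mul
      hηc.continuousOn hK
  have key := ae_eq_zero_of_tens hJ isOpen_univ isOpen_univ
    ((MemLp.locallyIntegrable_two hV.right).sub hηU) fun θ A B hθ hA hB => by
      obtain ⟨A', hA'⟩ := hA.exists_schwartz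
      obtain ⟨B', hB'⟩ := hB.exists_schwartz
      obtain ⟨A'', hA1, hA2⟩ := exists_sft_eq_fderiv A' i
      obtain ⟨B'', hB1, hB2⟩ := exists_sft_eq_fderiv B' i
      have h1 := h.stens hJ hu hg hθ (sft A') (sft B')
      simp only [hA1, hB1] at h1
      rw [hU.pair _ hθ.memLp_id_mul, hV.pair _ hθ.memLp_cpx, hU.pair _ hθ.memLp_cpx,
        ← integral_add] at h1
      · have i1 := integrable_mul_tens_bump (MemLp.locallyIntegrable_two hV.right) hθ hA hB
        have i2 := integrable_mul_tens_bump hηU hθ hA hB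
        simp only [Pi.sub_apply, sub_mul]
        rw [integral_sub i1 i2, sub_eq_zero, ← neg_inj]
        rw [show (A' : Sp d → ℂ) = cpx A from funext hA',
          show (B' : Sp d → ℂ) = cpx B from funext hB'] at h1
        rw [← h1, ← integral_neg]
        congr 1 with z
        -- The two terms contribute `-2πi t k_i` and `-2πi ξ_i`, whose sum is `-i η_i`.
        simp only [tens, hA2, hB2, hA', hB', eta, cpx, PiLp.smul_apply, PiLp.add_apply, smul_eq_mul]
        push_cast
        ring
      · exact hU.right.integrable_mul
          (memLp_tens hθ.memLp_id_mul (memLp_schwartz _) (memLp_schwartz _))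
      · exact hU.right.integrable_mul
          (memLp_tens hθ.memLp_cpx (memLp_schwartz _) (memLp_schwartz _))
  filter_upwards [key, hU.ae_eq_zero_off hJ.measurableSet, hV.ae_eq_zero_off hJ.measurableSet]
    with z h1 h2 h3
  by_cases hz : z.1 ∈ J
  · exact sub_eq_zero.1 (h1 ⟨hz, mem_univ _, mem_univ _⟩)
  · rw [h2 hz, h3 hz, mul_zero]

end WeakDerivatives

end

section



variable {d : ℕ}

/-! ### Plancherel and the fractional multiplier in `x` -/

section Plancherel

theorem eLpNorm_two_sq {α F : Type*} [MeasurableSpace α] [NormedAddCommGroup F] {μ : Measure α}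
    (f : α → F) : eLpNorm f 2 μ ^ 2 = ∫⁻ x, ‖f x‖ₑ ^ 2 ∂μ := by
  have := eLpNorm_nnreal_pow_eq_lintegral (f := f) (μ := μ) (p := 2) (by norm_num)
  simpa using this

theorem integral_fourierInv_mul {f g : Sp d → ℂ} (hf : Integrable f) (hg : Integrable g) :
    ∫ x, 𝓕⁻ f x * g x = ∫ k, f k * 𝓕⁻ g k := by
  have h1 : ∫ x, 𝓕⁻ f x * g x = ∫ x, 𝓕 f x * g (-x) := by
    rw [← integral_neg_eq_self]
    congr 1 with x
    rw [Real.fourierInv_eq_fourier_neg, neg_neg]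
  have h2 := VectorFourier.integral_fourierIntegral_smul_eq_flip (L := innerₗ (Sp d))
    (μ := volume) (ν := volume) (f := f) (g := fun x => g (-x)) Real.continuous_fourierChar
    continuous_inner hf hg.comp_neg
  rw [h1]
  simp only [smul_eq_mul, flip_innerₗ] at h2
  refine h2.trans ?_
  congr 1 with k
  rw [Real.fourierInv_eq_fourier_comp_neg]
  rfl

/-- Plancherel for the integral transform of an integrable, square integrable function. -/
theorem eLpNorm_fourierInv {f : Sp d → ℂ} (hf : Integrable f) (hf2 : MemLp f 2) :
    eLpNorm (𝓕⁻ f) 2 volume = eLpNorm f 2 volume := by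
  set F : Lp ℂ 2 (volume : Measure (Sp d)) := 𝓕⁻ hf2.toLp with hF
  have hc : Continuous (𝓕⁻ f) := by
    have h : 𝓕⁻ f = fun w => 𝓕 f (-w) := funext fun w => Real.fourierInv_eq_fourier_neg f w
    rw [h]
    exact (VectorFourier.fourierIntegral_continuous Real.continuous_fourierChar
      (L := innerₗ (Sp d)) continuous_inner hf).comp continuous_neg
  have hae : ∀ᵐ x, 𝓕⁻ f x = F x := by
    -- The integral transform and the `L_2` transform agree when tested with bumps, since both move
    -- onto the test function by duality; `F` carries the isometry.
    refine ae_eq_of_integral_contDiff_smul_eq hc.locallyIntegrable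
      ((Lp.memLp F).locallyIntegrable (by norm_num)) fun g hg hgc => ?_
    have hb : IsBump univ g := ⟨hg, hgc, subset_univ _⟩
    obtain ⟨A, hA⟩ := hb.exists_schwartz
    have h1 := congrArg (fun D => D A) (Lp.fourierInv_toTemperedDistribution_eq hf2.toLp)
    simp only [TemperedDistribution.fourierInv_apply, Lp.toTemperedDistribution_apply,
      smul_eq_mul] at h1
    have h2 : ∫ x, 𝓕⁻ f x * A x = ∫ k, f k * (𝓕⁻ A) k := by
      rw [integral_fourierInv_mul hf A.integrable, fourierInv_coe]
    have h3 : ∫ k, f k * (𝓕⁻ A) k = ∫ k, (𝓕⁻ A) k * (hf2.toLp f : Sp d → ℂ) k :=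
      integral_congr_ae (by filter_upwards [hf2.coeFn_toLp] with k hk; rw [hk, mul_comm])
    have e1 : ∫ x, g x • 𝓕⁻ f x = ∫ x, 𝓕⁻ f x * A x := by
      congr 1 with x
      rw [hA, Complex.real_smul, mul_comm]
    have e2 : ∫ x, g x • F x = ∫ x, A x * F x := by
      congr 1 with x
      rw [hA, Complex.real_smul]
    rw [e1, e2, h2, h3, h1]
  rw [eLpNorm_congr_ae hae]
  have h1 : ‖F‖ = ‖hf2.toLp‖ := by
    rw [hF]
    exact (Lp.fourierTransformₗᵢ (Sp d) ℂ).symm.norm_map _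
  rw [Lp.norm_def, Lp.norm_toLp, ENNReal.toReal_eq_toReal_iff' (Lp.memLp F).2.ne hf2.2.ne] at h1
  exact h1

theorem lintegral_fourier_sq (A : 𝓢(Sp d, ℂ)) :
    ∫⁻ k, ‖sft A k‖ₑ ^ 2 = ∫⁻ x, ‖A x‖ₑ ^ 2 := by
  have h := integral_norm_sq_fourier A
  have e : ∀ B : 𝓢(Sp d, ℂ), ∫⁻ x, ‖B x‖ₑ ^ 2 = ENNReal.ofReal (∫ x, ‖B x‖ ^ 2) := fun B => by
    have hi : Integrable fun x => ‖B x‖ ^ 2 := (B.memLp 2).integrable_norm_pow two_ne_zero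
    rw [ofReal_integral_eq_lintegral_ofReal hi (Eventually.of_forall fun x => by positivity)]
    congr 1 with x
    rw [← ofReal_norm, ENNReal.ofReal_pow (norm_nonneg _)]
  rw [e, e]
  exact congrArg ENNReal.ofReal h

/-- The symbol of `(-Δ_x)^s`. -/
def symb (s : ℝ) (k : Sp d) : ℝ := (2 * Real.pi * ‖k‖) ^ (2 * s)

theorem symb_nonneg (s : ℝ) (k : Sp d) : 0 ≤ symb s k := by unfold symb; positivity

theorem continuous_symb {s : ℝ} (hs : 0 ≤ s) : Continuous (symb (d := d) s) := by
  unfold symb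
  exact (by fun_prop : Continuous fun k : Sp d => 2 * Real.pi * ‖k‖).rpow_const
    fun k => Or.inr (by positivity)

theorem symb_le {s : ℝ} (hs : 0 ≤ s) (hs' : s ≤ 1 / 2) (k : Sp d) :
    symb s k ≤ 1 + 2 * Real.pi * ‖k‖ := by
  unfold symb
  have h0 : 0 ≤ 2 * Real.pi * ‖k‖ := by positivity
  rcases le_total (2 * Real.pi * ‖k‖) 1 with h | h
  · exact (Real.rpow_le_one h0 h (by linarith)).trans (by linarith)
  · have := Real.rpow_le_rpow_of_exponent_le h (show 2 * s ≤ 1 by linarith)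
    rw [Real.rpow_one] at this
    linarith

theorem symb_sq_le {s : ℝ} (hs : 0 ≤ s) (hs' : s ≤ 1 / 2) (k : Sp d) :
    symb s k ^ 2 ≤ 1 + (2 * Real.pi * ‖k‖) ^ 2 := by
  unfold symb
  have h0 : 0 ≤ 2 * Real.pi * ‖k‖ := by positivity
  rcases le_total (2 * Real.pi * ‖k‖) 1 with h | h
  · have h1 := Real.rpow_le_one h0 h (show 0 ≤ 2 * s by linarith)
    have h2 : 0 ≤ (2 * Real.pi * ‖k‖) ^ (2 * s) := by positivity
    nlinarith
  · have := Real.rpow_le_rpow_of_exponent_le h (show 2 * s ≤ 1 by linarith)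
    rw [Real.rpow_one] at this
    have h2 : 0 ≤ (2 * Real.pi * ‖k‖) ^ (2 * s) := by positivity
    nlinarith

theorem integrable_symb_mul {s : ℝ} (hs : 0 ≤ s) (hs' : s ≤ 1 / 2) (A : 𝓢(Sp d, ℂ)) :
    Integrable fun k => (symb s k : ℂ) * A k := by
  have h1 : Integrable fun k => ‖A k‖ + 2 * Real.pi * (‖k‖ ^ 1 * ‖A k‖) :=
    A.integrable.norm.add ((A.integrable_pow_mul volume 1).const_mul _)
  refine h1.mono' ((Complex.continuous_ofReal.comp
    (continuous_symb hs)).mul A.continuous).aestronglyMeasurable (Eventually.of_forall fun k => ?_)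
  rw [norm_mul, Complex.norm_real, Real.norm_eq_abs, abs_of_nonneg (symb_nonneg s k)]
  have := mul_le_mul_of_nonneg_right (symb_le hs hs' k) (norm_nonneg (A k))
  refine this.trans (le_of_eq ?_)
  ring

/-- For `s ≤ 1/2` the squared symbol is at most `1 + |2πk|²`, so the multiplier costs no more than
the `H¹` norm. -/
theorem lintegral_symb_mul_fourier_le {s : ℝ} (hs : 0 ≤ s) (hs' : s ≤ 1 / 2) (A : 𝓢(Sp d, ℂ)) :
    ∫⁻ k, ‖(symb s k : ℂ) * sft A k‖ₑ ^ 2 ≤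
      ∫⁻ x, (‖A x‖ₑ ^ 2 + ∑ i, ‖fderiv ℝ A x (EuclideanSpace.single i 1)‖ₑ ^ 2) := by
  have hm : ∀ B : 𝓢(Sp d, ℂ), Measurable fun k => ‖B k‖ₑ ^ 2 := fun B =>
    (B.continuous.measurable.enorm).pow_const 2
  let D : Fin d → 𝓢(Sp d, ℂ) := fun i =>
    LineDeriv.lineDerivOp (EuclideanSpace.single i 1 : Sp d) A
  have hD : ∀ i x, fderiv ℝ A x (EuclideanSpace.single i 1) = D i x := fun i x => rfl
  have hFD : ∀ i k, sft (D i) k = (2 * Real.pi * Complex.I) * ((k i : ℂ) * sft A k) := fun i k => by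
    have h := DFunLike.congr_fun
      (SchwartzMap.fourier_lineDerivOp_eq A (EuclideanSpace.single i 1)) k
    have ht : (fun x : Sp d => inner ℝ x (EuclideanSpace.single i 1)).HasTemperateGrowth := by
      fun_prop
    rw [smul_apply, smulLeftCLM_apply_apply ht] at h
    refine h.trans ?_
    simp [EuclideanSpace.inner_single_right, mul_assoc]
  simp only [hD]
  rw [lintegral_add_left (hm A), lintegral_finsetSum _ fun i _ => hm (D i), ← lintegral_fourier_sq A]
  simp only [← lintegral_fourier_sq (D _)]
  rw [← lintegral_finsetSum _ fun i _ => hm (sft (D i)), ← lintegral_add_left (hm (sft A))]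
  refine lintegral_mono fun k => ?_
  have e : ∀ w : ℂ, ‖w‖ₑ ^ 2 = ENNReal.ofReal (‖w‖ ^ 2) := fun w => by
    rw [← ofReal_norm, ENNReal.ofReal_pow (norm_nonneg _)]
  simp only [e]
  rw [← ENNReal.ofReal_sum_of_nonneg fun i _ => by positivity,
    ← ENNReal.ofReal_add (by positivity) (Finset.sum_nonneg fun i _ => by positivity)]
  refine ENNReal.ofReal_le_ofReal ?_
  have h1 : ∀ i, ‖sft (D i) k‖ ^ 2 = (2 * Real.pi) ^ 2 * ‖sft A k‖ ^ 2 * (k i) ^ 2 := fun i => by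
    rw [hFD]
    simp only [norm_mul, Complex.norm_real, Complex.norm_I, Complex.norm_ofNat, Real.norm_eq_abs,
      mul_one, mul_pow, sq_abs]
    ring
  simp only [h1]
  rw [← Finset.mul_sum, ← EuclideanSpace.real_norm_sq_eq, norm_mul, Complex.norm_real,
    Real.norm_eq_abs, mul_pow, sq_abs]
  have := mul_le_mul_of_nonneg_right (symb_sq_le hs hs' k) (sq_nonneg ‖sft A k‖)
  refine this.trans (le_of_eq ?_)
  ring

/-- The translation by `y = t v` in a sheared tensor becomes a modulation, which commutes with the
multiplier. -/
theorem fourierInv_sft_add (A : 𝓢(Sp d, ℂ)) (y k : Sp d) :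
    𝓕⁻ (fun x => sft A (x + y)) k = (Real.fourierChar (-inner ℝ y k) : ℂ) * A k := by
  have h1 : 𝓕⁻ (sft A : Sp d → ℂ) k = A k := by
    rw [← fourierInv_coe]
    exact DFunLike.congr_fun (FourierTransform.fourierInv_fourier_eq A) k
  rw [← h1, Real.fourierInv_eq, Real.fourierInv_eq, ← integral_const_mul,
    ← integral_add_right_eq_self (fun x => (Real.fourierChar (-inner ℝ y k) : ℂ) *
      Real.fourierChar (inner ℝ x k) • sft A x) y]
  congr 1 with x
  rw [inner_add_left, Circle.smul_def, Circle.smul_def, smul_eq_mul, smul_eq_mul, ← mul_assoc,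
    ← Circle.coe_mul, ← AddChar.map_add_eq_mul]
  congr 3
  ring

/-- The multiplier may be moved onto a test function whose transform avoids the origin. -/
theorem integral_multiplier_mul {s : ℝ} (hs : 0 ≤ s) (hs' : s ≤ 1 / 2) (ψ A A' : 𝓢(Sp d, ℂ))
    (hA : ∀ k, A' k = (symb s k : ℂ) * A k) (y : Sp d) :
    ∫ x, 𝓕⁻ (fun k => (symb s k : ℂ) * sft ψ k) x * sft A (x + y) =
      ∫ x, ψ x * sft A' (x + y) := by
  have hi : ∀ B : 𝓢(Sp d, ℂ), Integrable fun x => sft B (x + y) := fun B =>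
    (sft B).integrable.comp_add_right y
  have h1 : ∀ x, ψ x = 𝓕⁻ (sft ψ : Sp d → ℂ) x := fun x => by
    rw [← fourierInv_coe]
    exact (DFunLike.congr_fun (FourierTransform.fourierInv_fourier_eq ψ) x).symm
  simp only [h1]
  rw [integral_fourierInv_mul (integrable_symb_mul hs hs' (sft ψ)) (hi A),
    integral_fourierInv_mul (sft ψ).integrable (hi A')]
  congr 1 with k
  rw [fourierInv_sft_add, fourierInv_sft_add, hA]
  ring

end Plancherel

/-! ### Test functions satisfy their own weak equations -/

section TestFunctions

theorem cyl_univ : cyl d univ = univ := rfl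

theorem IsTest.toUniv {G : Set (Pt d)} {φ : Pt d → ℝ} (h : IsTest G φ) : IsTest univ φ :=
  ⟨h.smooth, h.compact, subset_univ _⟩

theorem IsTest.memLp {G : Set (Pt d)} {φ : Pt d → ℝ} (h : IsTest G φ) : MemLp φ 2 :=
  h.smooth.continuous.memLp_of_hasCompactSupport h.compact

theorem IsTest.fderiv_apply {G : Set (Pt d)} {φ : Pt d → ℝ} (h : IsTest G φ) {X : Pt d → Pt d}
    (hX : ContDiff ℝ ∞ X) : IsTest G fun z => fderiv ℝ φ z (X z) := by
  have hs : support (fun z => fderiv ℝ φ z (X z)) ⊆ support (fderiv ℝ φ) := fun z hz h0 => by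
    simp only [mem_support] at hz
    rw [h0] at hz
    exact hz rfl
  refine ⟨(h.smooth.fderiv_right (m := ∞) (by simp)).clm_apply hX, (h.compact.fderiv ℝ).mono hs, ?_⟩
  exact (closure_mono hs).trans ((tsupport_fderiv_subset ℝ).trans h.supp)

theorem IsTest.dv {G : Set (Pt d)} {φ : Pt d → ℝ} (h : IsTest G φ) (i : Fin d) :
    IsTest G (dv i φ) :=
  h.fderiv_apply contDiff_const

theorem IsTest.transport {G : Set (Pt d)} {φ : Pt d → ℝ} (h : IsTest G φ) :
    IsTest G (transport φ) :=
  h.fderiv_apply (X := fun z => (1, -z.2.2, 0)) (by fun_prop)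

theorem IsTest.mul {φ ψ : Pt d → ℝ} (h : IsTest univ φ) (h' : IsTest univ ψ) :
    IsTest univ fun z => φ z * ψ z :=
  ⟨h.smooth.mul h'.smooth, h.compact.mul_right, subset_univ _⟩

theorem IsTest.integrable {G : Set (Pt d)} {φ : Pt d → ℝ} (h : IsTest G φ) : Integrable φ :=
  h.smooth.continuous.integrable_of_hasCompactSupport h.compact

theorem isAddHaarMeasure_volume_pt : (volume : Measure (Pt d)).IsAddHaarMeasure := by
  have : (volume : Measure (Sp d × Sp d)).IsAddHaarMeasure :=
    Measure.prod.instIsAddHaarMeasure (volume : Measure (Sp d)) (volume : Measure (Sp d))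
  exact Measure.prod.instIsAddHaarMeasure (volume : Measure ℝ) (volume : Measure (Sp d × Sp d))

theorem IsTest.integral_fderiv_const {φ : Pt d → ℝ} (h : IsTest univ φ) (w : Pt d) :
    ∫ z, fderiv ℝ φ z w = 0 := by
  have := isAddHaarMeasure_volume_pt (d := d)
  have h1 := integral_mul_fderiv_eq_neg_fderiv_mul_of_integrable (μ := (volume : Measure (Pt d)))
    (f := fun _ => (1 : ℝ)) (g := φ) (v := w) (by simp)
    (by simpa using (h.fderiv_apply (X := fun _ => w) contDiff_const).integrable)
    (by simpa using h.integrable) (fun x _ => differentiableAt_const _)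
    (fun x _ => h.smooth.differentiable (by simp) x)
  simpa using h1

/-- After the measure preserving shear the transport derivative is the time derivative of a test
function. -/
theorem IsTest.integral_transport {φ : Pt d → ℝ} (h : IsTest univ φ) :
    ∫ z, KFP.transport φ z = 0 := by
  have hs : ContDiff ℝ ∞ fun z : Pt d => (shear d).symm z := by
    simp only [shear_symm_apply]
    fun_prop
  have ht : IsTest univ fun z => φ ((shear d).symm z) :=
    ⟨h.smooth.comp hs, h.compact.comp_homeomorph (shear d).symm, subset_univ _⟩
  have h1 := ht.integral_fderiv_const (1, 0, 0)
  rw [← integral_comp_shear] at h1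
  rw [← h1]
  congr 1 with z
  have hl : HasLineDerivAt ℝ (fun z => φ ((shear d).symm z)) (KFP.transport φ z) (shear d z)
      (1, 0, 0) := by
    have h2 : HasLineDerivAt ℝ φ (KFP.transport φ z) z (1, -z.2.2, 0) :=
      ((h.smooth.differentiable (by simp) z).hasFDerivAt).hasLineDerivAt _
    unfold HasLineDerivAt at h2 ⊢
    refine h2.congr_of_eventuallyEq (Eventually.of_forall fun s => ?_)
    simp only [shear_apply, shear_symm_apply, Prod.fst_add, Prod.snd_add, Prod.smul_fst,
      Prod.smul_snd, smul_eq_mul, mul_one, smul_zero, add_zero]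
    congr 1
    refine Prod.ext (by simp) (Prod.ext ?_ (by simp))
    simp only [Prod.fst_add, Prod.snd_add, Prod.smul_fst, Prod.smul_snd, add_smul, smul_neg]
    abel
  exact hl.lineDeriv.symm.trans
    (((ht.smooth.differentiable (by simp) _).hasFDerivAt).hasLineDerivAt (1, 0, 0)).lineDeriv

/-- The divergence free hypothesis is applied to the product of the two test functions. -/
theorem IsTest.isWeakAlong {φ : Pt d → ℝ} (h : IsTest univ φ) {X : Pt d → Pt d}
    (hX : ContDiff ℝ ∞ X) (h0 : ∀ ψ, IsTest univ ψ → ∫ z, fderiv ℝ ψ z (X z) = 0) :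
    IsWeakAlong univ X φ fun z => fderiv ℝ φ z (X z) := by
  intro ψ hψ
  have h1 := h0 _ (h.mul hψ)
  have e : ∀ z, fderiv ℝ (fun z => φ z * ψ z) z (X z) =
      φ z * fderiv ℝ ψ z (X z) + fderiv ℝ φ z (X z) * ψ z := fun z => by
    rw [fderiv_fun_mul (h.smooth.differentiable (by simp) z) (hψ.smooth.differentiable (by simp) z)]
    simp [mul_comm]
  simp only [e] at h1
  rw [integral_add (h.mul (hψ.fderiv_apply hX)).integrable
    ((h.fderiv_apply hX).mul hψ).integrable] at h1
  simpa [Measure.restrict_univ] using eq_neg_of_add_eq_zero_left h1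

theorem IsTest.isWeakDv {φ : Pt d → ℝ} (h : IsTest univ φ) (i : Fin d) :
    IsWeakDv univ i φ (KFP.dv i φ) :=
  h.isWeakAlong contDiff_const fun _ hψ => hψ.integral_fderiv_const _

theorem IsTest.isWeakTransport {φ : Pt d → ℝ} (h : IsTest univ φ) :
    IsWeakTransport univ φ (KFP.transport φ) :=
  h.isWeakAlong (X := fun z => (1, -z.2.2, 0)) (by fun_prop) fun _ hψ => hψ.integral_transport

theorem ext0_univ (u : Pt d → ℝ) : ext0 univ u = cpx u := indicator_univ _

theorem IsTest.isFT_dv {φ : Pt d → ℝ} (h : IsTest univ φ) (i : Fin d) {Φ : Pt d → ℂ}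
    (hΦ : IsFT (cpx φ) Φ) :
    IsFT (cpx (KFP.dv i φ)) fun z => Complex.I * (eta z i : ℂ) * Φ z := by
  obtain ⟨V, hV⟩ := exists_isFT (u := cpx (KFP.dv i φ)) (h.dv i).memLp.ofReal
  refine hV.congr (Eventually.of_forall fun _ => rfl) ?_
  have hw : IsWeakDv (cyl d univ) i φ (KFP.dv i φ) := h.isWeakDv i
  refine hw.isFT isOpen_univ (h.memLp.restrict _) ((h.dv i).memLp.restrict _) ?_ ?_
  · rw [cyl_univ, ext0_univ]; exact hΦ
  · rw [cyl_univ, ext0_univ]; exact hV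

end TestFunctions

/-! ### The fractional Laplacian of a test function and its transform -/

section FractionalLaplacian

/-- The complex valued function whose real part is `fracLapX s φ`. -/
def fracLapC (s : ℝ) (φ : Pt d → ℝ) (z : Pt d) : ℂ :=
  𝓕⁻ (fun k : Sp d => (symb s k : ℂ) * 𝓕 (fun y : Sp d => (φ (z.1, y, z.2.2) : ℂ)) k) z.2.1

theorem fracLapX_eq_re (s : ℝ) (φ : Pt d → ℝ) (z : Pt d) :
    fracLapX s φ z = (fracLapC s φ z).re := rfl

/-- The slice of a test function at fixed time and velocity is a Schwartz function. -/
theorem IsTest.exists_slice {φ : Pt d → ℝ} (h : IsTest univ φ) (t : ℝ) (v : Sp d) :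
    ∃ A : 𝓢(Sp d, ℂ), ∀ x, A x = φ (t, x, v) := by
  have hb : IsBump univ fun x => φ (t, x, v) := by
    refine ⟨h.smooth.comp (by fun_prop), ?_, subset_univ _⟩
    have hK : IsCompact ((fun z : Pt d => z.2.1) '' tsupport φ) :=
      h.compact.isCompact.image (by fun_prop)
    exact HasCompactSupport.of_support_subset_isCompact hK fun x hx =>
      ⟨(t, x, v), subset_tsupport _ hx, rfl⟩
  exact hb.exists_schwartz

theorem stronglyMeasurable_fracLapC {s : ℝ} (hs : 0 ≤ s) {φ : Pt d → ℝ} (h : IsTest univ φ) :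
    StronglyMeasurable (fracLapC s φ) := by
  have hφ := h.smooth.continuous
  have hm := continuous_symb (d := d) hs
  have h1 : StronglyMeasurable fun p : Pt d × Sp d =>
      𝓕 (fun y : Sp d => (φ (p.1.1, y, p.1.2.2) : ℂ)) p.2 := by
    simp only [Real.fourier_eq]
    refine StronglyMeasurable.integral_prod_right' (f := fun q : (Pt d × Sp d) × Sp d =>
      Real.fourierChar (-inner ℝ q.2 q.1.2) • (φ (q.1.1.1, q.2, q.1.1.2.2) : ℂ))
      (Continuous.stronglyMeasurable ?_)
    have : Continuous fun q : (Pt d × Sp d) × Sp d => Real.fourierChar (-inner ℝ q.2 q.1.2) :=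
      Real.continuous_fourierChar.comp (by fun_prop)
    exact this.smul (Complex.continuous_ofReal.comp (hφ.comp (by fun_prop)))
  unfold fracLapC
  simp only [Real.fourierInv_eq]
  refine StronglyMeasurable.integral_prod_right' (f := fun q : Pt d × Sp d =>
      Real.fourierChar (inner ℝ q.2 q.1.2.1) • ((symb s q.2 : ℂ) *
        𝓕 (fun y : Sp d => (φ (q.1.1, y, q.1.2.2) : ℂ)) q.2)) ?_
  have h2 : Continuous fun q : Pt d × Sp d => Real.fourierChar (inner ℝ q.2 q.1.2.1) :=
    Real.continuous_fourierChar.comp (by fun_prop)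
  have h3 : Continuous fun q : Pt d × Sp d => (symb s q.2 : ℂ) :=
    Complex.continuous_ofReal.comp (hm.comp continuous_snd)
  exact h2.stronglyMeasurable.smul (h3.stronglyMeasurable.mul h1)

theorem lintegral_slices {F : Pt d → ENNReal} (hF : Measurable F) :
    ∫⁻ z, F z = ∫⁻ t : ℝ, ∫⁻ v : Sp d, ∫⁻ x : Sp d, F (t, x, v) := by
  refine (lintegral_prod F hF.aemeasurable).trans ?_
  congr 1 with t
  exact lintegral_prod_symm (fun y : Sp d × Sp d => F (t, y))
    (hF.comp measurable_prodMk_left).aemeasurable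

theorem integral_slices {F : Pt d → ℂ} (hF : Integrable F) :
    ∫ z, F z = ∫ t : ℝ, ∫ v : Sp d, ∫ x : Sp d, F (t, x, v) := by
  refine (integral_prod F hF).trans (integral_congr_ae ?_)
  filter_upwards [hF.prod_right_ae] with t ht
  exact integral_prod_symm (fun y : Sp d × Sp d => F (t, y)) ht

/-- On each `x`-slice Plancherel bounds the norm by those of `φ` and its `x`-gradient. The bound is
then integrated over `t` and `v`. -/
theorem memLp_fracLapC {s : ℝ} (hs : 0 ≤ s) (hs' : s ≤ 1 / 2) {φ : Pt d → ℝ}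
    (h : IsTest univ φ) : MemLp (fracLapC s φ) 2 := by
  have hm := stronglyMeasurable_fracLapC hs h
  refine ⟨hm.aestronglyMeasurable, ?_⟩
  let X : Fin d → Pt d → ℝ := fun i z => fderiv ℝ φ z (0, EuclideanSpace.single i 1, 0)
  have hX : ∀ i, IsTest univ (X i) := fun i => h.fderiv_apply contDiff_const
  have hme : ∀ {ψ : Pt d → ℝ}, IsTest univ ψ → Measurable fun z => ‖(ψ z : ℂ)‖ₑ ^ 2 := fun hψ =>
    ((Complex.continuous_ofReal.comp hψ.smooth.continuous).measurable.enorm).pow_const 2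
  have hfin : ∀ {ψ : Pt d → ℝ}, IsTest univ ψ → ∫⁻ z, ‖(ψ z : ℂ)‖ₑ ^ 2 < ⊤ := fun {ψ} hψ => by
    rw [← eLpNorm_two_sq (fun z => (ψ z : ℂ))]
    exact ENNReal.pow_lt_top hψ.memLp.ofReal.2
  have hsq : eLpNorm (fracLapC s φ) 2 volume ^ 2 < ⊤ := by
    rw [eLpNorm_two_sq, lintegral_slices ((hm.measurable.enorm).pow_const 2)]
    refine lt_of_le_of_lt (b := ∫⁻ t : ℝ, ∫⁻ v : Sp d, ∫⁻ x : Sp d,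
      (‖(φ (t, x, v) : ℂ)‖ₑ ^ 2 + ∑ i, ‖(X i (t, x, v) : ℂ)‖ₑ ^ 2)) ?_ ?_
    · refine lintegral_mono fun t => lintegral_mono fun v => ?_
      obtain ⟨A, hA⟩ := h.exists_slice t v
      have hA' : (fun y : Sp d => (φ (t, y, v) : ℂ)) = A := funext fun y => (hA y).symm
      have hd : ∀ i x, fderiv ℝ A x (EuclideanSpace.single i 1) = (X i (t, x, v) : ℂ) := by
        intro i x
        rw [← hA']
        have h1 : HasFDerivAt (fun y : Sp d => (t, y, v))
            ((0 : Sp d →L[ℝ] ℝ).prod ((ContinuousLinearMap.id ℝ (Sp d)).prod 0)) x :=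
          (hasFDerivAt_const t x).prodMk ((hasFDerivAt_id x).prodMk (hasFDerivAt_const v x))
        have h2 : HasFDerivAt φ (fderiv ℝ φ (t, x, v)) (t, x, v) :=
          (h.smooth.differentiable (by simp) _).hasFDerivAt
        have h3 := Complex.ofRealCLM.hasFDerivAt.comp x (h2.comp x h1)
        have h4 : fderiv ℝ (fun y : Sp d => (φ (t, y, v) : ℂ)) x = _ := h3.fderiv
        rw [h4]
        rfl
      have e1 : ∀ x, fracLapC s φ (t, x, v) = 𝓕⁻ (fun k => (symb s k : ℂ) * sft A k) x := by
        intro x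
        simp only [fracLapC, hA', fourier_coe]
      simp only [e1]
      have hi := integrable_symb_mul hs hs' (sft A)
      have hle := lintegral_symb_mul_fourier_le hs hs' A
      simp only [hd, hA] at hle
      refine le_trans ?_ hle
      -- Plancherel needs a square integrable multiplier; if it were not so, the bound `hle` would
      -- make the claim trivial.
      by_cases htop : ∫⁻ k, ‖(symb s k : ℂ) * sft A k‖ₑ ^ 2 = ⊤
      · rw [htop]; exact le_top
      · have hf2 : MemLp (fun k => (symb s k : ℂ) * sft A k) 2 := by
          refine ⟨hi.1, ?_⟩
          have := eLpNorm_two_sq (μ := volume) (fun k => (symb s k : ℂ) * sft A k)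
          by_contra hc
          rw [not_lt, top_le_iff] at hc
          rw [hc] at this
          exact htop (by rw [← this]; simp)
        rw [← eLpNorm_two_sq (fun k => (symb s k : ℂ) * sft A k),
          ← eLpNorm_two_sq, eLpNorm_fourierInv hi hf2]
    · rw [← lintegral_slices (F := fun z => ‖(φ z : ℂ)‖ₑ ^ 2 + ∑ i, ‖(X i z : ℂ)‖ₑ ^ 2)
        ((hme h).add (Finset.measurable_fun_sum _ fun i _ => hme (hX i))),
        lintegral_add_left (hme h), lintegral_finsetSum _ fun i _ => hme (hX i)]
      exact ENNReal.add_lt_top.2 ⟨hfin h, ENNReal.sum_lt_top.2 fun i _ => hfin (hX i)⟩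
  by_contra hc
  rw [not_lt, top_le_iff] at hc
  simp [hc] at hsq

theorem ae_fst_ne_zero (hd : 1 ≤ d) : ∀ᵐ z : Pt d, z.2.1 ≠ 0 := by
  have : Nonempty (Fin d) := ⟨⟨0, hd⟩⟩
  have h1 : ∀ᵐ x : Sp d, x ≠ 0 := by
    rw [ae_iff]
    simp
  have h2 : ∀ᵐ y : Sp d × Sp d, y.1 ≠ 0 := Measure.quasiMeasurePreserving_fst.ae h1
  exact Measure.quasiMeasurePreserving_snd.ae h2

theorem contDiffAt_symb (s : ℝ) {k : Sp d} (hk : k ≠ 0) : ContDiffAt ℝ ∞ (symb (d := d) s) k := by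
  unfold symb
  exact ContDiffAt.rpow_const_of_ne (contDiffAt_const.mul (contDiffAt_norm ℝ hk)) (by positivity)

/-- The symbol is singular only at the origin, where the bump vanishes in a neighbourhood. -/
theorem IsBump.symb_mul (s : ℝ) {A : Sp d → ℝ} (hA : IsBump {0}ᶜ A) :
    IsBump univ fun k => symb s k * A k := by
  refine ⟨contDiff_iff_contDiffAt.2 fun k => ?_, hA.2.1.mul_left, subset_univ _⟩
  by_cases hk : k = 0
  · have h0 : A =ᶠ[𝓝 k] 0 := notMem_tsupport_iff_eventuallyEq.1 fun h => hA.2.2 h hk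
    have : (fun k => symb s k * A k) =ᶠ[𝓝 k] fun _ => 0 := by
      filter_upwards [h0] with y hy
      rw [hy]
      simp
    exact contDiffAt_const.congr_of_eventuallyEq this
  · exact (contDiffAt_symb s hk).mul hA.1.contDiffAt

/-- The transform of the fractional Laplacian of a test function. -/
theorem isFT_fracLapC (hd : 1 ≤ d) {s : ℝ} (hs : 0 ≤ s) (hs' : s ≤ 1 / 2) {φ : Pt d → ℝ}
    (h : IsTest univ φ) {Φ : Pt d → ℂ} (hΦ : IsFT (cpx φ) Φ) :
    IsFT (fracLapC s φ) fun z => (symb s z.2.1 : ℂ) * Φ z := by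
  have hL := memLp_fracLapC hs hs' h
  obtain ⟨V, hV⟩ := exists_isFT hL
  refine hV.congr (Eventually.of_forall fun _ => rfl) ?_
  have hmc : Continuous fun z : Pt d => (symb s z.2.1 : ℂ) :=
    Complex.continuous_ofReal.comp ((continuous_symb hs).comp (by fun_prop))
  have hMΦ : LocallyIntegrable fun z : Pt d => (symb s z.2.1 : ℂ) * Φ z := by
    refine locallyIntegrable_iff.2 fun K hK => ?_
    exact ((MemLp.locallyIntegrable_two hΦ.right).integrableOn_isCompact hK).continuousOn_mul
      hmc.continuousOn hK
  have key := ae_eq_zero_of_tens isOpen_univ (isOpen_compl_singleton (x := (0 : Sp d))) isOpen_univ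
    ((MemLp.locallyIntegrable_two hV.right).sub hMΦ) fun θ A B hθ hA hB => by
      obtain ⟨A', hA'⟩ := hA.exists_schwartz
      obtain ⟨A'', hA''⟩ := (hA.symb_mul s).exists_schwartz
      obtain ⟨B', hB'⟩ := hB.exists_schwartz
      have hAA : ∀ k, A'' k = (symb s k : ℂ) * A' k := fun k => by
        rw [hA'', hA']; push_cast; ring
      simp only [Pi.sub_apply, sub_mul]
      rw [integral_sub (integrable_mul_tens_bump (MemLp.locallyIntegrable_two hV.right) hθ hA hB)
        (integrable_mul_tens_bump hMΦ hθ hA hB), sub_eq_zero]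
      have e1 : ∫ z, V z * tens (cpx θ) (cpx A) (cpx B) z =
          ∫ z, fracLapC s φ z * stens (cpx θ) (sft A') (sft B') z := by
        rw [hV.pair _ hθ.memLp_cpx, show (A' : Sp d → ℂ) = cpx A from funext hA',
          show (B' : Sp d → ℂ) = cpx B from funext hB']
      have e2 : ∫ z, (symb s z.2.1 : ℂ) * Φ z * tens (cpx θ) (cpx A) (cpx B) z =
          ∫ z, cpx φ z * stens (cpx θ) (sft A'') (sft B') z := by
        rw [hΦ.pair _ hθ.memLp_cpx]
        congr 1 with z
        simp only [tens, hA'', hB', cpx]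
        push_cast
        ring
      rw [e1, e2]
      -- For fixed `t` and `v` the sheared tensor is, up to a constant, a translate in `x` by `t v`,
      -- so the multiplier is moved slice by slice.
      refine (integral_slices (hL.integrable_mul (memLp_stens hθ.memLp_cpx
        (memLp_schwartz (sft A')) (memLp_schwartz (sft B'))))).trans (Eq.trans ?_
        (integral_slices (hΦ.left.integrable_mul (memLp_stens hθ.memLp_cpx
          (memLp_schwartz (sft A'')) (memLp_schwartz (sft B'))))).symm)
      simp only [Pi.mul_apply]
      congr 1 with t
      congr 1 with v
      obtain ⟨ψ, hψ⟩ := h.exists_slice t v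
      have hψ' : (fun y : Sp d => (φ (t, y, v) : ℂ)) = ψ := funext fun y => (hψ y).symm
      have h3 := integral_multiplier_mul hs hs' ψ A' A'' hAA (t • v)
      have e3 : ∀ x, fracLapC s φ (t, x, v) = 𝓕⁻ (fun k => (symb s k : ℂ) * sft ψ k) x := by
        intro x
        simp only [fracLapC, hψ', fourier_coe]
      calc ∫ x, fracLapC s φ (t, x, v) * stens (cpx θ) (sft A') (sft B') (t, x, v)
          = ∫ x, (θ t * sft B' v) *
              (𝓕⁻ (fun k => (symb s k : ℂ) * sft ψ k) x * sft A' (x + t • v)) := by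
            congr 1 with x
            rw [e3]
            simp only [stens, cpx]
            ring
        _ = ∫ x, (θ t * sft B' v) * (ψ x * sft A'' (x + t • v)) := by
            rw [integral_const_mul, h3, integral_const_mul]
        _ = _ := by
            congr 1 with x
            rw [hψ]
            simp only [stens, cpx]
            ring
  -- The excluded frequencies `k = 0` form a null set because `d ≥ 1`.
  filter_upwards [key, ae_fst_ne_zero hd] with z h1 h2
  exact sub_eq_zero.1 (h1 ⟨mem_univ _, h2, mem_univ _⟩)

end FractionalLaplacian

end

section



variable {d : ℕ}

/-! ### From bounds on time lines to `L_2` bounds -/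

section WeightedBounds

theorem ae_aemeasurable_slice {F : Pt d → ℂ} (hF : AEStronglyMeasurable F volume) :
    ∀ᵐ ζ : Sp d × Sp d, AEStronglyMeasurable (fun t => F (t, ζ)) volume := by
  filter_upwards [ae_slice hF.ae_eq_mk] with ζ hζ
  exact ⟨fun t => hF.mk F (t, ζ), hF.stronglyMeasurable_mk.comp_measurable
    (Continuous.prodMk_left ζ).measurable, hζ⟩

theorem lintegral_time_slices {F : Pt d → ENNReal} (hF : AEMeasurable F volume) :
    ∫⁻ z, F z = ∫⁻ ζ : Sp d × Sp d, ∫⁻ t : ℝ, F (t, ζ) :=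
  lintegral_prod_symm F hF

/-- A weighted bound on almost every time line gives a weighted `L_2` bound. -/
theorem slice_bound {U F : Pt d → ℂ} (hU : AEStronglyMeasurable U volume)
    (hF : MemLp F 2) {w : Pt d → ℝ} (hw : Measurable w) (hw0 : ∀ z, 0 ≤ w z) {C : ENNReal}
    (hC : C ≠ ⊤) (hb : ∀ᵐ ζ : Sp d × Sp d, ∫⁻ t, (ENNReal.ofReal (w (t, ζ)) * ‖U (t, ζ)‖ₑ) ^ 2 ≤
      C ^ 2 * ∫⁻ t, ‖F (t, ζ)‖ₑ ^ 2) :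
    MemLp (fun z => (w z : ℂ) * U z) 2 ∧
      eLpNorm (fun z => (w z : ℂ) * U z) 2 volume ≤ C * eLpNorm F 2 volume := by
  have hm : AEStronglyMeasurable (fun z => (w z : ℂ) * U z) volume :=
    (Complex.measurable_ofReal.comp hw).aestronglyMeasurable.mul hU
  have key : eLpNorm (fun z => (w z : ℂ) * U z) 2 volume ≤ C * eLpNorm F 2 volume := by
    rw [← ENNReal.pow_le_pow_left_iff two_ne_zero, mul_pow, eLpNorm_two_sq, eLpNorm_two_sq,
      lintegral_time_slices (hm.enorm.pow_const 2), lintegral_time_slices (hF.1.enorm.pow_const 2),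
      ← lintegral_const_mul' _ _ (ENNReal.pow_ne_top hC)]
    refine lintegral_mono_ae ?_
    filter_upwards [hb] with ζ h1
    refine le_trans (le_of_eq ?_) h1
    congr 1 with t
    rw [enorm_mul, ← ofReal_norm (w (t, ζ) : ℂ), Complex.norm_real, Real.norm_of_nonneg (hw0 _)]
  exact ⟨⟨hm, key.trans_lt (ENNReal.mul_lt_top hC.lt_top hF.2)⟩, key⟩

/-- A pointwise Duhamel bound and a weighted bound on time lines give a weighted `L_2` bound. -/
theorem weight_bound {U F : Pt d → ℂ} (hU : AEStronglyMeasurable U volume)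
    (hF : MemLp F 2) {c : Sp d × Sp d → ℝ → ℝ}
    (hle : ∀ᵐ z : Pt d, ‖U z‖ₑ ≤ duh (c z.2) (fun s => ‖F (s, z.2)‖ₑ) z.1) {w : Pt d → ℝ}
    (hw : Measurable w) (hw0 : ∀ z, 0 ≤ w z) {C : ENNReal} (hC : C ≠ ⊤)
    (hb : ∀ ζ (f : ℝ → ENNReal), AEMeasurable f →
      ∫⁻ t, (ENNReal.ofReal (w (t, ζ)) * duh (c ζ) f t) ^ 2 ≤ C ^ 2 * ∫⁻ s, f s ^ 2) :
    MemLp (fun z => (w z : ℂ) * U z) 2 ∧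
      eLpNorm (fun z => (w z : ℂ) * U z) 2 volume ≤ C * eLpNorm F 2 volume := by
  refine slice_bound hU hF hw hw0 hC ?_
  filter_upwards [ae_slice hle, ae_aemeasurable_slice hF.1] with ζ h1 h2
  refine le_trans (lintegral_mono_ae ?_) (hb ζ _ h2.enorm)
  filter_upwards [h1] with t ht
  exact pow_le_pow_left' (mul_le_mul' le_rfl ht) 2

end WeightedBounds

/-! ### Linearity of the transform and vector valued norms -/

section Linear

theorem IsFT.const_mul {u U : Pt d → ℂ} (h : IsFT u U) (c : ℂ) :
    IsFT (fun z => c * u z) fun z => c * U z :=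
  h.mul_time (b := fun _ => c) measurable_const (C := ‖c‖) fun _ => le_rfl

theorem isFT_zero : IsFT (fun _ : Pt d => (0 : ℂ)) fun _ => 0 :=
  ⟨MemLp.zero', MemLp.zero', fun _ _ _ _ => by simp⟩

theorem IsFT.sum {ι : Type*} (s : Finset ι) {u U : ι → Pt d → ℂ} (h : ∀ i, IsFT (u i) (U i)) :
    IsFT (fun z => ∑ i ∈ s, u i z) fun z => ∑ i ∈ s, U i z := by
  classical
  induction s using Finset.induction_on with
  | empty => simpa using isFT_zero
  | insert i s hi ih =>
    simp only [Finset.sum_insert hi]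
    exact (h i).add ih

theorem MemLp.apply {ι : Type*} [Fintype ι] {p : Pt d → EuclideanSpace ℝ ι} {μ : Measure (Pt d)}
    (h : MemLp p 2 μ) (i : ι) : MemLp (fun z => p z i) 2 μ :=
  (EuclideanSpace.proj (𝕜 := ℝ) i).comp_memLp' h

theorem memLp_of_apply {ι : Type*} [Fintype ι] {p : Pt d → EuclideanSpace ℝ ι}
    {μ : Measure (Pt d)} (h : ∀ i, MemLp (fun z => p z i) 2 μ) : MemLp p 2 μ := by
  classical
  have h1 : MemLp (fun z => ∑ i, p z i • EuclideanSpace.single i (1 : ℝ)) 2 μ :=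
    memLp_finsetSum _ fun i _ => by
      have := (ContinuousLinearMap.toSpanSingleton ℝ
        (EuclideanSpace.single i (1 : ℝ) : EuclideanSpace ℝ ι)).comp_memLp' (h i)
      simpa [Function.comp_def] using this
  have e : (fun z => ∑ i, p z i • EuclideanSpace.single i (1 : ℝ)) = p := by
    funext z
    ext j
    simp [Finset.sum_apply, Pi.single_apply]
  rwa [e] at h1

theorem eLpNorm_le_sum_apply {ι : Type*} [Fintype ι] {p : Pt d → EuclideanSpace ℝ ι}
    {μ : Measure (Pt d)} (h : MemLp p 2 μ) :
    eLpNorm p 2 μ ≤ ∑ i, eLpNorm (fun z => p z i) 2 μ := by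
  classical
  have h1 : eLpNorm p 2 μ ≤ eLpNorm (∑ i, fun z => ‖p z i‖) 2 μ := by
    refine eLpNorm_mono_real fun z => ?_
    rw [Finset.sum_apply]
    have : p z = ∑ i, EuclideanSpace.single i (p z i) := by
      ext j
      simp [Finset.sum_apply]
    calc ‖p z‖ = ‖∑ i, EuclideanSpace.single i (p z i)‖ := by rw [← this]
      _ ≤ ∑ i, ‖EuclideanSpace.single i (p z i)‖ := norm_sum_le _ _
      _ = _ := by simp
  refine h1.trans ((eLpNorm_sum_le (fun i _ => (MemLp.apply h i).1.norm) (by norm_num)).trans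
    (le_of_eq ?_))
  simp only [eLpNorm_norm]

end Linear

/-! ### The a priori estimate -/

section Estimate

variable {a : ℝ → Matrix (Fin d) (Fin d) ℝ} {δ lam : ℝ} {J : Set ℝ} {u : Pt d → ℝ}
  {p : Pt d → Sp d} {H : Pt d → EuclideanSpace ℝ (Fin d × Fin d)} {Y : Pt d → ℝ}
  {U F : Pt d → ℂ}

theorem HasS2.isFT_p (h : HasS2 (cyl d J) u p H Y) (hJ : IsOpen J)
    (hU : IsFT (ext0 (cyl d J) u) U) (i : Fin d) :
    IsFT (ext0 (cyl d J) fun z => p z i) fun z => Complex.I * (eta z i : ℂ) * U z := by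
  have hm := (isOpen_cyl (d := d) hJ).measurableSet
  obtain ⟨V, hV⟩ := exists_isFT (memLp_ext0 hm (MemLp.apply h.memLp_p i))
  exact hV.congr (Eventually.of_forall fun _ => rfl)
    ((h.weak_p i).isFT hJ h.memLp_u (MemLp.apply h.memLp_p i) hU hV)

theorem HasS2.isFT_H (h : HasS2 (cyl d J) u p H Y) (hJ : IsOpen J)
    (hU : IsFT (ext0 (cyl d J) u) U) (i j : Fin d) :
    IsFT (ext0 (cyl d J) fun z => H z (i, j))
      fun z => -((eta z i * eta z j : ℝ) : ℂ) * U z := by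
  have hm := (isOpen_cyl (d := d) hJ).measurableSet
  obtain ⟨V, hV⟩ := exists_isFT (memLp_ext0 hm (MemLp.apply h.memLp_H (i, j)))
  refine hV.congr (Eventually.of_forall fun _ => rfl) ?_
  filter_upwards [(h.weak_H i j).isFT hJ (MemLp.apply h.memLp_p j) (MemLp.apply h.memLp_H (i, j))
    (h.isFT_p hJ hU j) hV] with z hz
  rw [hz]
  push_cast
  linear_combination (eta z i * eta z j * U z : ℂ) * Complex.I_mul_I

/-- The transform of the combination `Y - a^{ij} H_{ij} + lam u`. -/
theorem isFT_operator (ha : IsCoeff δ a) {uc Yc Yh : Pt d → ℂ} {Hc : Fin d → Fin d → Pt d → ℂ}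
    (hu : IsFT uc U) (hY : IsFT Yc Yh)
    (hH : ∀ i j, IsFT (Hc i j) fun z => -((eta z i * eta z j : ℝ) : ℂ) * U z) :
    IsFT (fun z => Yc z - (∑ i, ∑ j, (a z.1 i j : ℂ) * Hc i j z) + lam * uc z)
      fun z => Yh z + (rate a lam z.2 z.1 : ℂ) * U z := by
  obtain ⟨C, hC⟩ := ha.bounded
  have h1 := (IsFT.sum Finset.univ fun i => IsFT.sum Finset.univ fun j =>
    (hH i j).mul_time (b := fun t => (a t i j : ℂ))
      (Complex.measurable_ofReal.comp (ha.measurable i j)) (C := C)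
      fun t => by rw [Complex.norm_real]; exact hC t i j).const_mul (-1)
  have h2 := (hY.add h1).add (hu.const_mul lam)
  refine h2.congr (Eventually.of_forall fun z => ?_) (Eventually.of_forall fun z => ?_)
  · ring
  · simp only [rate, quad]
    push_cast
    rw [add_mul, Finset.sum_mul, Finset.mul_sum, ← add_assoc]
    congr 2
    refine Finset.sum_congr rfl fun i _ => ?_
    rw [Finset.sum_mul, Finset.mul_sum]
    refine Finset.sum_congr rfl fun j _ => ?_
    ring

theorem HasS2.isFT_P0 (h : HasS2 (cyl d J) u p H Y) (ha : IsCoeff δ a) (hJ : IsOpen J)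
    (hU : IsFT (ext0 (cyl d J) u) U) {V : Pt d → ℂ} (hV : IsFT (ext0 (cyl d J) Y) V) :
    IsFT (ext0 (cyl d J) fun z => P0 a H Y z + lam * u z)
      fun z => V z + (rate a lam z.2 z.1 : ℂ) * U z := by
  refine (isFT_operator (lam := lam) ha hU hV (h.isFT_H hJ hU)).congr
    (Eventually.of_forall fun z => ?_) (Eventually.of_forall fun _ => rfl)
  by_cases hz : z ∈ cyl d J
  · simp [ext0, hz, P0, cpx]
  · simp [ext0, hz]

theorem ae_memLp_slice {f : Pt d → ℂ} (hf : MemLp f 2) :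
    ∀ᵐ ζ : Sp d × Sp d, MemLp (fun t => f (t, ζ)) 2 := by
  have h1 : Integrable (fun z => ‖f z‖ ^ 2) (volume : Measure (Pt d)) :=
    hf.integrable_norm_pow two_ne_zero
  have h2 : ∀ᵐ ζ : Sp d × Sp d, Integrable fun t => ‖f (t, ζ)‖ ^ 2 := h1.prod_left_ae
  filter_upwards [h2, ae_aemeasurable_slice hf.1] with ζ h3 h4
  exact (memLp_two_iff_integrable_sq_norm h4).2 h3

/-- The transform of `u` is controlled by the Duhamel integral of the transform of the right hand
side. -/
theorem HasS2.ae_le_duh (h : HasS2 (cyl d J) u p H Y) (ha : IsCoeff δ a) (hδ : 0 < δ)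
    (hl : 0 ≤ lam) (hJ : IsOpen J) (hJl : IsLowerSet J)
    (hU : IsFT (ext0 (cyl d J) u) U)
    (hF : IsFT (ext0 (cyl d J) fun z => P0 a H Y z + lam * u z) F) :
    ∀ᵐ z : Pt d, ‖U z‖ₑ ≤ duh (rate a lam z.2) (fun s => ‖F (s, z.2)‖ₑ) z.1 := by
  have hm := (isOpen_cyl (d := d) hJ).measurableSet
  have hoff := hU.ae_eq_zero_off hJ.measurableSet
  rcases J.eq_empty_or_nonempty with rfl | hne
  · filter_upwards [hoff] with z hz
    simp [hz]
  obtain ⟨V, hV⟩ := exists_isFT (memLp_ext0 hm h.memLp_Y)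
  obtain ⟨W, hW, hWp⟩ := exists_isPrim_of_weak hJ hJl.ordConnected hne hU.right hV.right
    (h.weak_Y.weak_time hJ h.memLp_u h.memLp_Y hU hV)
  have hR := hF.ae_unique (h.isFT_P0 ha hJ hU hV)
  have key : ∀ᵐ ζ : Sp d × Sp d, ∀ b ∈ J,
      ‖W (b, ζ)‖ₑ ≤ duh (rate a lam ζ) (fun s => ‖F (s, ζ)‖ₑ) b := by
    filter_upwards [hWp, ae_slice hW, ae_slice hR, ae_memLp_slice hU.right] with ζ h1 h2 h3 h4 b hb
    -- Since `J` is a lower set, `W` equals `U` almost everywhere on the whole half line up to `b`,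
    -- which gives both square integrability and the equation.
    refine (ha.isRate hδ hl ζ).duhamel_le (fun c hc => h1 c b hc) ?_ ?_
    · refine (h4.restrict (Iic b)).ae_eq ?_
      refine (ae_restrict_iff' measurableSet_Iic).2 ?_
      filter_upwards [h2] with t ht htb
      exact ht (hJl htb hb)
    · filter_upwards [h2, h3] with t ht ht' htb
      rw [ht', ← ht (hJl htb hb)]
      ring
  have key' : ∀ᵐ z : Pt d, z.1 ∈ J →
      ‖W z‖ₑ ≤ duh (rate a lam z.2) (fun s => ‖F (s, z.2)‖ₑ) z.1 := by
    have : ∀ᵐ z : Pt d, ∀ b ∈ J,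
      ‖W (b, z.2)‖ₑ ≤ duh (rate a lam z.2) (fun s => ‖F (s, z.2)‖ₑ) b :=
      Measure.quasiMeasurePreserving_snd.ae key
    filter_upwards [this] with z hz hzJ using hz z.1 hzJ
  filter_upwards [hoff, hW, key'] with z h1 h2 h3
  by_cases hz : z.1 ∈ J
  · rw [h2 hz]; exact h3 hz
  · simp [h1 hz]

/-- The sum of the symbols of `lam`, `-Δ_v` and `(-Δ_x)^{1/3}`. -/
def wt (lam : ℝ) (z : Pt d) : ℝ := lam + ‖eta z‖ ^ 2 + symb (1 / 3) z.2.1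

theorem symb_third_pow (k : Sp d) : symb (1 / 3) k ^ 3 = ‖(2 * Real.pi) • k‖ ^ 2 := by
  have h0 : 0 ≤ 2 * Real.pi * ‖k‖ := by positivity
  rw [symb, ← Real.rpow_natCast, ← Real.rpow_mul h0, norm_smul, Real.norm_of_nonneg (by positivity),
    ← Real.rpow_natCast]
  norm_num

theorem symb_sixth_sq (k : Sp d) : symb (1 / 6) k ^ 2 = symb (1 / 3) k := by
  have h0 : 0 ≤ 2 * Real.pi * ‖k‖ := by positivity
  rw [symb, symb, ← Real.rpow_natCast, ← Real.rpow_mul h0]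
  norm_num

theorem abs_eta_le (z : Pt d) (i : Fin d) : |eta z i| ≤ ‖eta z‖ := by
  simpa using PiLp.norm_apply_le (eta z) i

/-- Every multiplier dominated by `wt` is bounded by the right hand side. -/
theorem freq_bound (ha : IsCoeff δ a) (hδ : 0 < δ) (hδ1 : δ < 1) (hl : 0 ≤ lam)
    (hU : AEStronglyMeasurable U volume) (hF : MemLp F 2)
    (hle : ∀ᵐ z : Pt d, ‖U z‖ₑ ≤ duh (rate a lam z.2) (fun s => ‖F (s, z.2)‖ₑ) z.1)
    {g : Pt d → ℂ} (hg : Measurable g) (hgw : ∀ z, ‖g z‖ ≤ wt lam z) :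
    MemLp (fun z => g z * U z) 2 ∧
      eLpNorm (fun z => g z * U z) 2 volume ≤
        ENNReal.ofReal (39 * δ⁻¹) * eLpNorm F 2 volume := by
  have h1 := weight_bound (w := fun _ => lam) hU hF hle measurable_const (fun _ => hl)
    ENNReal.one_ne_top fun ζ f hf => by simpa using ha.bound_lam hδ hl ζ hf
  have h2 := weight_bound (w := fun z => ‖eta z‖ ^ 2) hU hF hle
    (continuous_eta.norm.pow 2).measurable (fun _ => by positivity) ENNReal.ofReal_ne_top
    fun ζ f hf => ha.bound_eta hδ hl ζ hf
  have h3 := weight_bound (w := fun z => symb (1 / 3) z.2.1) hU hF hle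
    ((continuous_symb (by norm_num)).comp (by fun_prop : Continuous fun z : Pt d => z.2.1)).measurable
    (fun _ => symb_nonneg _ _) ENNReal.ofReal_ne_top
    fun ζ f hf => ha.bound_kap hδ hδ1 hl ζ (symb_nonneg _ _) (symb_third_pow _) hf
  have hm : AEStronglyMeasurable (fun z => g z * U z) volume := hg.aestronglyMeasurable.mul hU
  have hi : 1 ≤ δ⁻¹ := (one_le_inv₀ hδ).2 hδ1.le
  have key : eLpNorm (fun z => g z * U z) 2 volume ≤
      ENNReal.ofReal (39 * δ⁻¹) * eLpNorm F 2 volume := by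
    have h4 := (h1.1.add h2.1).add h3.1
    have e1 : eLpNorm (fun z => g z * U z) 2 volume ≤ eLpNorm
        ((fun z => (lam : ℂ) * U z) + (fun z => ((‖eta z‖ ^ 2 : ℝ) : ℂ) * U z) +
          fun z => (symb (1 / 3) z.2.1 : ℂ) * U z) 2 volume := by
      refine eLpNorm_mono fun z => ?_
      simp only [Pi.add_apply, ← add_mul, norm_mul, ← Complex.ofReal_add]
      rw [Complex.norm_real]
      exact mul_le_mul_of_nonneg_right ((hgw z).trans (le_abs_self _)) (norm_nonneg _)
    refine e1.trans ((eLpNorm_add_le (h1.1.add h2.1).1 h3.1.1 (by norm_num)).trans ?_)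
    refine (add_le_add (eLpNorm_add_le h1.1.1 h2.1.1 (by norm_num)) le_rfl).trans ?_
    refine (add_le_add (add_le_add h1.2 h2.2) h3.2).trans ?_
    -- The three weights contribute `1 + 2δ⁻¹ + 36δ⁻¹`, at most `39δ⁻¹` because `δ < 1`.
    rw [← add_mul, ← add_mul, ← ENNReal.ofReal_one, ← ENNReal.ofReal_add (by norm_num) (by positivity),
      ← ENNReal.ofReal_add (by positivity) (by positivity)]
    gcongr
    linarith
  exact ⟨⟨hm, key.trans_lt (ENNReal.mul_lt_top ENNReal.ofReal_lt_top hF.2)⟩, key⟩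

theorem eLpNorm_ext0 {G : Set (Pt d)} (hG : MeasurableSet G) (u : Pt d → ℝ) :
    eLpNorm (ext0 G u) 2 volume = eLpNorm u 2 (leb G) := by
  rw [ext0, eLpNorm_indicator_eq_eLpNorm_restrict hG]
  exact eLpNorm_congr_norm_ae (Eventually.of_forall fun z => by simp [cpx])

theorem integral_re_mul {f g : Pt d → ℂ} (hf : MemLp f 2) (hg : MemLp g 2) :
    (∫ z, f z * conj (g z)).re = ∫ z, (f z * conj (g z)).re :=
  (integral_re (𝕜 := ℂ) (hf.integrable_mul (memLp_conj hg))).symm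

theorem setIntegral_re_mul_test {G : Set (Pt d)} {f : Pt d → ℂ} (hf : MemLp f 2) {φ : Pt d → ℝ}
    (hφ : IsTest G φ) : ∫ z in G, (f z).re * φ z = (∫ z, f z * conj (cpx φ z)).re := by
  rw [integral_re_mul (g := cpx φ) hf hφ.memLp.ofReal,
    setIntegral_eq_integral_of_forall_compl_eq_zero fun z hz => by
      rw [image_eq_zero_of_notMem_tsupport fun h => hz (hφ.supp h), mul_zero]]
  congr 1 with z
  simp [cpx]

theorem setIntegral_mul_re {G : Set (Pt d)} (hG : MeasurableSet G) {u : Pt d → ℝ}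
    (hu : MemLp u 2 (leb G)) {g : Pt d → ℂ} (hg : MemLp g 2) :
    ∫ z in G, u z * (g z).re = (∫ z, ext0 G u z * conj (g z)).re := by
  rw [integral_re_mul (memLp_ext0 hG hu) hg, ← integral_indicator hG]
  congr 1 with z
  by_cases hz : z ∈ G <;> simp [ext0, hz, cpx]

/-- The fractional derivative of `u`, read off from the transform of `u`. -/
theorem isFracLapX_of_isFT (hd : 1 ≤ d) {s : ℝ} (hs : 0 ≤ s) (hs' : s ≤ 1 / 2) {G : Set (Pt d)}
    (hG : MeasurableSet G) (hu : MemLp u 2 (leb G)) (hU : IsFT (ext0 G u) U) {w : Pt d → ℂ}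
    (hw : IsFT w fun z => (symb s z.2.1 : ℂ) * U z) :
    IsFracLapX G s u fun z => (w z).re := by
  intro φ hφ
  obtain ⟨Φ, hΦ⟩ := exists_isFT (u := cpx φ) hφ.memLp.ofReal
  have h1 := isFT_fracLapC hd hs hs' hφ.toUniv hΦ
  simp only [fracLapX_eq_re]
  rw [setIntegral_mul_re hG hu h1.left, setIntegral_re_mul_test hw.left hφ, hU.parseval h1,
    hw.parseval hΦ]
  congr 2 with z
  simp only [map_mul, Complex.conj_ofReal]
  ring

theorem isDvFracLapX_of_isFT (hd : 1 ≤ d) {s : ℝ} (hs : 0 ≤ s) (hs' : s ≤ 1 / 2) {G : Set (Pt d)}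
    (hG : MeasurableSet G) (hu : MemLp u 2 (leb G)) (hU : IsFT (ext0 G u) U) (i : Fin d)
    {w : Pt d → ℂ}
    (hw : IsFT w fun z => Complex.I * (eta z i : ℂ) * (symb s z.2.1 : ℂ) * U z) :
    IsDvFracLapX G s i u fun z => (w z).re := by
  intro φ hφ
  obtain ⟨Φ, hΦ⟩ := exists_isFT (u := cpx φ) hφ.memLp.ofReal
  have h1 := isFT_fracLapC hd hs hs' (hφ.dv i).toUniv (hφ.toUniv.isFT_dv i hΦ)
  simp only [fracLapX_eq_re]
  rw [setIntegral_mul_re hG hu h1.left, setIntegral_re_mul_test hw.left hφ, hU.parseval h1,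
    hw.parseval hΦ, ← Complex.neg_re, ← integral_neg]
  congr 2 with z
  simp only [map_mul, Complex.conj_ofReal, Complex.conj_I]
  ring

theorem eLpNorm_re_le {f : Pt d → ℂ} (G : Set (Pt d)) :
    eLpNorm (fun z => (f z).re) 2 (leb G) ≤ eLpNorm f 2 volume :=
  (eLpNorm_mono fun z => by simpa using Complex.abs_re_le_norm (f z)).trans
    (eLpNorm_restrict_le _ _ _ _)

/-- The constant of the a priori estimate. -/
def aprioriConst (d : ℕ) : ℝ := 39 * (2 + 2 * d + d ^ 2)

/-- Each quantity on the left is, up to restriction and real parts, a multiplier of `U` dominated by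
`wt`. The fractional derivatives are defined as inverse transforms and recognised by Parseval. -/
theorem HasS2.apriori (h : HasS2 (cyl d J) u p H Y) (hd : 1 ≤ d) (ha : IsCoeff δ a) (hδ : 0 < δ)
    (hδ1 : δ < 1) (hl : 0 ≤ lam) (hJ : IsOpen J) (hJl : IsLowerSet J) :
    ∃ w m, HasFrac (cyl d J) u w m ∧
      ENNReal.ofReal lam * normL2 (cyl d J) u
        + ENNReal.ofReal (Real.sqrt lam) * normL2 (cyl d J) p
        + normL2 (cyl d J) H + normL2 (cyl d J) w + normL2 (cyl d J) m
      ≤ ENNReal.ofReal (aprioriConst d * δ⁻¹)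
        * normL2 (cyl d J) (fun z => P0 a H Y z + lam * u z) := by
  have hm := (isOpen_cyl (d := d) hJ).measurableSet
  obtain ⟨U, hU⟩ := exists_isFT (memLp_ext0 hm h.memLp_u)
  obtain ⟨V, hV⟩ := exists_isFT (memLp_ext0 hm h.memLp_Y)
  have hop := h.isFT_P0 (lam := lam) ha hJ hU hV
  set F : Pt d → ℂ := fun z => V z + (rate a lam z.2 z.1 : ℂ) * U z with hFdef
  have hle := h.ae_le_duh ha hδ hl hJ hJl hU hop
  have hFn : eLpNorm F 2 volume = normL2 (cyl d J) (fun z => P0 a H Y z + lam * u z) := by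
    rw [← hop.eLpNorm_eq, eLpNorm_ext0 hm]
  have fb := fun (g : Pt d → ℂ) hg hgw =>
    freq_bound ha hδ hδ1 hl hU.right.1 hop.right hle (g := g) hg hgw
  have hsl := Real.sq_sqrt hl
  have hsl0 := Real.sqrt_nonneg lam
  have hηm : ∀ i, Measurable fun z : Pt d => (eta z i : ℂ) := fun i =>
    Complex.measurable_ofReal.comp (continuous_eta_apply i).measurable
  have hsm : ∀ s : ℝ, 0 ≤ s → Measurable fun z : Pt d => (symb s z.2.1 : ℂ) := fun s hs =>
    Complex.measurable_ofReal.comp ((continuous_symb hs).comp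
      (by fun_prop : Continuous fun z : Pt d => z.2.1)).measurable
  have hs3 := fun z : Pt d => symb_nonneg (1 / 3) z.2.1
  have b1 := fb (fun _ => (lam : ℂ)) measurable_const fun z => by
    rw [Complex.norm_real, Real.norm_of_nonneg hl, wt]
    nlinarith [hs3 z, sq_nonneg ‖eta z‖]
  -- The mixed terms here and in `b5` are dominated through `xy ≤ x² + y²`, with `x² = λ` or `x² =
  -- |κ|^{2/3}` and `y = |η_i|`.
  have b2 := fun i => fb (fun z => (Real.sqrt lam : ℂ) * (Complex.I * (eta z i : ℂ)))
    (measurable_const.mul (measurable_const.mul (hηm i))) fun z => by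
      simp only [norm_mul, Complex.norm_real, Complex.norm_I, one_mul, Real.norm_eq_abs,
        abs_of_nonneg hsl0, wt]
      nlinarith [hs3 z, abs_eta_le z i, abs_nonneg (eta z i), sq_nonneg (Real.sqrt lam - |eta z i|),
        norm_nonneg (eta z)]
  have b3 := fun i j => fb (fun z => -((eta z i * eta z j : ℝ) : ℂ))
    (by push_cast; exact ((hηm i).mul (hηm j)).neg) fun z => by
      rw [norm_neg, Complex.norm_real, Real.norm_eq_abs, abs_mul, wt]
      have := mul_le_mul (abs_eta_le z i) (abs_eta_le z j) (abs_nonneg _) (norm_nonneg _)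
      nlinarith [hs3 z]
  have b4 := fb (fun z => (symb (1 / 3) z.2.1 : ℂ)) (hsm _ (by norm_num)) fun z => by
    rw [Complex.norm_real, Real.norm_of_nonneg (hs3 z), wt]
    nlinarith [sq_nonneg ‖eta z‖]
  have b5 := fun i => fb (fun z => Complex.I * (eta z i : ℂ) * (symb (1 / 6) z.2.1 : ℂ))
    ((measurable_const.mul (hηm i)).mul (hsm _ (by norm_num))) fun z => by
      simp only [norm_mul, Complex.norm_real, Complex.norm_I, one_mul, Real.norm_eq_abs,
        abs_of_nonneg (symb_nonneg (1 / 6) z.2.1), wt]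
      nlinarith [hs3 z, abs_eta_le z i, abs_nonneg (eta z i), symb_sixth_sq z.2.1,
        sq_nonneg (symb (1 / 6) z.2.1 - |eta z i|), norm_nonneg (eta z),
        symb_nonneg (1 / 6) z.2.1]
  obtain ⟨wc, hwc⟩ := exists_isFT_inv b4.1
  choose mc hmc using fun i => exists_isFT_inv (b5 i).1
  have hwL : MemLp (fun z => (wc z).re) 2 (leb (cyl d J)) := (hwc.left.re).restrict _
  have hmL : ∀ i, MemLp (fun z => (mc i z).re) 2 (leb (cyl d J)) := fun i =>
    ((hmc i).left.re).restrict _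
  have hmL' : MemLp (fun z => (WithLp.toLp 2 fun i => (mc i z).re : Sp d)) 2 (leb (cyl d J)) :=
    memLp_of_apply hmL
  refine ⟨fun z => (wc z).re, fun z => WithLp.toLp 2 fun i => (mc i z).re,
    ⟨hwL, hmL', isFracLapX_of_isFT hd (by norm_num) (by norm_num) hm h.memLp_u hU hwc,
      fun i => isDvFracLapX_of_isFT hd (by norm_num) (by norm_num) hm h.memLp_u hU i (hmc i)⟩, ?_⟩
  set K : ENNReal := ENNReal.ofReal (39 * δ⁻¹) * eLpNorm F 2 volume with hK
  have c1 : ENNReal.ofReal lam * normL2 (cyl d J) u ≤ K := by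
    refine le_trans (le_of_eq ?_) b1.2
    rw [normL2, ← eLpNorm_ext0 hm, hU.eLpNorm_eq]
    have := eLpNorm_const_smul (lam : ℂ) U 2 (volume : Measure (Pt d))
    rw [show (fun z => (lam : ℂ) * U z) = (lam : ℂ) • U from rfl, this, ← ofReal_norm,
      Complex.norm_real, Real.norm_of_nonneg hl]
  have c2 : ENNReal.ofReal (Real.sqrt lam) * normL2 (cyl d J) p ≤ d * K := by
    refine (mul_le_mul' le_rfl (eLpNorm_le_sum_apply h.memLp_p)).trans ?_
    rw [Finset.mul_sum]
    refine (Finset.sum_le_card_nsmul _ _ K fun i _ => ?_).trans (by simp)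
    refine le_trans (le_of_eq ?_) (b2 i).2
    rw [← eLpNorm_ext0 hm, (h.isFT_p hJ hU i).eLpNorm_eq]
    have := eLpNorm_const_smul (Real.sqrt lam : ℂ) (fun z => Complex.I * (eta z i : ℂ) * U z) 2
      (volume : Measure (Pt d))
    rw [← ofReal_norm, Complex.norm_real, Real.norm_of_nonneg hsl0] at this
    rw [← this]
    congr 1
    funext z
    simp only [Pi.smul_apply, smul_eq_mul]
    ring
  have c3 : normL2 (cyl d J) H ≤ (d ^ 2 : ℕ) * K := by
    refine (eLpNorm_le_sum_apply h.memLp_H).trans ?_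
    refine (Finset.sum_le_card_nsmul _ _ K fun q _ => ?_).trans (by simp [pow_two])
    obtain ⟨i, j⟩ := q
    refine le_trans (le_of_eq ?_) (b3 i j).2
    rw [← eLpNorm_ext0 hm, (h.isFT_H hJ hU i j).eLpNorm_eq]
  have c4 : normL2 (cyl d J) (fun z => (wc z).re) ≤ K :=
    (eLpNorm_re_le _).trans (hwc.eLpNorm_eq.trans_le b4.2)
  have c5 : normL2 (cyl d J) (fun z => (WithLp.toLp 2 fun i => (mc i z).re : Sp d)) ≤ d * K := by
    refine (eLpNorm_le_sum_apply hmL').trans ?_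
    refine (Finset.sum_le_card_nsmul _ _ K fun i _ => ?_).trans (by simp)
    exact (eLpNorm_re_le _).trans ((hmc i).eLpNorm_eq.trans_le (b5 i).2)
  -- One multiple of `K` per scalar component: `1 + d + d² + 1 + d`.
  refine (add_le_add (add_le_add (add_le_add (add_le_add c1 c2) c3) c4) c5).trans (le_of_eq ?_)
  rw [← hFn, hK, aprioriConst]
  have e : ENNReal.ofReal (39 * (2 + 2 * d + d ^ 2) * δ⁻¹) =
      (2 + 2 * d + (d ^ 2 : ℕ)) * ENNReal.ofReal (39 * δ⁻¹) := by
    rw [show (39 * (2 + 2 * d + d ^ 2) * δ⁻¹ : ℝ) = ((2 + 2 * d + d ^ 2 : ℕ) : ℝ) * (39 * δ⁻¹) by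
      push_cast; ring, ENNReal.ofReal_mul (by positivity), ENNReal.ofReal_natCast]
    push_cast
    rfl
  rw [e]
  ring

end Estimate

end

section



variable {d : ℕ}

/-! ### From the transform back to weak derivatives -/

section Converse

variable {J : Set ℝ} {U : Pt d → ℂ}

/-- Parseval against the transform of the test function; `i η_i` is purely imaginary, which produces
the sign of integration by parts. Real test functions only see real parts. -/
theorem isWeakDv_of_isFT {G : Set (Pt d)} {u v : Pt d → ℂ} {i : Fin d} (hu : IsFT u U)
    (hv : IsFT v fun z => Complex.I * (eta z i : ℂ) * U z) :
    IsWeakDv G i (fun z => (u z).re) fun z => (v z).re := by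
  intro φ hφ
  obtain ⟨Φ, hΦ⟩ := exists_isFT (u := cpx φ) hφ.memLp.ofReal
  rw [setIntegral_re_mul_test hu.left (hφ.dv i), setIntegral_re_mul_test hv.left hφ,
    hu.parseval (hφ.toUniv.isFT_dv i hΦ), hv.parseval hΦ, ← Complex.neg_re, ← integral_neg]
  congr 2 with z
  simp only [map_mul, Complex.conj_ofReal, Complex.conj_I]
  ring

theorem IsTest.exists_Icc {φ : Pt d → ℝ} (hJ : J.OrdConnected) (hne : J.Nonempty)
    (hφ : IsTest (cyl d J) φ) :
    ∃ a b, a ≤ b ∧ Icc a b ⊆ J ∧ ∀ z ∈ tsupport φ, z.1 ∈ Icc a b := by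
  rcases (tsupport φ).eq_empty_or_nonempty with h | h
  · obtain ⟨t, ht⟩ := hne
    exact ⟨t, t, le_rfl, hJ.out ht ht, by simp [h]⟩
  · have hc : IsCompact (Prod.fst '' tsupport φ) := hφ.compact.isCompact.image continuous_fst
    have hn : (Prod.fst '' tsupport φ).Nonempty := h.image _
    have hs : Prod.fst '' tsupport φ ⊆ J := by
      rintro _ ⟨z, hz, rfl⟩
      exact hφ.supp hz
    refine ⟨_, _, Real.sInf_le_sSup _ hc.bddBelow hc.bddAbove,
      hJ.out (hs (hc.sInf_mem hn)) (hs (hc.sSup_mem hn)), fun z hz => ?_⟩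
    exact ⟨csInf_le hc.bddBelow ⟨z, hz, rfl⟩, le_csSup hc.bddAbove ⟨z, hz, rfl⟩⟩

theorem ext0_eq_cpx {G : Set (Pt d)} {φ : Pt d → ℝ} (h : ∀ z, z ∉ G → φ z = 0) :
    ext0 G φ = cpx φ := by
  funext z
  by_cases hz : z ∈ G
  · simp [ext0, hz]
  · simp [ext0, hz, cpx, h z hz]

theorem integral_time_slices {F : Pt d → ℂ} (hF : Integrable F) :
    ∫ z, F z = ∫ ζ : Sp d × Sp d, ∫ t : ℝ, F (t, ζ) :=
  integral_prod_symm F hF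

/-- Integration by parts in time against the transform of a test function. -/
theorem integral_transport_freq (hJ : J.OrdConnected) {φ : Pt d → ℝ} (hφ : IsTest (cyl d J) φ)
    {Φ Ψ : Pt d → ℂ} (hΦ : IsFT (cpx φ) Φ) (hΨ : IsFT (cpx (transport φ)) Ψ)
    {V W Z : Pt d → ℂ} (hU : MemLp U 2) (hV : MemLp V 2)
    (hUW : ∀ᵐ z, z.1 ∈ J → U z = W z) (hVZ : ∀ᵐ z, z.1 ∈ J → V z = Z z)
    (hp : ∀ᵐ ζ : Sp d × Sp d, ∀ a b, a ≤ b → IsPrim (fun t => W (t, ζ)) (fun t => Z (t, ζ)) a b) :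
    ∫ z, U z * conj (Ψ z) = -∫ z, V z * conj (Φ z) := by
  rcases J.eq_empty_or_nonempty with rfl | hne
  · have h0 : ∀ z, φ z = 0 := fun z => image_eq_zero_of_notMem_tsupport fun h => hφ.supp h
    have hφ0 : φ = fun _ => 0 := funext h0
    subst hφ0
    have e1 : cpx (transport fun _ : Pt d => (0 : ℝ)) = fun _ => 0 := by
      funext z; simp [transport, cpx]
    have e2 : cpx (fun _ : Pt d => (0 : ℝ)) = fun _ => 0 := by funext z; simp [cpx]
    have z1 := (hΨ.congr (Eventually.of_forall fun z => congrFun e1 z)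
      (Eventually.of_forall fun _ => rfl)).ae_unique isFT_zero
    have z2 := (hΦ.congr (Eventually.of_forall fun z => congrFun e2 z)
      (Eventually.of_forall fun _ => rfl)).ae_unique isFT_zero
    have w1 : ∫ z, U z * conj (Ψ z) = 0 :=
      integral_eq_zero_of_ae (by filter_upwards [z1] with z hz; simp [hz])
    have w2 : ∫ z, V z * conj (Φ z) = 0 :=
      integral_eq_zero_of_ae (by filter_upwards [z2] with z hz; simp [hz])
    rw [w1, w2, neg_zero]
  obtain ⟨a, b, hab, hIJ, hsupp⟩ := hφ.exists_Icc hJ hne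
  have hφz : ∀ z, z ∉ cyl d (Icc a b) → φ z = 0 := fun z hz =>
    image_eq_zero_of_notMem_tsupport fun h => hz (hsupp z h)
  have hψz : ∀ z, z ∉ cyl d (Icc a b) → transport φ z = 0 := fun z hz => by
    have : fderiv ℝ φ z = 0 := image_eq_zero_of_notMem_tsupport fun h =>
      hz (hsupp z (tsupport_fderiv_subset ℝ h))
    simp [transport, this]
  have hΦ0 : ∀ᵐ z, z.1 ∉ Icc a b → Φ z = 0 :=
    IsFT.ae_eq_zero_off (u := φ) measurableSet_Icc (by rwa [ext0_eq_cpx hφz])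
  have hΨ0 : ∀ᵐ z, z.1 ∉ Icc a b → Ψ z = 0 :=
    IsFT.ae_eq_zero_off (u := transport φ) measurableSet_Icc (by rwa [ext0_eq_cpx hψz])
  have hwt : IsWeakTransport (cyl d univ) φ (transport φ) := hφ.toUniv.isWeakTransport
  -- The transform of a test function also has only an absolutely continuous representative,
  -- obtained from the weak equation that the test function satisfies.
  obtain ⟨L, hL, hLp⟩ := exists_isPrim_of_weak isOpen_univ ordConnected_univ univ_nonempty
    hΦ.right hΨ.right (hwt.weak_time isOpen_univ (hφ.memLp.restrict _)
      (hφ.transport.memLp.restrict _) (by rwa [cyl_univ, ext0_univ]) (by rwa [cyl_univ, ext0_univ]))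
  have i1 : Integrable fun z => U z * conj (Ψ z) := hU.integrable_mul (memLp_conj hΨ.right)
  have i2 : Integrable fun z => V z * conj (Φ z) := hV.integrable_mul (memLp_conj hΦ.right)
  rw [integral_time_slices i1, integral_time_slices i2, ← integral_neg]
  refine integral_congr_ae ?_
  filter_upwards [hp, hLp, ae_slice hL, ae_slice hΦ0, ae_slice hΨ0, ae_slice hUW, ae_slice hVZ]
    with ζ p1 p2 l1 f0 g0 uw vz
  set a' := a - 1 with ha'
  set b' := b + 1 with hb'
  have hab' : a' ≤ b' := by rw [ha', hb']; linarith
  -- Vanishing almost everywhere off `[a, b]` becomes vanishing everywhere there by continuity, so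
  -- the boundary terms at `a - 1` and `b + 1` are zero.
  have hL0 : ∀ t, t ∉ Icc a b → L (t, ζ) = 0 := by
    have hae : ∀ᵐ t, t ∈ (Icc a b)ᶜ → L (t, ζ) = 0 := by
      filter_upwards [l1, f0] with t h1 h2 h3
      rw [← h1 (mem_univ _), h2 h3]
    intro t ht
    have hc : ContinuousAt (fun t => L (t, ζ)) t := by
      have := (p2 (t - 1) (t + 1) (by linarith)).continuousOn
      rw [uIcc_of_le (by linarith)] at this
      exact this.continuousAt (Icc_mem_nhds (by linarith) (by linarith))
    by_contra hne0
    have hev : ∀ᶠ s in 𝓝 t, L (s, ζ) ≠ 0 ∧ s ∈ (Icc a b)ᶜ :=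
      (hc.eventually_ne hne0).and (isClosed_Icc.isOpen_compl.mem_nhds ht)
    have hpos : 0 < volume {s | L (s, ζ) ≠ 0 ∧ s ∈ (Icc a b)ᶜ} :=
      Measure.measure_pos_of_mem_nhds volume hev
    refine hpos.ne' (measure_mono_null (fun s hs => ?_) (ae_iff.1 hae))
    simp only [mem_ofPred_eq, Classical.not_imp] at hs ⊢
    exact ⟨hs.2, hs.1⟩
  have hm := ((p1 a' b' hab').mul (p2 a' b' hab').conj).sub_eq
  have q1 := p1 a' b' hab'
  have q2 := (p2 a' b' hab').conj
  rw [intervalIntegral.integral_add (q1.integrable.mul_continuousOn q2.continuousOn)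
    (q2.integrable.continuousOn_mul q1.continuousOn)] at hm
  rw [hL0 a' (fun h => by have := h.1; rw [ha'] at this; linarith),
    hL0 b' (fun h => by have := h.2; rw [hb'] at this; linarith)] at hm
  simp only [map_zero, mul_zero, sub_self] at hm
  have hsub : Icc a b ⊆ Ioc a' b' := fun x hx =>
    ⟨by rw [ha']; linarith [hx.1], by rw [hb']; linarith [hx.2]⟩
  have key : ∀ g g' : ℝ → ℂ, (∀ᵐ t, t ∉ Icc a b → g t = 0 ∧ g' t = 0) →
      (∀ᵐ t, t ∈ Icc a b → g t = g' t) → ∫ t, g t = ∫ t in a'..b', g' t := by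
    intro g g' h0 h1
    rw [intervalIntegral.integral_of_le hab', ← integral_indicator measurableSet_Ioc]
    refine integral_congr_ae ?_
    filter_upwards [h0, h1] with t h2 h3
    by_cases ht : t ∈ Icc a b
    · rw [indicator_of_mem (hsub ht), h3 ht]
    · rw [(h2 ht).1]
      by_cases ht' : t ∈ Ioc a' b'
      · rw [indicator_of_mem ht', (h2 ht).2]
      · rw [indicator_of_notMem ht']
  have k1 := key (fun t => U (t, ζ) * conj (Ψ (t, ζ))) (fun t => W (t, ζ) * conj (Ψ (t, ζ)))
    (by filter_upwards [g0] with t h ht; simp [h ht])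
    (by filter_upwards [uw] with t h ht; rw [h (hIJ ht)])
  have k2 := key (fun t => V (t, ζ) * conj (Φ (t, ζ))) (fun t => Z (t, ζ) * conj (L (t, ζ)))
    (by filter_upwards [f0] with t h ht; simp [h ht, hL0 t ht])
    (by filter_upwards [vz, l1] with t h h' ht; rw [h (hIJ ht), h' (mem_univ _)])
  rw [k1, k2, eq_neg_iff_add_eq_zero, add_comm]
  exact hm.symm

theorem isWeakTransport_of_isFT (hJ : J.OrdConnected) {u y : Pt d → ℂ} {V W Z : Pt d → ℂ}
    (hu : IsFT u U) (hy : IsFT y V)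
    (hUW : ∀ᵐ z, z.1 ∈ J → U z = W z) (hVZ : ∀ᵐ z, z.1 ∈ J → V z = Z z)
    (hp : ∀ᵐ ζ : Sp d × Sp d, ∀ a b, a ≤ b → IsPrim (fun t => W (t, ζ)) (fun t => Z (t, ζ)) a b) :
    IsWeakTransport (cyl d J) (fun z => (u z).re) fun z => (y z).re := by
  intro φ hφ
  obtain ⟨Φ, hΦ⟩ := exists_isFT (u := cpx φ) hφ.memLp.ofReal
  obtain ⟨Ψ, hΨ⟩ := exists_isFT (u := cpx (transport φ)) hφ.transport.memLp.ofReal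
  rw [setIntegral_re_mul_test hu.left hφ.transport, setIntegral_re_mul_test hy.left hφ,
    hu.parseval hΨ, hy.parseval hΦ, ← Complex.neg_re,
    integral_transport_freq hJ hφ hΦ hΨ hu.right hy.right hUW hVZ hp]

theorem IsFT.ae_eq_zero_left {u : Pt d → ℂ} (h : IsFT u U) (hJ : MeasurableSet J)
    (h0 : ∀ᵐ z, z.1 ∈ J → U z = 0) : ∀ᵐ z, z.1 ∈ J → u z = 0 := by
  have h1 := h.mul_time (b := J.indicator fun _ => 1) (measurable_const.indicator hJ) (C := 1)
    (fun t => by by_cases ht : t ∈ J <;> simp [ht])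
  have h2 := (h1.congr (Eventually.of_forall fun _ => rfl) (by
    filter_upwards [h0] with z hz
    by_cases hzJ : z.1 ∈ J
    · simp [hz hzJ]
    · simp [hzJ])).ae_unique_left isFT_zero
  filter_upwards [h2] with z hz hzJ
  simpa [hzJ] using hz

end Converse

/-! ### Construction of solutions from the Duhamel integral -/

section Solution

variable {a : ℝ → Matrix (Fin d) (Fin d) ℝ} {δ lam : ℝ} {J : Set ℝ} {F : Pt d → ℂ}

/-- The Duhamel solution of `∂_t W + rate W = F`. -/
def duhSol (a : ℝ → Matrix (Fin d) (Fin d) ℝ) (lam : ℝ) (F : Pt d → ℂ) (z : Pt d) : ℂ :=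
  ∫ s in Iic z.1, (prop (rate a lam z.2) z.1 s : ℂ) * F (s, z.2)

theorem enorm_duhSol_le (z : Pt d) :
    ‖duhSol a lam F z‖ₑ ≤ duh (rate a lam z.2) (fun s => ‖F (s, z.2)‖ₑ) z.1 := by
  refine (enorm_integral_le_lintegral_enorm _).trans (le_of_eq ?_)
  simp only [enorm_mul, enorm_prop, duh]

/-- The exponent is a difference of time primitives of the rate based at `0`, which are jointly
measurable in all variables. -/
theorem IsCoeff.measurable_prop (ha : IsCoeff δ a) (hδ : 0 < δ) (hl : 0 ≤ lam) :
    Measurable fun q : Pt d × ℝ => prop (rate a lam q.1.2) q.1.1 q.2 := by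
  have hr : StronglyMeasurable fun z : Pt d => (rate a lam z.2 z.1 : ℂ) :=
    (Complex.measurable_ofReal.comp (ha.measurable_quad.add_const lam)).stronglyMeasurable
  have hR := stronglyMeasurable_timePrim 0 hr
  have e : ∀ q : Pt d × ℝ, prop (rate a lam q.1.2) q.1.1 q.2 =
      Real.exp (-((timePrim 0 (fun z : Pt d => (rate a lam z.2 z.1 : ℂ)) q.1).re -
        (timePrim 0 (fun z : Pt d => (rate a lam z.2 z.1 : ℂ)) (q.2, q.1.2)).re)) := by
    intro q
    have hc := ha.isRate hδ hl q.1.2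
    simp only [timePrim, prop, intervalIntegral.integral_ofReal, Complex.ofReal_re]
    rw [intervalIntegral.integral_interval_sub_left (hc.intervalIntegrable _ _)
      (hc.intervalIntegrable _ _)]
  simp only [e]
  have h1 : Measurable fun q : Pt d × ℝ =>
      (timePrim 0 (fun z : Pt d => (rate a lam z.2 z.1 : ℂ)) q.1).re :=
    Complex.measurable_re.comp (hR.measurable.comp measurable_fst)
  have h2 : Measurable fun q : Pt d × ℝ =>
      (timePrim 0 (fun z : Pt d => (rate a lam z.2 z.1 : ℂ)) (q.2, q.1.2)).re :=
    Complex.measurable_re.comp (hR.measurable.comp (by fun_prop))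
  exact Real.measurable_exp.comp (h1.sub h2).neg

theorem IsCoeff.stronglyMeasurable_duhSol (ha : IsCoeff δ a) (hδ : 0 < δ) (hl : 0 ≤ lam)
    (hF : StronglyMeasurable F) : StronglyMeasurable (duhSol a lam F) := by
  have h1 : StronglyMeasurable fun q : Pt d × ℝ =>
      (prop (rate a lam q.1.2) q.1.1 q.2 : ℂ) * F (q.2, q.1.2) :=
    (Complex.measurable_ofReal.comp (ha.measurable_prop hδ hl)).stronglyMeasurable.mul
      (hF.comp_measurable (by fun_prop))
  have hS : MeasurableSet {q : Pt d × ℝ | q.2 ≤ q.1.1} :=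
    measurableSet_le measurable_snd (by fun_prop)
  have h2 := (h1.indicator hS).integral_prod_right' (ν := (volume : Measure ℝ))
  have e : duhSol a lam F = fun z => ∫ s, ({q : Pt d × ℝ | q.2 ≤ q.1.1}.indicator
      fun q : Pt d × ℝ => (prop (rate a lam q.1.2) q.1.1 q.2 : ℂ) * F (q.2, q.1.2)) (z, s) := by
    funext z
    rw [duhSol, ← integral_indicator measurableSet_Iic]
    rfl
  rw [e]
  exact h2

/-- The solution in the physical variables, built from the Duhamel solution. -/
theorem IsCoeff.exists_solution (ha : IsCoeff δ a) (hδ : 0 < δ) (hδ1 : δ < 1) (hl : 0 ≤ lam)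
    (hJ : IsOpen J) (hJc : J.OrdConnected) {f : Pt d → ℝ}
    (hF : IsFT (ext0 (cyl d J) f) F)
    (hint : ∀ᵐ ζ : Sp d × Sp d, ∀ t,
      IntegrableOn (fun s => (prop (rate a lam ζ) t s : ℂ) * F (s, ζ)) (Iic t))
    (hU2 : MemLp ((cyl d J).indicator (duhSol a lam F)) 2) :
    ∃ (uc : Pt d → ℂ) (p : Pt d → Sp d) (H : Pt d → EuclideanSpace ℝ (Fin d × Fin d))
      (Y : Pt d → ℝ), IsFT uc ((cyl d J).indicator (duhSol a lam F)) ∧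
      HasS2 (cyl d J) (fun z => (uc z).re) p H Y ∧
      (∀ᵐ z ∂leb (cyl d J), P0 a H Y z + lam * (uc z).re = f z) ∧
      normL2 (cyl d J) Y ≤ ENNReal.ofReal (4 * δ⁻¹) * normL2 (cyl d J) f := by
  have hG := (isOpen_cyl (d := d) hJ).measurableSet
  set U : Pt d → ℂ := (cyl d J).indicator (duhSol a lam F) with hUdef
  have hUm : AEStronglyMeasurable U volume := hU2.1
  have hle : ∀ᵐ z : Pt d, ‖U z‖ₑ ≤ duh (rate a lam z.2) (fun s => ‖F (s, z.2)‖ₑ) z.1 := by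
    refine Eventually.of_forall fun z => ?_
    refine le_trans ?_ (enorm_duhSol_le z)
    by_cases hz : z ∈ cyl d J
    · simp [hUdef, hz]
    · simp [hUdef, hz]
  have fb := fun (g : Pt d → ℂ) hg hgw =>
    freq_bound ha hδ hδ1 hl hUm hF.right hle (g := g) hg hgw
  have hs3 := fun z : Pt d => symb_nonneg (1 / 3) z.2.1
  have hηm : ∀ i, Measurable fun z : Pt d => (eta z i : ℂ) := fun i =>
    Complex.measurable_ofReal.comp (continuous_eta_apply i).measurable
  have bH := fun i j => (fb (fun z => -((eta z i * eta z j : ℝ) : ℂ))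
    (by push_cast; exact ((hηm i).mul (hηm j)).neg) fun z => by
      rw [norm_neg, Complex.norm_real, Real.norm_eq_abs, abs_mul, wt]
      have := mul_le_mul (abs_eta_le z i) (abs_eta_le z j) (abs_nonneg _) (norm_nonneg _)
      nlinarith [hs3 z]).1
  -- For `λ = 0` the weight `wt` does not control `|η_i|`. The bound `|η_i| ≤ 1 + η_i²` is used
  -- together with `U ∈ L_2`.
  have bp : ∀ i, MemLp (fun z => Complex.I * (eta z i : ℂ) * U z) 2 := fun i => by
    have hm : AEStronglyMeasurable (fun z => Complex.I * (eta z i : ℂ) * U z) volume :=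
      (measurable_const.mul (hηm i)).aestronglyMeasurable.mul hUm
    refine (hU2.norm.add (bH i i).norm).mono' hm (Eventually.of_forall fun z => ?_)
    simp only [Pi.add_apply, norm_mul, norm_neg, Complex.norm_real, Complex.norm_I, one_mul,
      Real.norm_eq_abs]
    nlinarith [norm_nonneg (U z), sq_nonneg (|eta z i| - 1), abs_nonneg (eta z i),
      mul_nonneg (norm_nonneg (U z)) (sq_nonneg (|eta z i| - 1)),
      mul_nonneg (norm_nonneg (U z)) (abs_nonneg (eta z i))]
  have bl := weight_bound (w := fun _ => lam) hUm hF.right hle measurable_const (fun _ => hl)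
    ENNReal.one_ne_top fun ζ f hf => by simpa using ha.bound_lam hδ hl ζ hf
  have bq := weight_bound (w := fun z => quad a z.1 (eta z)) hUm hF.right hle
    ha.measurable_quad (fun z => ha.quad_nonneg hδ _ _) ENNReal.ofReal_ne_top
    fun ζ f hf => ha.bound_quad hδ hl ζ hf
  -- The transform of `∂_t u - v · D_x u`, read off from the equation. Its norm is at most `(1 +
  -- 2δ⁻¹ + 1)‖F‖`, hence `4δ⁻¹‖F‖`.
  set V : Pt d → ℂ := fun z => F z + (-1 : ℂ) * (((quad a z.1 (eta z) : ℝ) : ℂ) * U z +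
    (lam : ℂ) * U z) with hVdef
  have hV2 : MemLp V 2 := hF.right.add ((bq.1.add bl.1).const_mul (-1))
  have hVn : eLpNorm V 2 volume ≤ ENNReal.ofReal (4 * δ⁻¹) * eLpNorm F 2 volume := by
    have hi : 1 ≤ δ⁻¹ := (one_le_inv₀ hδ).2 hδ1.le
    refine (eLpNorm_add_le hF.right.1 ((bq.1.add bl.1).const_mul (-1)).1 (by norm_num)).trans ?_
    have e : eLpNorm (fun z => (-1 : ℂ) * (((quad a z.1 (eta z) : ℝ) : ℂ) * U z +
        (lam : ℂ) * U z)) 2 volume ≤ ENNReal.ofReal (2 * δ⁻¹) * eLpNorm F 2 volume +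
          1 * eLpNorm F 2 volume := by
      refine le_trans (le_of_eq ?_) ((eLpNorm_add_le bq.1.1 bl.1.1 (by norm_num)).trans
        (add_le_add bq.2 bl.2))
      refine eLpNorm_congr_norm_ae (Eventually.of_forall fun z => ?_)
      rw [norm_mul, norm_neg, norm_one, one_mul]
      rfl
    refine (add_le_add le_rfl e).trans ?_
    rw [one_mul, show (4 * δ⁻¹ : ℝ) = 2 * δ⁻¹ + (δ⁻¹ + δ⁻¹) by ring,
      ENNReal.ofReal_add (by positivity) (by positivity),
      ENNReal.ofReal_add (by positivity) (by positivity)]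
    have h1 : 1 ≤ ENNReal.ofReal δ⁻¹ := by rw [← ENNReal.ofReal_one]; gcongr
    have h2 : eLpNorm F 2 volume ≤ ENNReal.ofReal δ⁻¹ * eLpNorm F 2 volume :=
      le_mul_of_one_le_left' h1
    calc _ = ENNReal.ofReal (2 * δ⁻¹) * eLpNorm F 2 volume +
          (eLpNorm F 2 volume + eLpNorm F 2 volume) := by ring
      _ ≤ ENNReal.ofReal (2 * δ⁻¹) * eLpNorm F 2 volume +
          (ENNReal.ofReal δ⁻¹ * eLpNorm F 2 volume + ENNReal.ofReal δ⁻¹ * eLpNorm F 2 volume) := by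
        gcongr
      _ = _ := by ring
  obtain ⟨uc, huc⟩ := exists_isFT_inv hU2
  choose pc hpc using fun i => exists_isFT_inv (bp i)
  choose Hc hHc using fun i j => exists_isFT_inv (bH i j)
  obtain ⟨Yc, hYc⟩ := exists_isFT_inv hV2
  have hop : IsFT (fun z => Yc z - (∑ i, ∑ j, (a z.1 i j : ℂ) * Hc i j z) + lam * uc z) F := by
    refine (isFT_operator (lam := lam) ha huc hYc hHc).congr (Eventually.of_forall fun _ => rfl)
      (Eventually.of_forall fun z => ?_)
    simp only [hVdef, rate]
    push_cast
    ring
  have hae := hop.ae_unique_left hF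
  refine ⟨uc, fun z => WithLp.toLp 2 fun i => (pc i z).re,
    fun z => WithLp.toLp 2 fun q => (Hc q.1 q.2 z).re, fun z => (Yc z).re, huc, ?_, ?_, ?_⟩
  · refine ⟨huc.left.re.restrict _, ?_, ?_, hYc.left.re.restrict _, ?_, ?_, ?_⟩
    · exact memLp_of_apply fun i => (hpc i).left.re.restrict _
    · exact memLp_of_apply fun q => (hHc q.1 q.2).left.re.restrict _
    · exact fun i => isWeakDv_of_isFT huc (hpc i)
    · intro i j
      refine isWeakDv_of_isFT (hpc j) ((hHc i j).congr (Eventually.of_forall fun _ => rfl)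
        (Eventually.of_forall fun z => ?_))
      push_cast
      linear_combination -(eta z i * eta z j * U z : ℂ) * Complex.I_mul_I
    · refine isWeakTransport_of_isFT hJc huc hYc (W := duhSol a lam F)
        (Z := fun z => F z - (rate a lam z.2 z.1 : ℂ) * duhSol a lam F z)
        (Eventually.of_forall fun z hz => ?_) (Eventually.of_forall fun z hz => ?_) ?_
      · exact indicator_of_mem (show z ∈ cyl d J from hz) _
      · have : U z = duhSol a lam F z := indicator_of_mem (show z ∈ cyl d J from hz) _
        simp only [hVdef, this, rate]
        push_cast
        ring
      · filter_upwards [hint] with ζ hζ α β hαβ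
        exact (ha.isRate hδ hl ζ).isPrim_duhamel (F := fun s => F (s, ζ)) hαβ hζ
  · refine (ae_restrict_iff' hG).2 ?_
    filter_upwards [hae] with z hz hzG
    have h1 := congrArg Complex.re hz
    simp only [ext0, indicator_of_mem hzG, cpx, Complex.ofReal_re] at h1
    rw [← h1]
    simp only [P0, Complex.add_re, Complex.sub_re, Complex.re_sum, Complex.re_ofReal_mul]
  · refine (eLpNorm_re_le _).trans (hYc.eLpNorm_eq.trans_le (hVn.trans (le_of_eq ?_)))
    rw [← hF.eLpNorm_eq, eLpNorm_ext0 hG]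

end Solution

end

section



variable {d : ℕ}

/-! ### Time intervals and slabs -/

section Slabs

/-- The time interval `(S, T)`. -/
def tint (S T : EReal) : Set ℝ := {t | S < (t : EReal) ∧ (t : EReal) < T}

theorem slab_eq_cyl (S T : EReal) : slab d S T = cyl d (tint S T) := rfl

theorem isOpen_tint (S T : EReal) : IsOpen (tint S T) :=
  (isOpen_lt continuous_const continuous_coe_real_ereal).inter
    (isOpen_lt continuous_coe_real_ereal continuous_const)

theorem ordConnected_tint (S T : EReal) : (tint S T).OrdConnected :=
  ⟨fun _ hx _ hy _ hz => ⟨hx.1.trans_le (EReal.coe_le_coe_iff.2 hz.1),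
    (EReal.coe_le_coe_iff.2 hz.2).trans_lt hy.2⟩⟩

theorem isLowerSet_tint (T : EReal) : IsLowerSet (tint ⊥ T) := fun _ _ hab ha =>
  ⟨EReal.bot_lt_coe _, (EReal.coe_le_coe_iff.2 hab).trans_lt ha.2⟩

theorem isOpen_slab (S T : EReal) : IsOpen (slab d S T) := isOpen_cyl (isOpen_tint S T)

theorem tint_coe (S T : ℝ) : tint S T = Ioo S T := by
  ext t
  simp [tint]

theorem slab_subset_past (S T : EReal) : slab d S T ⊆ past d T := fun _ hz =>
  ⟨EReal.bot_lt_coe _, hz.2⟩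

end Slabs

/-! ### Restriction, differences and locality of weak derivatives -/

section Restriction

variable {G G' : Set (Pt d)} {u u' : Pt d → ℝ} {p p' : Pt d → Sp d}
  {H H' : Pt d → EuclideanSpace ℝ (Fin d × Fin d)} {Y Y' : Pt d → ℝ}

theorem IsTest.mono (h : IsTest G' u) (hs : G' ⊆ G) : IsTest G u :=
  ⟨h.smooth, h.compact, h.supp.trans hs⟩

theorem IsTest.eq_zero (h : IsTest G u) {z : Pt d} (hz : z ∉ G) : u z = 0 :=
  image_eq_zero_of_notMem_tsupport fun h' => hz (h.supp h')

theorem setIntegral_mul_test (hs : G' ⊆ G) (u : Pt d → ℝ) {φ : Pt d → ℝ}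
    (hφ : ∀ z, z ∉ G' → φ z = 0) : ∫ z in G, u z * φ z = ∫ z in G', u z * φ z := by
  rw [setIntegral_eq_integral_of_forall_compl_eq_zero fun z hz => by
      rw [hφ z fun h => hz (hs h), mul_zero],
    setIntegral_eq_integral_of_forall_compl_eq_zero fun z hz => by rw [hφ z hz, mul_zero]]

theorem IsWeakAlong.mono {X : Pt d → Pt d} (hX : ContDiff ℝ ∞ X) (hs : G' ⊆ G)
    (h : IsWeakAlong G X u u') : IsWeakAlong G' X u u' := by
  intro φ hφ
  have h1 := h φ (hφ.mono hs)
  rw [setIntegral_mul_test hs _ fun z hz => hφ.eq_zero hz,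
    setIntegral_mul_test hs u fun z hz => (hφ.fderiv_apply hX).eq_zero hz] at h1
  exact h1

theorem contDiff_transport_field : ContDiff ℝ ∞ fun z : Pt d => ((1, -z.2.2, 0) : Pt d) := by
  fun_prop

theorem HasS2.mono (h : HasS2 G u p H Y) (hs : G' ⊆ G) : HasS2 G' u p H Y where
  memLp_u := h.memLp_u.mono_measure (Measure.restrict_mono_set _ hs)
  memLp_p := h.memLp_p.mono_measure (Measure.restrict_mono_set _ hs)
  memLp_H := h.memLp_H.mono_measure (Measure.restrict_mono_set _ hs)
  memLp_Y := h.memLp_Y.mono_measure (Measure.restrict_mono_set _ hs)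
  weak_p i := IsWeakAlong.mono contDiff_const hs (h.weak_p i)
  weak_H i j := IsWeakAlong.mono contDiff_const hs (h.weak_H i j)
  weak_Y := IsWeakAlong.mono contDiff_transport_field hs h.weak_Y

theorem fracLapX_eq_zero (s : ℝ) {φ : Pt d → ℝ} {z : Pt d} (h : ∀ y, φ (z.1, y, z.2.2) = 0) :
    fracLapX s φ z = 0 := by
  simp [fracLapX, fracLap, h, Real.fourier_eq, Real.fourierInv_eq]

/-- The fractional Laplacian is nonlocal in `x` only. On a smaller cylinder the image of a test
function still vanishes outside the smaller time set. -/
theorem HasFrac.mono {J J' : Set ℝ} {w : Pt d → ℝ} {m : Pt d → Sp d}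
    (h : HasFrac (cyl d J) u w m) (hs : J' ⊆ J) : HasFrac (cyl d J') u w m := by
  have hs' : cyl d J' ⊆ cyl d J := fun z hz => hs hz
  have hz : ∀ (s : ℝ) {φ : Pt d → ℝ}, IsTest (cyl d J') φ → ∀ z, z ∉ cyl d J' →
      fracLapX s φ z = 0 := fun s φ hφ z hz => fracLapX_eq_zero s fun y => hφ.eq_zero hz
  refine ⟨h.memLp_w.mono_measure (Measure.restrict_mono_set _ hs'),
    h.memLp_m.mono_measure (Measure.restrict_mono_set _ hs'), fun φ hφ => ?_, fun i φ hφ => ?_⟩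
  · have h1 := h.eq_w φ (hφ.mono hs')
    rwa [setIntegral_mul_test hs' _ (hz _ hφ),
      setIntegral_mul_test hs' _ fun z hz => hφ.eq_zero hz] at h1
  · have h1 := h.eq_m i φ (hφ.mono hs')
    rwa [setIntegral_mul_test hs' _ (hz _ (hφ.dv i)),
      setIntegral_mul_test hs' _ fun z hz => hφ.eq_zero hz] at h1

theorem integrable_mul_test {g : Pt d → ℝ} (hg : MemLp g 2 (leb G)) {φ : Pt d → ℝ}
    (hφ : IsTest G φ) : Integrable (fun z => g z * φ z) (leb G) :=
  hg.integrable_mul (hφ.memLp.restrict G)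

theorem IsWeakAlong.sub {X : Pt d → Pt d} (hX : ContDiff ℝ ∞ X) {g g' : Pt d → ℝ}
    (hu : MemLp u 2 (leb G)) (hu' : MemLp u' 2 (leb G)) (hg : MemLp g 2 (leb G))
    (hg' : MemLp g' 2 (leb G)) (h : IsWeakAlong G X u g) (h' : IsWeakAlong G X u' g') :
    IsWeakAlong G X (fun z => u z - u' z) fun z => g z - g' z := by
  intro φ hφ
  have hφ' := hφ.fderiv_apply hX
  simp only [sub_mul]
  rw [integral_sub (integrable_mul_test hu hφ') (integrable_mul_test hu' hφ'),
    integral_sub (integrable_mul_test hg hφ) (integrable_mul_test hg' hφ), h φ hφ, h' φ hφ]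
  ring

theorem HasS2.sub (h : HasS2 G u p H Y) (h' : HasS2 G u' p' H' Y') :
    HasS2 G (fun z => u z - u' z) (fun z => p z - p' z) (fun z => H z - H' z)
      fun z => Y z - Y' z where
  memLp_u := h.memLp_u.sub h'.memLp_u
  memLp_p := h.memLp_p.sub h'.memLp_p
  memLp_H := h.memLp_H.sub h'.memLp_H
  memLp_Y := h.memLp_Y.sub h'.memLp_Y
  weak_p i := IsWeakAlong.sub contDiff_const h.memLp_u h'.memLp_u (MemLp.apply h.memLp_p i)
    (MemLp.apply h'.memLp_p i) (h.weak_p i) (h'.weak_p i)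
  weak_H i j := IsWeakAlong.sub contDiff_const (MemLp.apply h.memLp_p j) (MemLp.apply h'.memLp_p j)
    (MemLp.apply h.memLp_H (i, j)) (MemLp.apply h'.memLp_H (i, j)) (h.weak_H i j) (h'.weak_H i j)
  weak_Y := IsWeakAlong.sub contDiff_transport_field h.memLp_u h'.memLp_u h.memLp_Y h'.memLp_Y
    h.weak_Y h'.weak_Y

/-- A weak derivative of a function that vanishes is zero. -/
theorem IsWeakAlong.ae_eq_zero (hG : IsOpen G) {X : Pt d → Pt d} {g : Pt d → ℝ}
    (hu : ∀ᵐ z ∂leb G, u z = 0) (hg : MemLp g 2 (leb G)) (h : IsWeakAlong G X u g) :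
    ∀ᵐ z ∂leb G, g z = 0 := by
  have hl : LocallyIntegrableOn g G :=
    locallyIntegrableOn_of_locallyIntegrable_restrict (hg.locallyIntegrable (by norm_num))
  refine (ae_restrict_iff' hG.measurableSet).2
    (hG.ae_eq_zero_of_integral_contDiff_smul_eq_zero hl fun φ h1 h2 h3 => ?_)
  have hφ : IsTest G φ := ⟨h1, h2, h3⟩
  have h4 := h φ hφ
  have h5 : ∫ z in G, u z * fderiv ℝ φ z (X z) = 0 :=
    integral_eq_zero_of_ae (by filter_upwards [hu] with z hz; simp [hz])
  rw [h5, zero_eq_neg] at h4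
  rw [← h4, setIntegral_eq_integral_of_forall_compl_eq_zero fun z hz => by
    rw [hφ.eq_zero hz, mul_zero]]
  congr 1 with z
  rw [smul_eq_mul, mul_comm]

theorem HasS2.ae_eq_zero (h : HasS2 G u p H Y) (hG : IsOpen G) (hu : ∀ᵐ z ∂leb G, u z = 0) :
    (∀ᵐ z ∂leb G, p z = 0) ∧ (∀ᵐ z ∂leb G, H z = 0) ∧ ∀ᵐ z ∂leb G, Y z = 0 := by
  have hp : ∀ i, ∀ᵐ z ∂leb G, p z i = 0 := fun i =>
    IsWeakAlong.ae_eq_zero hG hu (MemLp.apply h.memLp_p i) (h.weak_p i)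
  have hH : ∀ q : Fin d × Fin d, ∀ᵐ z ∂leb G, H z q = 0 := fun q =>
    IsWeakAlong.ae_eq_zero hG (hp q.2) (MemLp.apply h.memLp_H q) (h.weak_H q.1 q.2)
  refine ⟨?_, ?_, IsWeakAlong.ae_eq_zero hG hu h.memLp_Y h.weak_Y⟩
  · filter_upwards [ae_all_iff.2 hp] with z hz
    ext i
    exact hz i
  · filter_upwards [ae_all_iff.2 hH] with z hz
    ext q
    exact hz q

theorem P0_sub (a : ℝ → Matrix (Fin d) (Fin d) ℝ) (z : Pt d) :
    P0 a (fun z => H z - H' z) (fun z => Y z - Y' z) z = P0 a H Y z - P0 a H' Y' z := by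
  simp only [P0, PiLp.sub_apply, mul_sub, Finset.sum_sub_distrib]
  ring

end Restriction

/-! ### Uniqueness on half lines in time -/

section Uniqueness

variable {a : ℝ → Matrix (Fin d) (Fin d) ℝ} {δ lam : ℝ} {J : Set ℝ} {u : Pt d → ℝ}
  {p : Pt d → Sp d} {H : Pt d → EuclideanSpace ℝ (Fin d × Fin d)} {Y : Pt d → ℝ}

/-- The homogeneous equation on `(-∞, T)` has only the trivial solution. -/
theorem HasS2.ae_eq_zero_of_P0 (h : HasS2 (cyl d J) u p H Y) (ha : IsCoeff δ a) (hδ : 0 < δ)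
    (hl : 0 ≤ lam) (hJ : IsOpen J) (hJl : IsLowerSet J)
    (h0 : ∀ᵐ z ∂leb (cyl d J), P0 a H Y z + lam * u z = 0) : ∀ᵐ z ∂leb (cyl d J), u z = 0 := by
  have hG := (isOpen_cyl (d := d) hJ).measurableSet
  obtain ⟨U, hU⟩ := exists_isFT (memLp_ext0 hG h.memLp_u)
  have hF : IsFT (ext0 (cyl d J) fun z => P0 a H Y z + lam * u z) fun _ => 0 := by
    refine isFT_zero.congr ?_ (Eventually.of_forall fun _ => rfl)
    filter_upwards [(ae_restrict_iff' hG).1 h0] with z hz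
    by_cases hzG : z ∈ cyl d J
    · simp only [ext0, indicator_of_mem hzG, cpx, hz hzG, Complex.ofReal_zero]
    · simp [ext0, hzG]
  have hU0 : U =ᵐ[volume] fun _ => 0 := by
    filter_upwards [h.ae_le_duh ha hδ hl hJ hJl hU hF] with z hz
    simpa [duh] using hz
  have hu0 := (hU.congr (Eventually.of_forall fun _ => rfl) hU0).ae_unique_left isFT_zero
  refine (ae_restrict_iff' hG).2 ?_
  filter_upwards [hu0] with z hz hzG
  simpa [ext0, hzG] using hz

end Uniqueness

/-! ### Existence for positive `λ` and for the Cauchy problem -/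

section Existence

variable {a : ℝ → Matrix (Fin d) (Fin d) ℝ} {δ lam : ℝ}

/-- From `x ≤ 1 + x²`. It yields an integrable majorant of propagator times `|f|` out of one for the
propagator and `|f|²`. -/
theorem le_add_mul_sq {x q g : ℝ} (hq : 0 ≤ q) (hq1 : q ≤ 1) (hqg : q ≤ g) :
    q * x ≤ g + x ^ 2 := by
  nlinarith [sq_nonneg (x - 1), mul_nonneg (sub_nonneg.2 hq1) (sq_nonneg x),
    mul_nonneg hq (sq_nonneg (x - 1))]

theorem IsCoeff.prop_le_exp (ha : IsCoeff δ a) (hδ : 0 < δ) (hl : 0 ≤ lam) (ζ : Sp d × Sp d)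
    {s t : ℝ} (hst : s ≤ t) : prop (rate a lam ζ) t s ≤ Real.exp (-(lam * (t - s))) := by
  rw [prop, Real.exp_le_exp, neg_le_neg_iff]
  refine le_trans ?_ (ha.integral_rate_ge hδ hl ζ hst)
  have : 0 ≤ ∫ r in s..t, ‖eta (r, ζ)‖ ^ 2 :=
    intervalIntegral.integral_nonneg hst fun r _ => by positivity
  nlinarith [mul_nonneg hδ.le this]

theorem exists_stronglyMeasurable_isFT {u : Pt d → ℂ} (hu : MemLp u 2) :
    ∃ U, StronglyMeasurable U ∧ IsFT u U := by
  obtain ⟨U, hU⟩ := exists_isFT hu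
  exact ⟨hU.right.1.mk U, hU.right.1.stronglyMeasurable_mk,
    hU.congr (Eventually.of_forall fun _ => rfl) hU.right.1.ae_eq_mk⟩

/-- Integrability of the Duhamel integrand from an integrable majorant of the propagator. -/
theorem integrableOn_prop_mul {c : ℝ → ℝ} (hc : IsRate c) {f : ℝ → ℂ} (hf : MemLp f 2) {t : ℝ}
    {g : ℝ → ℝ} (hg : IntegrableOn g (Iic t))
    (hle : ∀ᵐ s, s ≤ t → f s = 0 ∧ 0 ≤ g s ∨ prop c t s ≤ g s) :
    IntegrableOn (fun s => (prop c t s : ℂ) * f s) (Iic t) := by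
  have h2 : Integrable fun s => ‖f s‖ ^ 2 := hf.integrable_norm_pow two_ne_zero
  have hm : AEStronglyMeasurable (fun s => (prop c t s : ℂ) * f s) volume :=
    (Complex.continuous_ofReal.comp (hc.continuous_prop.comp
      (Continuous.prodMk_right t))).aestronglyMeasurable.mul hf.1
  refine (hg.add h2.integrableOn).mono' hm.restrict ((ae_restrict_iff' measurableSet_Iic).2 ?_)
  filter_upwards [hle] with s hs hst
  rw [norm_mul, Complex.norm_real, Real.norm_of_nonneg (prop_pos c t s).le]
  rcases hs hst with ⟨h, h'⟩ | h
  · simpa [h] using h'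
  · exact le_add_mul_sq (prop_pos c t s).le (hc.prop_le_one hst) h

theorem IsCoeff.exists_isSol (ha : IsCoeff δ a) (hδ : 0 < δ) (hδ1 : δ < 1) (hl : 0 < lam)
    {J : Set ℝ} (hJ : IsOpen J) (hJc : J.OrdConnected) {f : Pt d → ℝ}
    (hf : MemLp f 2 (leb (cyl d J))) : ∃ u, IsSol a lam (cyl d J) f u := by
  have hG := (isOpen_cyl (d := d) hJ).measurableSet
  obtain ⟨F, hFm, hF⟩ := exists_stronglyMeasurable_isFT (memLp_ext0 hG hf)
  have hint : ∀ᵐ ζ : Sp d × Sp d, ∀ t,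
      IntegrableOn (fun s => (prop (rate a lam ζ) t s : ℂ) * F (s, ζ)) (Iic t) := by
    filter_upwards [ae_memLp_slice hF.right] with ζ hζ t
    have hg : IntegrableOn (fun s => Real.exp (-(lam * (t - s)))) (Iic t) := by
      refine ⟨(by fun_prop : Continuous _).aestronglyMeasurable, ?_⟩
      rw [hasFiniteIntegral_iff_ofReal (Eventually.of_forall fun s => (Real.exp_pos _).le),
        lintegral_exp_Iic hl]
      exact ENNReal.ofReal_lt_top
    exact integrableOn_prop_mul (ha.isRate hδ hl.le ζ) hζ hg
      (Eventually.of_forall fun s hs => Or.inr (ha.prop_le_exp hδ hl.le ζ hs))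
  have hUm : AEStronglyMeasurable ((cyl d J).indicator (duhSol a lam F)) volume :=
    ((ha.stronglyMeasurable_duhSol hδ hl.le hFm).indicator hG).aestronglyMeasurable
  have hle : ∀ᵐ z : Pt d, ‖(cyl d J).indicator (duhSol a lam F) z‖ₑ ≤
      duh (rate a lam z.2) (fun s => ‖F (s, z.2)‖ₑ) z.1 :=
    Eventually.of_forall fun z => (enorm_indicator_le_enorm_self _ _).trans (enorm_duhSol_le z)
  have bl := weight_bound (w := fun _ => lam) hUm hF.right hle measurable_const (fun _ => hl.le)
    ENNReal.one_ne_top fun ζ f hf => by simpa using ha.bound_lam hδ hl.le ζ hf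
  -- Here `λ > 0` is essential: the weighted bound is divided by `λ`.
  have hU2 : MemLp ((cyl d J).indicator (duhSol a lam F)) 2 := by
    refine (bl.1.const_mul (lam : ℂ)⁻¹).ae_eq (Eventually.of_forall fun z => ?_)
    have : (lam : ℂ) ≠ 0 := by exact_mod_cast hl.ne'
    simp only [← mul_assoc, inv_mul_cancel₀ this, one_mul]
  obtain ⟨uc, p, H, Y, -, hS, heq, -⟩ := ha.exists_solution hδ hδ1 hl.le hJ hJc hF hint hU2
  exact ⟨_, p, H, Y, hS, heq⟩

/-- Energy bound for the Duhamel solution of a right hand side supported in `(S, T)`. -/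
theorem IsCoeff.cauchy_bound (ha : IsCoeff δ a) (hδ : 0 < δ) {S T : ℝ} {F : Pt d → ℂ}
    (hF : MemLp F 2) (hFm : StronglyMeasurable F) (h0 : ∀ᵐ z, z.1 ∉ Ioo S T → F z = 0) :
    MemLp ((past d T).indicator (duhSol a 0 F)) 2 ∧
      eLpNorm ((past d T).indicator (duhSol a 0 F)) 2 volume ≤
        ENNReal.ofReal (T - S) * eLpNorm F 2 volume := by
  have hG := (isOpen_slab (d := d) ⊥ T).measurableSet
  have hUm : AEStronglyMeasurable ((past d T).indicator (duhSol a 0 F)) volume :=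
    ((ha.stronglyMeasurable_duhSol hδ le_rfl hFm).indicator hG).aestronglyMeasurable
  have key := slice_bound (w := fun _ => 1) hUm hF measurable_const (fun _ => zero_le_one)
    (C := ENNReal.ofReal (T - S)) ENNReal.ofReal_ne_top ?_
  · simpa using key
  filter_upwards [ae_slice h0] with ζ hζ
  -- Without `λ` the propagator is only bounded by `1`, but both times lie in `(S, T)`. Rows and
  -- columns of the indicator kernel then have mass at most `T - S`.
  let A : Set (ℝ × ℝ) := {q | S < q.2 ∧ q.2 ≤ q.1 ∧ q.1 < T}
  have hA : MeasurableSet A :=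
    (measurableSet_lt measurable_const measurable_snd).inter
      ((measurableSet_le measurable_snd measurable_fst).inter
        (measurableSet_lt measurable_fst measurable_const))
  let K : ℝ → ℝ → ENNReal := fun t s => A.indicator (fun _ => 1) (t, s)
  have hK : Measurable (uncurry K) := measurable_const.indicator hA
  have hK1 : ∀ t s, K t s ≤ (Ioo S T).indicator (fun _ => 1) s := fun t s => by
    by_cases h : (t, s) ∈ A
    · have hs : s ∈ Ioo S T := ⟨h.1, h.2.1.trans_lt h.2.2⟩
      simp [K, h, hs]
    · simp [K, h]
  have hK2 : ∀ t s, K t s ≤ (Ioo S T).indicator (fun _ => 1) t := fun t s => by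
    by_cases h : (t, s) ∈ A
    · have hs : t ∈ Ioo S T := ⟨h.1.trans_le h.2.1, h.2.2⟩
      simp [K, h, hs]
    · simp [K, h]
  have hI : ∫⁻ s, (Ioo S T).indicator (fun _ => (1 : ENNReal)) s = ENNReal.ofReal (T - S) := by
    rw [lintegral_indicator measurableSet_Ioo]
    simp
  have hFs : AEMeasurable fun s => ‖F (s, ζ)‖ₑ :=
    ((hFm.comp_measurable (Continuous.prodMk_left ζ).measurable).enorm).aemeasurable
  have hsch := lintegral_schur hK hFs (fun t => (lintegral_mono (hK1 t)).trans hI.le)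
    (fun s => (lintegral_mono fun t => hK2 t s).trans hI.le)
  rw [← pow_two] at hsch
  refine (lintegral_mono fun t => ?_).trans hsch
  refine pow_le_pow_left' ?_ 2
  rw [ENNReal.ofReal_one, one_mul]
  by_cases ht : (t, ζ) ∈ past d T
  · have htT : t < T := EReal.coe_lt_coe_iff.1 ht.2
    rw [indicator_of_mem ht]
    refine (enorm_duhSol_le _).trans ?_
    rw [duh, ← lintegral_indicator measurableSet_Iic]
    refine lintegral_mono_ae ?_
    filter_upwards [hζ] with s hs
    by_cases hst : s ∈ Iic t
    · rw [indicator_of_mem hst]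
      by_cases hsI : s ∈ Ioo S T
      · have hA' : (t, s) ∈ A := ⟨hsI.1, hst, htT⟩
        simp only [K, indicator_of_mem hA']
        refine mul_le_mul' ?_ le_rfl
        rw [← ENNReal.ofReal_one]
        exact ENNReal.ofReal_le_ofReal ((ha.isRate hδ le_rfl ζ).prop_le_one hst)
      · simp [hs hsI]
    · rw [indicator_of_notMem hst]
      exact zero_le
  · rw [indicator_of_notMem ht]
    simp

/-- The solution of the Cauchy problem, extended by zero to the past. -/
theorem IsCoeff.exists_cauchy (ha : IsCoeff δ a) (hδ : 0 < δ) (hδ1 : δ < 1) {S T : ℝ} {f : Pt d → ℝ}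
    (hf : MemLp f 2 (leb (slab d S T))) :
    ∃ (u : Pt d → ℝ) (p : Pt d → Sp d) (H : Pt d → EuclideanSpace ℝ (Fin d × Fin d))
      (Y : Pt d → ℝ), HasS2 (past d T) u p H Y ∧
      (∀ᵐ z ∂leb (past d S), u z = 0) ∧
      (∀ᵐ z ∂leb (past d T), P0 a H Y z = (slab d S T).indicator f z) ∧
      normL2 (past d T) u ≤ ENNReal.ofReal (T - S) * normL2 (slab d S T) f ∧
      normL2 (past d T) Y ≤ ENNReal.ofReal (4 * δ⁻¹) * normL2 (slab d S T) f := by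
  have hG := (isOpen_slab (d := d) ⊥ T).measurableSet
  have hG' := (isOpen_slab (d := d) S T).measurableSet
  have hsub := slab_subset_past (d := d) (S : EReal) T
  have hnorm : normL2 (past d T) ((slab d S T).indicator f) = normL2 (slab d S T) f := by
    rw [normL2, eLpNorm_indicator_eq_eLpNorm_restrict hG', Measure.restrict_restrict hG',
      inter_eq_left.2 hsub]
  have he : ext0 (past d T) ((slab d S T).indicator f) = ext0 (slab d S T) f := by
    funext z
    by_cases hz : z ∈ slab d S T
    · simp [ext0, hz, hsub hz, cpx]
    · by_cases hz' : z ∈ past d T <;> simp [ext0, hz, hz', cpx]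
  obtain ⟨F, hFm, hF⟩ := exists_stronglyMeasurable_isFT (memLp_ext0 hG' hf)
  have hF0 : ∀ᵐ z, z.1 ∉ Ioo S T → F z = 0 := by
    have h1 : IsFT (ext0 (cyl d (tint S T)) f) F := hF
    have := h1.ae_eq_zero_off (isOpen_tint S T).measurableSet
    rwa [tint_coe] at this
  have hFn : eLpNorm F 2 volume = normL2 (slab d S T) f := by
    rw [← hF.eLpNorm_eq, eLpNorm_ext0 hG']
  have hint : ∀ᵐ ζ : Sp d × Sp d, ∀ t,
      IntegrableOn (fun s => (prop (rate a 0 ζ) t s : ℂ) * F (s, ζ)) (Iic t) := by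
    filter_upwards [ae_memLp_slice hF.right, ae_slice hF0] with ζ hζ hζ0 t
    have hg : IntegrableOn ((Ioo S T).indicator fun _ => (1 : ℝ)) (Iic t) :=
      ((integrable_indicator_iff measurableSet_Ioo).2
        (integrableOn_const (by simp))).integrableOn
    refine integrableOn_prop_mul (ha.isRate hδ le_rfl ζ) hζ hg ?_
    filter_upwards [hζ0] with s hs hst
    by_cases hsI : s ∈ Ioo S T
    · right
      simpa [hsI] using (ha.isRate hδ le_rfl ζ).prop_le_one hst
    · left
      simp [hs hsI, hsI]
  obtain ⟨hU2, hUn⟩ := ha.cauchy_bound hδ hF.right hFm hF0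
  have hF' : IsFT (ext0 (cyl d (tint ⊥ T)) ((slab d S T).indicator f)) F := by
    rw [← slab_eq_cyl, he]
    exact hF
  obtain ⟨uc, p, H, Y, huc, hS, heq, hYn⟩ := ha.exists_solution hδ hδ1 le_rfl (isOpen_tint ⊥ T)
    (ordConnected_tint ⊥ T) hF' hint hU2
  refine ⟨fun z => (uc z).re, p, H, Y, hS, ?_, ?_, ?_, ?_⟩
  -- Before time `S` the Duhamel integral only sees times at which `F` vanishes.
  · have hU0 : ∀ᵐ z : Pt d, z.1 ∈ tint ⊥ S → (cyl d (tint ⊥ T)).indicator (duhSol a 0 F) z = 0 := by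
      have hz : ∀ᵐ z : Pt d, ∀ᵐ s, s ∉ Ioo S T → F (s, z.2) = 0 :=
        Measure.quasiMeasurePreserving_snd.ae (ae_slice hF0)
      filter_upwards [hz] with z hz hzS
      have hzS' : z.1 < S := EReal.coe_lt_coe_iff.1 hzS.2
      have : duhSol a 0 F z = 0 := by
        refine integral_eq_zero_of_ae ((ae_restrict_iff' measurableSet_Iic).2 ?_)
        filter_upwards [hz] with s hs hst
        rw [hs fun h => absurd (h.1.trans_le hst) (not_lt.2 hzS'.le)]
        simp
      by_cases hzT : z ∈ cyl d (tint ⊥ T) <;> simp [hzT, this]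
    refine (ae_restrict_iff' (isOpen_slab ⊥ S).measurableSet).2 ?_
    filter_upwards [huc.ae_eq_zero_left (isOpen_tint ⊥ S).measurableSet hU0] with z hz hzS
    rw [hz hzS, Complex.zero_re]
  · filter_upwards [heq] with z hz
    rw [← hz]
    simp
  · rw [← hFn]
    exact (eLpNorm_re_le _).trans (huc.eLpNorm_eq.trans_le hUn)
  · exact hYn.trans_eq (by rw [← slab_eq_cyl, hnorm])

end Existence

end

section



variable {d : ℕ}

/-! ### Uniqueness and estimates for the Cauchy problem -/

section CauchyProblem

variable {a : ℝ → Matrix (Fin d) (Fin d) ℝ} {δ lam : ℝ}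

theorem IsSol.ae_unique (ha : IsCoeff δ a) (hδ : 0 < δ) (hl : 0 ≤ lam) {T : EReal}
    {f u u' : Pt d → ℝ} (h : IsSol a lam (past d T) f u) (h' : IsSol a lam (past d T) f u') :
    ∀ᵐ z ∂leb (past d T), u' z = u z := by
  obtain ⟨p, H, Y, hS, heq⟩ := h
  obtain ⟨p', H', Y', hS', heq'⟩ := h'
  have hs : HasS2 (cyl d (tint ⊥ T)) _ _ _ _ := hS'.sub hS
  have h0 := hs.ae_eq_zero_of_P0 (lam := lam) ha hδ hl (isOpen_tint ⊥ T) (isLowerSet_tint T) (by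
    filter_upwards [heq, heq'] with z h1 h2
    rw [P0_sub]
    linear_combination h2 - h1)
  filter_upwards [h0] with z hz
  exact sub_eq_zero.1 hz

theorem ae_past_of_slab {S T : ℝ} {P : Pt d → Prop} (h1 : ∀ᵐ z ∂leb (past d S), P z)
    (h2 : ∀ᵐ z ∂leb (slab d S T), P z) : ∀ᵐ z ∂leb (past d T), P z := by
  have h3 : ∀ᵐ z : Pt d, z.1 ≠ S := by
    have : ∀ᵐ t : ℝ, t ≠ S := by
      rw [ae_iff]
      simp
    exact Measure.quasiMeasurePreserving_fst.ae this
  rw [ae_restrict_iff' (isOpen_slab _ _).measurableSet] at h1 h2 ⊢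
  filter_upwards [h1, h2, h3] with z h1 h2 h3 hz
  rcases lt_or_gt_of_ne h3 with h | h
  · exact h1 ⟨EReal.bot_lt_coe _, EReal.coe_lt_coe_iff.2 h⟩
  · exact h2 ⟨EReal.coe_lt_coe_iff.2 h, hz.2⟩

/-- The difference of the two extensions vanishes before `S`, hence so do its derivatives there. It
solves the homogeneous equation on all of `(-∞, T)`, the slice `t = S` being null, and uniqueness
with `λ = 0` applies. -/
theorem IsCauchySol.ae_unique (ha : IsCoeff δ a) (hδ : 0 < δ) {S T : ℝ} (hST : S < T)
    {f u u' : Pt d → ℝ} (h : IsCauchySol a S T f u) (h' : IsCauchySol a S T f u') :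
    ∀ᵐ z ∂leb (slab d S T), u' z = u z := by
  obtain ⟨-, v, p, H, Y, hS, hu, h0, heq⟩ := h
  obtain ⟨-, v', p', H', Y', hS', hu', h0', heq'⟩ := h'
  have hs := hS'.sub hS
  have hsub : past d S ⊆ past d T := fun z hz =>
    ⟨hz.1, hz.2.trans (EReal.coe_lt_coe_iff.2 hST)⟩
  obtain ⟨-, hH0, hY0⟩ := (hs.mono hsub).ae_eq_zero (isOpen_slab ⊥ S) (by
    filter_upwards [h0, h0'] with z h1 h2
    rw [h1, h2, sub_zero])
  have hP : ∀ᵐ z ∂leb (past d T),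
      P0 a (fun z => H' z - H z) (fun z => Y' z - Y z) z + 0 * (v' z - v z) = 0 := by
    refine ae_past_of_slab (S := S) ?_ ?_
    · filter_upwards [hH0, hY0] with z h1 h2
      simp [P0, h1, h2]
    · filter_upwards [heq, heq'] with z h1 h2
      rw [P0_sub, h1, h2]
      ring
  have hs' : HasS2 (cyl d (tint ⊥ T)) _ _ _ _ := hs
  have hz := hs'.ae_eq_zero_of_P0 (lam := 0) ha hδ le_rfl (isOpen_tint ⊥ T) (isLowerSet_tint T) hP
  have hz' := ae_mono (Measure.restrict_mono_set volume (slab_subset_past (d := d) (S : EReal) T)) hz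
  filter_upwards [hz', hu, hu'] with z h1 h2 h3
  rw [← h2, ← h3]
  exact sub_eq_zero.1 h1

/-- The constant of the Cauchy problem on an interval of length `τ`. -/
def cauchyConst (d : ℕ) (τ : ℝ) : ℝ :=
  τ + Real.sqrt τ * (2 * aprioriConst d) + 2 * aprioriConst d + 4

theorem aprioriConst_nonneg (d : ℕ) : 0 ≤ aprioriConst d := by unfold aprioriConst; positivity

theorem normL2_mono {F : Type*} [NormedAddCommGroup F] {G G' : Set (Pt d)} (hs : G' ⊆ G)
    (f : Pt d → F) : normL2 G' f ≤ normL2 G f :=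
  eLpNorm_mono_measure f (Measure.restrict_mono_set _ hs)

/-- The bound on `u` comes from the Duhamel integral and the one on `Y` from the quadratic weight.
The others follow from the a priori estimate with an artificial `λ`. -/
theorem IsCoeff.exists_cauchySol (hd : 1 ≤ d) (ha : IsCoeff δ a) (hδ : 0 < δ) (hδ1 : δ < 1)
    {S T : ℝ} (hST : S < T) {f : Pt d → ℝ} (hf : MemLp f 2 (leb (slab d S T))) :
    ∃ u, IsCauchySol a S T f u ∧
      ∀ p H Y, HasS2 (slab d S T) u p H Y → ∃ w m, HasFrac (slab d S T) u w m ∧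
        normL2 (slab d S T) u + normL2 (slab d S T) p + normL2 (slab d S T) H
          + normL2 (slab d S T) w + normL2 (slab d S T) m + normL2 (slab d S T) Y
        ≤ ENNReal.ofReal (cauchyConst d (T - S) * δ⁻¹) * normL2 (slab d S T) f := by
  have hsub := slab_subset_past (d := d) (S : EReal) T
  have hG' := (isOpen_slab (d := d) S T).measurableSet
  obtain ⟨u, p, H, Y, hS, hu0, hP, hun, hYn⟩ := ha.exists_cauchy hδ hδ1 hf
  refine ⟨u, ⟨⟨p, H, Y, hS.mono hsub⟩, u, p, H, Y, hS, Eventually.of_forall fun _ => rfl, hu0, ?_⟩,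
    fun p' H' Y' hS' => ?_⟩
  · filter_upwards [ae_mono (Measure.restrict_mono_set volume hsub) hP, ae_restrict_mem hG']
      with z h1 h2
    rw [h1, indicator_of_mem h2]
  set τ := T - S with hτ
  have hτ0 : 0 < τ := sub_pos.2 hST
  -- With `λ = τ⁻¹` the added term `λ u` has norm at most `‖f‖`, because `‖u‖ ≤ τ‖f‖`. The right
  -- hand side of the a priori estimate is then at most `2‖f‖`, and `√λ` costs a factor `√τ` in the
  -- bound for `D_v u`.
  have hlam : (0 : ℝ) ≤ τ⁻¹ := by positivity
  have hS2 : HasS2 (cyl d (tint ⊥ T)) u p H Y := hS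
  obtain ⟨w, m, hfr, hest⟩ := hS2.apriori (lam := τ⁻¹) hd ha hδ hδ1 hlam (isOpen_tint ⊥ T)
    (isLowerSet_tint T)
  rw [← slab_eq_cyl] at hfr hest
  refine ⟨w, m, HasFrac.mono (J := tint ⊥ T) (J' := tint S T) hfr
    fun t ht => ⟨EReal.bot_lt_coe _, ht.2⟩, ?_⟩
  set X := normL2 (slab d S T) f with hX
  have hnorm : normL2 (past d T) ((slab d S T).indicator f) = X := by
    rw [normL2, eLpNorm_indicator_eq_eLpNorm_restrict hG', Measure.restrict_restrict hG',
      inter_eq_left.2 hsub]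
  have hR : normL2 (past d T) (fun z => P0 a H Y z + τ⁻¹ * u z) ≤ 2 * X := by
    have e1 : normL2 (past d T) (fun z => P0 a H Y z + τ⁻¹ * u z) =
        normL2 (past d T) ((slab d S T).indicator f + τ⁻¹ • u) :=
      eLpNorm_congr_ae (by filter_upwards [hP] with z hz; simp [hz])
    have hfi : MemLp ((slab d S T).indicator f) 2 (leb (past d T)) := by
      rw [memLp_indicator_iff_restrict hG', Measure.restrict_restrict hG', inter_eq_left.2 hsub]
      exact hf
    rw [e1]
    refine (eLpNorm_add_le hfi.1 (hS.memLp_u.const_smul τ⁻¹).1 (by norm_num)).trans ?_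
    rw [two_mul]
    refine add_le_add hnorm.le ?_
    rw [eLpNorm_const_smul, ← ofReal_norm, Real.norm_of_nonneg hlam]
    refine (mul_le_mul' le_rfl hun).trans (le_of_eq ?_)
    rw [← mul_assoc, ← ENNReal.ofReal_mul hlam, inv_mul_cancel₀ hτ0.ne', ENNReal.ofReal_one, one_mul]
  set N := aprioriConst d with hN
  have hN0 : 0 ≤ N := aprioriConst_nonneg d
  have hi : 1 ≤ δ⁻¹ := (one_le_inv₀ hδ).2 hδ1.le
  set B := ENNReal.ofReal (2 * N * δ⁻¹) * X with hB
  have hest' : ENNReal.ofReal τ⁻¹ * normL2 (past d T) u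
        + ENNReal.ofReal (Real.sqrt τ⁻¹) * normL2 (past d T) p
        + normL2 (past d T) H + normL2 (past d T) w + normL2 (past d T) m ≤ B := by
    refine hest.trans ((mul_le_mul' le_rfl hR).trans (le_of_eq ?_))
    rw [hB, ← mul_assoc, mul_assoc 2 N, ENNReal.ofReal_mul (by norm_num : (0 : ℝ) ≤ 2),
      ENNReal.ofReal_ofNat]
    ring
  have hp : normL2 (past d T) p ≤ ENNReal.ofReal (Real.sqrt τ) * B := by
    have h1 : ENNReal.ofReal (Real.sqrt τ⁻¹) * normL2 (past d T) p ≤ B := by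
      refine le_trans ?_ hest'
      rw [add_assoc, add_assoc, add_comm (ENNReal.ofReal τ⁻¹ * _), add_assoc]
      exact le_self_add
    refine le_trans (le_of_eq ?_) (mul_le_mul' le_rfl h1)
    rw [← mul_assoc, ← ENNReal.ofReal_mul (Real.sqrt_nonneg _), ← Real.sqrt_mul hτ0.le,
      mul_inv_cancel₀ hτ0.ne', Real.sqrt_one, ENNReal.ofReal_one, one_mul]
  have hHwm : normL2 (past d T) H + normL2 (past d T) w + normL2 (past d T) m ≤ B := by
    refine le_trans ?_ hest'
    gcongr
    exact le_add_self
  -- The estimate is claimed for an arbitrary choice of derivatives on the slab; all choices agree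
  -- almost everywhere.
  obtain ⟨d1, d2, d3⟩ := ((hS.mono hsub).sub hS').ae_eq_zero (isOpen_slab S T)
    (Eventually.of_forall fun z => sub_self _)
  have ep : normL2 (slab d S T) p' = normL2 (slab d S T) p :=
    eLpNorm_congr_ae (by filter_upwards [d1] with z hz; exact (sub_eq_zero.1 hz).symm)
  have eH : normL2 (slab d S T) H' = normL2 (slab d S T) H :=
    eLpNorm_congr_ae (by filter_upwards [d2] with z hz; exact (sub_eq_zero.1 hz).symm)
  have eY : normL2 (slab d S T) Y' = normL2 (slab d S T) Y :=
    eLpNorm_congr_ae (by filter_upwards [d3] with z hz; exact (sub_eq_zero.1 hz).symm)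
  have hu1 : normL2 (past d T) u ≤ ENNReal.ofReal (τ * δ⁻¹) * X := by
    refine hun.trans (mul_le_mul' (ENNReal.ofReal_le_ofReal ?_) le_rfl)
    exact le_mul_of_one_le_right hτ0.le hi
  rw [ep, eH, eY]
  calc _ ≤ normL2 (past d T) u + normL2 (past d T) p + normL2 (past d T) H + normL2 (past d T) w
        + normL2 (past d T) m + normL2 (past d T) Y := by
        gcongr <;> exact normL2_mono hsub _
    _ = normL2 (past d T) u + normL2 (past d T) p +
        (normL2 (past d T) H + normL2 (past d T) w + normL2 (past d T) m) +
          normL2 (past d T) Y := by ring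
    _ ≤ ENNReal.ofReal (τ * δ⁻¹) * X + ENNReal.ofReal (Real.sqrt τ) * B + B +
        ENNReal.ofReal (4 * δ⁻¹) * X := by gcongr
    _ = _ := by
      rw [hB, cauchyConst, ← hN, add_mul, add_mul, add_mul,
        ENNReal.ofReal_add (by positivity) (by positivity),
        ENNReal.ofReal_add (by positivity) (by positivity),
        ENNReal.ofReal_add (by positivity) (by positivity), mul_assoc (Real.sqrt τ),
        ENNReal.ofReal_mul (Real.sqrt_nonneg τ)]
      ring

end CauchyProblem

end

end KFP

end

/-! ### The main theorem -/

theorem theorem4p1 (d : ℕ) (hd : 1 ≤ d) :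
    -- (i) the a priori estimate
    (∃ N : ℝ, ∀ (δ : ℝ) (a : ℝ → Matrix (Fin d) (Fin d) ℝ), 0 < δ → δ < 1 → KFP.IsCoeff δ a →
      ∀ (lam : ℝ) (T : EReal), 0 ≤ lam → T ≠ ⊥ →
      ∀ u p H Y, KFP.HasS2 (KFP.past d T) u p H Y →
        ∃ w m, KFP.HasFrac (KFP.past d T) u w m ∧
          ENNReal.ofReal lam * KFP.normL2 (KFP.past d T) u
            + ENNReal.ofReal (Real.sqrt lam) * KFP.normL2 (KFP.past d T) p
            + KFP.normL2 (KFP.past d T) H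
            + KFP.normL2 (KFP.past d T) w
            + KFP.normL2 (KFP.past d T) m
          ≤ ENNReal.ofReal (N * δ⁻¹)
            * KFP.normL2 (KFP.past d T) (fun z => KFP.P0 a H Y z + lam * u z)) ∧
    -- (ii) unique solvability for positive `lam`
    (∀ (δ : ℝ) (a : ℝ → Matrix (Fin d) (Fin d) ℝ), 0 < δ → δ < 1 → KFP.IsCoeff δ a →
      ∀ (lam : ℝ) (T : EReal), 0 < lam → T ≠ ⊥ →
      ∀ f : KFP.Pt d → ℝ, MemLp f 2 (KFP.leb (KFP.past d T)) →
        ∃ u, KFP.IsSol a lam (KFP.past d T) f u ∧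
          ∀ u', KFP.IsSol a lam (KFP.past d T) f u' →
            ∀ᵐ z ∂KFP.leb (KFP.past d T), u' z = u z) ∧
    -- (iii) the Cauchy problem on `(S, T)`; the constant depends on `d` and `T - S` only
    (∃ N : ℝ → ℝ, ∀ (δ : ℝ) (a : ℝ → Matrix (Fin d) (Fin d) ℝ), 0 < δ → δ < 1 → KFP.IsCoeff δ a →
      ∀ S T : ℝ, S < T →
      ∀ f : KFP.Pt d → ℝ, MemLp f 2 (KFP.leb (KFP.slab d S T)) →
        ∃ u, KFP.IsCauchySol a S T f u ∧
          (∀ u', KFP.IsCauchySol a S T f u' →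
            ∀ᵐ z ∂KFP.leb (KFP.slab d S T), u' z = u z) ∧
          ∀ p H Y, KFP.HasS2 (KFP.slab d S T) u p H Y →
            ∃ w m, KFP.HasFrac (KFP.slab d S T) u w m ∧
              KFP.normL2 (KFP.slab d S T) u
                + KFP.normL2 (KFP.slab d S T) p
                + KFP.normL2 (KFP.slab d S T) H
                + KFP.normL2 (KFP.slab d S T) w
                + KFP.normL2 (KFP.slab d S T) m
                + KFP.normL2 (KFP.slab d S T) Y
              ≤ ENNReal.ofReal (N (T - S) * δ⁻¹) * KFP.normL2 (KFP.slab d S T) f) := by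
  refine ⟨⟨KFP.aprioriConst d, fun δ a hδ hδ1 ha lam T hl _ u p H Y hS => ?_⟩,
    fun δ a hδ hδ1 ha lam T hl _ f hf => ?_,
    KFP.cauchyConst d, fun δ a hδ hδ1 ha S T hST f hf => ?_⟩
  · exact KFP.HasS2.apriori (J := KFP.tint ⊥ T) hS hd ha hδ hδ1 hl (KFP.isOpen_tint ⊥ T)
      (KFP.isLowerSet_tint T)
  · obtain ⟨u, hu⟩ := ha.exists_isSol hδ hδ1 hl (KFP.isOpen_tint ⊥ T) (KFP.ordConnected_tint ⊥ T)
      (f := f) hf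
    exact ⟨u, hu, fun u' hu' => KFP.IsSol.ae_unique ha hδ hl.le hu hu'⟩
  · obtain ⟨u, hu, hest⟩ := ha.exists_cauchySol hd hδ hδ1 hST hf
    exact ⟨u, hu, fun u' hu' => KFP.IsCauchySol.ae_unique ha hδ hST hu hu', hest⟩
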